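/- **Setting.** Let $M$ be a smooth (Hausdorff, second countable) $7$-manifold with a $G_2$-structure $\varphi\in\Omega^3(M)$, with induced metric $g=\langle\cdot,\cdot\rangle$, Levi-Civita connection $\nabla$, cross product $\langle Y\times Z,W\rangle=\varphi(Y,Z,W)$, and the induced orientation, chosen such that $\star(\varphi\wedge\beta)=-2\beta$ for $\beta\in\Lambda^2_7$; that is, at each point there is an oriented orthonormal basis in which $\varphi=e^{123}+e^{145}-e^{167}+e^{246}+e^{257}+e^{347}-e^{356}$. Put $\psi=\star\varphi$ and assume that $\varphi$ is nearly parallel, normalised so that $d\varphi=4\psi$. Let $S=\Lambda^0\oplus\Lambda^1$ be the real spinor bundle of $M$ (one-forms and tangent vectors being identified by $g$), with Clifford multiplication $Y\cdot(f,Z)=(\langle Y,Z\rangle,\,-fY-Y\times Z)$, extended to forms by $\beta\cdot u=\frac1{p!}\sum\beta(e_{i_1},\dots,e_{i_p})\,e_{i_1}\cdots e_{i_p}\cdot u$, and let $\eta=(1,0)$ be the spinor field defined by $\varphi$. Let $\nabla^{LC}$ be the spin connection on $S$ (the metric connection for which Clifford multiplication is parallel), and for $t\in\mathbb R$ put $\nabla^t_Xu=\nabla^{LC}_Xu+\frac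 t6(i_X\varphi)\cdot u$; $\nabla^{-1}$ is the canonical connection. Let $K$ be a Lie group, $P\to M$ a smooth principal $K$-bundle with adjoint bundle $\mathrm{Ad}_P$, and $A$ a connection on $P$ that is a $G_2$-instanton: $F_A\wedge\varphi=\star F_A$. Let $\nabla^{t,A}$ be the connection on $S\otimes\mathrm{Ad}_P$ induced by $\nabla^t$ and $A$, and $D^{t,A}=\sum_a e_a\cdot\nabla^{t,A}_{e_a}$ its Dirac operator, acting on $\Gamma(S\otimes \mathrm{Ad}_P)$. Let $d^A$ be the exterior covariant derivative and $(d^A)^*$ its formal adjoint, and for $\varepsilon\in\Gamma(T^*M\otimes\mathrm{Ad}_P)$ let $\varepsilon\cdot\eta\in\Gamma(S\otimes\mathrm{Ad}_P)$ be its Clifford product with $\eta$. The infinitesimal deformations of $A$ are the $\varepsilon\in\Gamma(T^*M\otimes\mathrm{Ad}_P)$ with $$(d^A\varepsilon)\cdot\eta=0,\qquad (d^A)^*\varepsilon=0.\tag{1}$$ All sections are smooth. **Theorem.** 1. For every $t\in\mathbb R$ and every $\varepsilon\in\Gamma(T^*M\otimes\mathrm{Ad}_P)$, $\varepsilon$ satisfies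 (1) if and only if $$D^{t,A}(\varepsilon\cdot\eta)=-\tfrac{t+5}{2}\,\varepsilon\cdot\eta .$$ 2. The first-order operator $D^{-1,A}+2\,\mathrm{Id}$ on $\Gamma(S\otimes\mathrm{Ad}_P)$ is elliptic, i.e. its principal symbol is invertible at every non-zero covector. 3. The map $\varepsilon\mapsto\varepsilon\cdot\eta$ is a linear isomorphism from the space of infinitesimal deformations of $A$ onto the kernel of $D^{-1,A}+2\,\mathrm{Id}$ on $\Gamma(\Lambda^1\otimes\mathrm{Ad}_P)$, where $\Lambda^1\cong\Lambda^1\cdot\eta\subset S$, i.e. onto the space of all $s\in\Gamma(\Lambda^1\cdot\eta\otimes\mathrm{Ad}_P)$ with $D^{-1,A}s+2s=0$. -/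

import Mathlib

open Bundle
open scoped Manifold ContDiff

namespace NearlyG2

noncomputable section

/-! ## Linear algebra: forms on a seven-dimensional vector space -/

section LinearAlgebra

/-- The coefficient `(e^a ∧ e^b ∧ e^c)(e_i, e_j, e_k)`. -/
def tripleCoeff (a b c i j k : Fin 7) : ℝ :=
  Matrix.det (Matrix.of fun r s : Fin 3 =>
    if (![a, b, c] : Fin 3 → Fin 7) r = (![i, j, k] : Fin 3 → Fin 7) s then (1 : ℝ) else 0)

/-- Components of the model three-form
`φ₀ = e¹²³ + e¹⁴⁵ - e¹⁶⁷ + e²⁴⁶ + e²⁵⁷ + e³⁴⁷ - e³⁵⁶` on `ℝ⁷` (the indices in the code start at `0`).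
With the orientation `e¹²³⁴⁵⁶⁷`, the operator `β ↦ ⋆(φ₀ ∧ β)` on two-forms has the eigenvalues
`-2` on `Λ²₇` and `1` on `Λ²₁₄`. -/
def phi0 (i j k : Fin 7) : ℝ :=
  tripleCoeff 0 1 2 i j k + tripleCoeff 0 3 4 i j k - tripleCoeff 0 5 6 i j k
    + tripleCoeff 1 3 5 i j k + tripleCoeff 1 4 6 i j k + tripleCoeff 2 3 6 i j k
    - tripleCoeff 2 4 5 i j k

variable {V W : Type*} [AddCommGroup V] [Module ℝ V] [AddCommGroup W] [Module ℝ W]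

/-- The Hodge star of a `W`-valued `p`-form on the oriented Euclidean space in which `b` is an oriented
orthonormal basis: `(⋆α)(v) = (1/p!) ∑ α(b_{i₁}, …, b_{i_p}) vol(b_{i₁}, …, b_{i_p}, v)`. -/
def hodgeStar (b : Module.Basis (Fin 7) ℝ V) (p q : ℕ) (h : p + q = 7)
    (α : (Fin p → V) → W) (v : Fin q → V) : W :=
  ((p.factorial : ℝ)⁻¹) • ∑ i : Fin p → Fin 7,
    b.det (fun k : Fin 7 => Fin.append (fun r => b (i r)) v (Fin.cast h.symm k)) •
      α (fun r => b (i r))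

/-- The wedge product of a `W`-valued `p`-form and a real `q`-form. -/
def wedge (p q : ℕ) (α : (Fin p → V) → W) (β : (Fin q → V) → ℝ) (v : Fin (p + q) → V) : W :=
  (((p.factorial * q.factorial : ℕ) : ℝ)⁻¹) • ∑ σ : Equiv.Perm (Fin (p + q)),
    (((Equiv.Perm.sign σ : ℤ) : ℝ) * β (fun r => v (σ (Fin.natAdd p r)))) •
      α (fun r => v (σ (Fin.castAdd q r)))

end LinearAlgebra

/-! ## Differential forms on manifolds -/

section Forms

variable {E : Type*} [NormedAddCommGroup E] [NormedSpace ℝ E]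
  {F : Type*} [NormedAddCommGroup F] [NormedSpace ℝ F]
  {M : Type*} [TopologicalSpace M] [ChartedSpace E M]

/-- Smoothness of an `F`-valued `n`-form: it takes smooth vector fields to smooth functions. -/
def IsSmoothForm [IsManifold 𝓘(ℝ, E) ∞ M] {n : ℕ}
    (α : ∀ x : M, TangentSpace 𝓘(ℝ, E) x [⋀^Fin n]→L[ℝ] F) : Prop :=
  ∀ (x : M) (Y : Fin n → ∀ y : M, TangentSpace 𝓘(ℝ, E) y),
    (∀ i, ContMDiffAt 𝓘(ℝ, E) (𝓘(ℝ, E).prod 𝓘(ℝ, E)) ∞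
      (fun y => TotalSpace.mk' E y (Y i y)) x) →
    ContMDiffAt 𝓘(ℝ, E) 𝓘(ℝ, F) ∞ (fun y => α y (fun i => Y i y)) x

/-- The expression of a form in the preferred chart at `x₀`, i.e. its pullback under the inverse of the
chart. -/
def formInChart {n : ℕ} (α : ∀ x : M, TangentSpace 𝓘(ℝ, E) x [⋀^Fin n]→L[ℝ] F) (x₀ : M) :
    E → E [⋀^Fin n]→L[ℝ] F :=
  fun y => (α ((extChartAt 𝓘(ℝ, E) x₀).symm y)).compContinuousLinearMap
    (mfderiv 𝓘(ℝ, E) 𝓘(ℝ, E) (extChartAt 𝓘(ℝ, E) x₀).symm y)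

/-- The exterior derivative of a form on a manifold, computed at `x` in the preferred chart at `x`. -/
def extD {n : ℕ} (α : ∀ x : M, TangentSpace 𝓘(ℝ, E) x [⋀^Fin n]→L[ℝ] F) (x : M) :
    TangentSpace 𝓘(ℝ, E) x [⋀^Fin (n + 1)]→L[ℝ] F :=
  (extDeriv (formInChart α x) (extChartAt 𝓘(ℝ, E) x x)).compContinuousLinearMap
    (mfderiv 𝓘(ℝ, E) 𝓘(ℝ, E) (extChartAt 𝓘(ℝ, E) x) x)

end Forms

/-! ## Principal bundles, connections and the adjoint bundle -/

section PrincipalBundles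

variable {EM : Type*} [NormedAddCommGroup EM] [NormedSpace ℝ EM]
  {EK : Type*} [NormedAddCommGroup EK] [NormedSpace ℝ EK]
  {EP : Type*} [NormedAddCommGroup EP] [NormedSpace ℝ EP]

/-- A smooth principal `K`-bundle `P → M`, with `K` acting on the right.  Near every point of `M` there is
a smooth local section `σ` such that `(y, k) ↦ σ(y) · k` is a local trivialisation, with inverse
`p ↦ (proj p, κ p)`. -/
structure PrincipalBundle (EM EK EP : Type*)
    [NormedAddCommGroup EM] [NormedSpace ℝ EM] [NormedAddCommGroup EK] [NormedSpace ℝ EK]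
    [NormedAddCommGroup EP] [NormedSpace ℝ EP]
    (M K P : Type*) [TopologicalSpace M] [ChartedSpace EM M]
    [TopologicalSpace K] [ChartedSpace EK K] [Group K]
    [TopologicalSpace P] [ChartedSpace EP P] where
  proj : P → M
  act : P → K → P
  act_one : ∀ p, act p 1 = p
  act_mul : ∀ p k l, act p (k * l) = act (act p k) l
  proj_act : ∀ p k, proj (act p k) = proj p
  contMDiff_proj : ContMDiff 𝓘(ℝ, EP) 𝓘(ℝ, EM) ∞ proj
  contMDiff_act : ContMDiff (𝓘(ℝ, EP).prod 𝓘(ℝ, EK)) 𝓘(ℝ, EP) ∞ (fun q : P × K => act q.1 q.2)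
  locally_trivial : ∀ x : M, ∃ U : Set M, IsOpen U ∧ x ∈ U ∧ ∃ (σ : M → P) (κ : P → K),
    ContMDiffOn 𝓘(ℝ, EM) 𝓘(ℝ, EP) ∞ σ U ∧ ContMDiffOn 𝓘(ℝ, EP) 𝓘(ℝ, EK) ∞ κ (proj ⁻¹' U) ∧
    (∀ y ∈ U, proj (σ y) = y) ∧ (∀ p, proj p ∈ U → act (σ (proj p)) (κ p) = p) ∧
    (∀ y ∈ U, ∀ k, κ (act (σ y) k) = k)

variable {M K P : Type*} [TopologicalSpace M] [ChartedSpace EM M]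
  [TopologicalSpace K] [ChartedSpace EK K] [Group K]
  [TopologicalSpace P] [ChartedSpace EP P]

/-- The adjoint action of `k` on the Lie algebra `T₁K` (whose underlying vector space is `EK`), the
derivative at `1` of conjugation by `k`. -/
def Ad (k : K) : EK →L[ℝ] EK :=
  mfderiv 𝓘(ℝ, EK) 𝓘(ℝ, EK) (fun g : K => k * g * k⁻¹) 1

/-- The bracket of the Lie algebra of `K`. -/
def lieBr (K : Type*) [TopologicalSpace K] [ChartedSpace EK K] [Group K] (v w : EK) : EK :=
  Bracket.bracket (L := GroupLieAlgebra 𝓘(ℝ, EK) K) (M := GroupLieAlgebra 𝓘(ℝ, EK) K) v w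

namespace PrincipalBundle

variable (Q : PrincipalBundle EM EK EP M K P)

/-- The value at `p` of the fundamental vector field of an element of the Lie algebra. -/
def fund (p : P) : EK →L[ℝ] EP :=
  mfderiv 𝓘(ℝ, EK) 𝓘(ℝ, EP) (fun k : K => Q.act p k) 1

/-- The derivative at `p` of the right translation by `k`. -/
def dR (k : K) (p : P) : EP →L[ℝ] EP :=
  mfderiv 𝓘(ℝ, EP) 𝓘(ℝ, EP) (fun q : P => Q.act q k) p

/-- The derivative of the projection at `p`. -/
def dproj (p : P) : EP →L[ℝ] EM :=
  mfderiv 𝓘(ℝ, EP) 𝓘(ℝ, EM) Q.proj p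

/-- A connection on a principal bundle: a smooth one-form on `P` with values in the Lie algebra that
reproduces the generators of the fundamental vector fields and is equivariant. -/
structure Connection [IsManifold 𝓘(ℝ, EP) ∞ P] where
  form : ∀ p : P, TangentSpace 𝓘(ℝ, EP) p [⋀^Fin 1]→L[ℝ] EK
  smooth : IsSmoothForm form
  fund_eq : ∀ (p : P) (ξ : EK), form p ![Q.fund p ξ] = ξ
  equivariant : ∀ (p : P) (k : K) (v : EP), form (Q.act p k) ![Q.dR k p v] = Ad k⁻¹ (form p ![v])

/-- The fibre at `x` of the adjoint bundle `Ad_P = P ×_K 𝔨`, as the space of those functions from the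
fibre of `P` to the Lie algebra that satisfy `f (p · k) = Ad(k⁻¹) f(p)`. -/
def AdFiber (x : M) : Submodule ℝ ({p : P // Q.proj p = x} → EK) where
  carrier := {f | ∀ (p : {p : P // Q.proj p = x}) (k : K),
    f ⟨Q.act p.1 k, (Q.proj_act p.1 k).trans p.2⟩ = Ad k⁻¹ (f p)}
  add_mem' := fun {f g} hf hg p k => by
    simp only [Pi.add_apply, map_add]
    rw [hf p k, hg p k]
  zero_mem' := fun p k => by simp
  smul_mem' := fun c f hf p k => by
    simp only [Pi.smul_apply, map_smul]
    rw [hf p k]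

/-- The equivariant function on `P` that corresponds to a section of the adjoint bundle. -/
def lift (e : ∀ x : M, Q.AdFiber x) (p : P) : EK :=
  (e (Q.proj p)).1 ⟨p, rfl⟩

/-- A section of the adjoint bundle is smooth at `x` if the equivariant function is smooth along the
fibre over `x`. -/
def SmoothAdAt (e : ∀ x : M, Q.AdFiber x) (x : M) : Prop :=
  ∀ p, Q.proj p = x → ContMDiffAt 𝓘(ℝ, EP) 𝓘(ℝ, EK) ∞ (Q.lift e) p

end PrincipalBundle


namespace PrincipalBundle
variable (Q : PrincipalBundle EM EK EP M K P)

theorem hasMFDerivAt_proj {p q : P} (h : q = p) :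
    HasMFDerivAt 𝓘(ℝ, EP) 𝓘(ℝ, EM) Q.proj q (Q.dproj p) := by
  subst h
  exact ((Q.contMDiff_proj q).mdifferentiableAt (by simp)).hasMFDerivAt

theorem hasMFDerivAt_dR {p q : P} (h : q = p) (k : K) :
    HasMFDerivAt 𝓘(ℝ, EP) 𝓘(ℝ, EP) (fun q : P => Q.act q k) q (Q.dR k p) := by
  subst h
  have : ContMDiff 𝓘(ℝ, EP) 𝓘(ℝ, EP) ∞ (fun q : P => Q.act q k) :=
    Q.contMDiff_act.comp (contMDiff_id.prodMk contMDiff_const)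
  exact ((this q).mdifferentiableAt (by simp)).hasMFDerivAt

theorem contMDiff_orbit (p : P) :
    ContMDiff 𝓘(ℝ, EK) 𝓘(ℝ, EP) ∞ (fun k : K => Q.act p k) :=
  Q.contMDiff_act.comp (contMDiff_const.prodMk contMDiff_id)

theorem hasMFDerivAt_fund (p : P) {k : K} (h : k = 1) :
    HasMFDerivAt 𝓘(ℝ, EK) 𝓘(ℝ, EP) (fun k : K => Q.act p k) k (Q.fund p) := by
  subst h
  exact ((Q.contMDiff_orbit p 1).mdifferentiableAt (by simp)).hasMFDerivAt

theorem dproj_fund (p : P) (ξ : EK) : Q.dproj p (Q.fund p ξ) = 0 := by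
  have h1 := (Q.hasMFDerivAt_proj (Q.act_one p)).comp (1 : K) (Q.hasMFDerivAt_fund p rfl)
  have h2 : (Q.proj ∘ fun k : K => Q.act p k) = fun _ => Q.proj p := by
    funext k; exact Q.proj_act p k
  rw [h2] at h1
  have h3 := hasMFDerivAt_unique h1 (hasMFDerivAt_const (Q.proj p) (1 : K))
  exact congrArg (fun L : EK →L[ℝ] EM => L ξ) h3

/-- Through every point of `P` there is a smooth local section. -/
theorem exists_section (p : P) : ∃ L : EM →L[ℝ] EP, ∀ X, Q.dproj p (L X) = X := by
  obtain ⟨U, hU, hx, σ, κ, hσ, hκ, h1, h2, h3⟩ := Q.locally_trivial (Q.proj p)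
  have hτ : ContMDiffAt 𝓘(ℝ, EM) 𝓘(ℝ, EP) ∞ (fun y => Q.act (σ y) (κ p)) (Q.proj p) :=
    ContMDiffAt.comp (Q.proj p) (Q.contMDiff_act _)
      ((hσ.contMDiffAt (hU.mem_nhds hx)).prodMk contMDiffAt_const)
  have hd := (hτ.mdifferentiableAt (by simp)).hasMFDerivAt
  have hc := (Q.hasMFDerivAt_proj (h2 p hx)).comp (Q.proj p) hd
  have he : (Q.proj ∘ fun y => Q.act (σ y) (κ p)) =ᶠ[nhds (Q.proj p)] id := by
    filter_upwards [hU.mem_nhds hx] with y hy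
    simp [Q.proj_act, h1 y hy]
  have h4 := hasMFDerivAt_unique (hc.congr_of_eventuallyEq he.symm) (hasMFDerivAt_id (Q.proj p))
  refine ⟨mfderiv 𝓘(ℝ, EM) 𝓘(ℝ, EP) (fun y => Q.act (σ y) (κ p)) (Q.proj p), fun X => ?_⟩
  exact congrArg (fun L : EM →L[ℝ] EM => L X) h4

/-- Vectors tangent to the fibres are values of fundamental vector fields. -/
theorem exists_fund [LieGroup 𝓘(ℝ, EK) ∞ K] (p : P) (v : EP) (hv : Q.dproj p v = 0) : ∃ ξ, v = Q.fund p ξ := by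
  obtain ⟨U, hU, hx, σ, κ, hσ, hκ, h1, h2, h3⟩ := Q.locally_trivial (Q.proj p)
  have hUP : Q.proj ⁻¹' U ∈ nhds p :=
    (hU.preimage Q.contMDiff_proj.continuous).mem_nhds hx
  have hκd := ((hκ.contMDiffAt hUP).mdifferentiableAt (by simp)).hasMFDerivAt
  have hσd := ((hσ.contMDiffAt (hU.mem_nhds hx)).mdifferentiableAt (by simp)).hasMFDerivAt
  have hs := hσd.comp p (Q.hasMFDerivAt_proj rfl)
  have ha := ((Q.contMDiff_act (σ (Q.proj p), κ p)).mdifferentiableAt (by simp))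
  have hc := ha.hasMFDerivAt.comp p (hs.prodMk hκd)
  have he : ((fun q : P × K => Q.act q.1 q.2) ∘ fun q => ((σ ∘ Q.proj) q, κ q))
      =ᶠ[nhds p] id := by
    filter_upwards [hUP] with q hq
    exact h2 q hq
  have h4 := hasMFDerivAt_unique (hc.congr_of_eventuallyEq he.symm) (hasMFDerivAt_id p)
  set a : EK := (mfderiv 𝓘(ℝ, EP) 𝓘(ℝ, EK) κ p : EP →L[ℝ] EK) v with hadef
  have hi : HasMFDerivAt 𝓘(ℝ, EK) (𝓘(ℝ, EP).prod 𝓘(ℝ, EK))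
      (fun k : K => (σ (Q.proj p), k)) (κ p)
      (ContinuousLinearMap.prod (0 : EK →L[ℝ] EP) (ContinuousLinearMap.id ℝ EK)) :=
    (hasMFDerivAt_const _ _).prodMk (hasMFDerivAt_id _)
  have hA := HasMFDerivAt.comp (κ p) ha.hasMFDerivAt hi
  have hL : ContMDiff 𝓘(ℝ, EK) 𝓘(ℝ, EK) ∞ (fun k : K => (κ p)⁻¹ * k) := contMDiff_mul_left
  have hLd := ((hL (κ p)).mdifferentiableAt (by simp)).hasMFDerivAt
  have hB := HasMFDerivAt.comp (κ p) (Q.hasMFDerivAt_fund p (inv_mul_cancel (κ p))) hLd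
  have hfun : ((fun k : K => Q.act p k) ∘ fun k : K => (κ p)⁻¹ * k) =
      ((fun q : P × K => Q.act q.1 q.2) ∘ fun k : K => (σ (Q.proj p), k)) := by
    funext k
    have : Q.act (σ (Q.proj p)) k = Q.act (Q.act (σ (Q.proj p)) (κ p)) ((κ p)⁻¹ * k) := by
      rw [← Q.act_mul, mul_inv_cancel_left]
    simp only [Function.comp_apply]
    rw [this, h2 p hx]
  rw [hfun] at hB
  have h5 := hasMFDerivAt_unique hA hB
  refine ⟨(mfderiv 𝓘(ℝ, EK) 𝓘(ℝ, EK) (fun k : K => (κ p)⁻¹ * k) (κ p) : EK →L[ℝ] EK) a, ?_⟩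
  have h6 := congrArg (fun L : EP →L[ℝ] EP => L v) h4
  have h7 := congrArg (fun L : EK →L[ℝ] EP => L a) h5
  refine (h6.symm.trans ?_).trans h7
  have key : ∀ (S : EM →L[ℝ] EP) (T : EP × EK →L[ℝ] EP),
      T (S (Q.dproj p v), a) = T (0, a) := by
    intro S T
    rw [hv, map_zero]
  exact key _ _

variable {Q}

theorem lift_act (e : ∀ x : M, Q.AdFiber x) (p : P) (k : K) :
    Q.lift e (Q.act p k) = Ad k⁻¹ (Q.lift e p) := by
  have h := (e (Q.proj p)).2 ⟨p, rfl⟩ k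
  refine Eq.trans ?_ h
  have key : ∀ (x : M) (hx : x = Q.proj p) (q : P) (hq : Q.proj q = x),
      (e x).1 ⟨q, hq⟩ = (e (Q.proj p)).1 ⟨q, hq.trans hx⟩ := by
    rintro x rfl q hq; rfl
  exact key _ (Q.proj_act p k) _ rfl

variable [IsManifold 𝓘(ℝ, EP) ∞ P]

namespace Connection

/-- The connection form as a linear map on the tangent space of `P`. -/
def formL (A : Q.Connection) (p : P) : EP →ₗ[ℝ] EK where
  toFun v := A.form p ![v]
  map_add' v w := by
    have hu : ∀ x : EP, Function.update (![0] : Fin 1 → EP) 0 x = ![x] := fun x => by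
      ext i; fin_cases i; simp
    have h := (A.form p).map_update_add ![0] 0 v w
    exact (congrArg (A.form p) (hu (v + w))).symm.trans (h.trans
      (congrArg₂ (· + ·) (congrArg (A.form p) (hu v)) (congrArg (A.form p) (hu w))))
  map_smul' c v := by
    have hu : ∀ x : EP, Function.update (![0] : Fin 1 → EP) 0 x = ![x] := fun x => by
      ext i; fin_cases i; simp
    have h := (A.form p).map_update_smul ![0] 0 c v
    exact (congrArg (A.form p) (hu (c • v))).symm.trans (h.trans
      (congrArg (c • ·) (congrArg (A.form p) (hu v))))

theorem exists_horLift (A : Q.Connection) (p : P) : ∃ h : EM →ₗ[ℝ] EP,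
    ∀ X, Q.dproj p (h X) = X ∧ A.form p ![h X] = 0 := by
  obtain ⟨L, hL⟩ := Q.exists_section p
  refine ⟨L.toLinearMap - (Q.fund p).toLinearMap ∘ₗ A.formL p ∘ₗ L.toLinearMap, fun X => ⟨?_, ?_⟩⟩
  · simp [hL, dproj_fund]
  · have h1 : A.formL p (Q.fund p (A.formL p (L X))) = A.formL p (L X) := A.fund_eq p _
    change A.formL p _ = 0
    simp [h1]

/-- The horizontal lift of tangent vectors of `M` to the point `p` of `P`. -/
def horLift (A : Q.Connection) (p : P) : EM →ₗ[ℝ] EP := (A.exists_horLift p).choose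

theorem dproj_horLift (A : Q.Connection) (p : P) (X : EM) : Q.dproj p (A.horLift p X) = X :=
  ((A.exists_horLift p).choose_spec X).1

theorem form_horLift (A : Q.Connection) (p : P) (X : EM) : A.form p ![A.horLift p X] = 0 :=
  ((A.exists_horLift p).choose_spec X).2

theorem eq_of_horizontal [LieGroup 𝓘(ℝ, EK) ∞ K] (A : Q.Connection) (p : P) (v w : EP)
    (h : Q.dproj p v = Q.dproj p w) (hv : A.form p ![v] = 0) (hw : A.form p ![w] = 0) : v = w := by
  obtain ⟨ξ, hξ⟩ := Q.exists_fund p (v - w) (by rw [map_sub, h, sub_self])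
  have h1 : A.formL p (v - w) = 0 := by
    rw [map_sub]
    change A.form p ![v] - A.form p ![w] = 0
    rw [hv, hw, sub_zero]
  have h2 : ξ = 0 := by
    rw [← A.fund_eq p ξ, ← hξ]
    exact h1
  rw [h2, map_zero, sub_eq_zero] at hξ
  exact hξ

theorem dR_horLift [LieGroup 𝓘(ℝ, EK) ∞ K] (A : Q.Connection) (p : P) (k : K) (X : EM) :
    Q.dR k p (A.horLift p X) = A.horLift (Q.act p k) X := by
  apply A.eq_of_horizontal
  · rw [dproj_horLift]
    have h1 := (Q.hasMFDerivAt_proj (rfl : Q.act p k = Q.act p k)).comp p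
      (Q.hasMFDerivAt_dR rfl k)
    have h2 : (Q.proj ∘ fun q : P => Q.act q k) = Q.proj := by
      funext q; exact Q.proj_act q k
    rw [h2] at h1
    have h3 := hasMFDerivAt_unique h1 (Q.hasMFDerivAt_proj rfl)
    have h4 := congrArg (fun L : EP →L[ℝ] EM => L (A.horLift p X)) h3
    exact h4.trans (A.dproj_horLift p X)
  · rw [A.equivariant, form_horLift, map_zero]
  · exact A.form_horLift _ X

/-- The derivative at `p` of an equivariant function in the direction of a horizontal lift. -/
def horDeriv (A : Q.Connection) (e : ∀ x : M, Q.AdFiber x) (p : P) (X : EM) : EK :=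
  mvfderiv 𝓘(ℝ, EP) (Q.lift e) p (A.horLift p X)

theorem horDeriv_act [LieGroup 𝓘(ℝ, EK) ∞ K] (A : Q.Connection) (e : ∀ x : M, Q.AdFiber x)
    (p : P) (k : K) (X : EM) :
    A.horDeriv e (Q.act p k) X = Ad k⁻¹ (A.horDeriv e p X) := by
  have hfun : (Q.lift e ∘ fun q : P => Q.act q k) = (Ad k⁻¹ : EK →L[ℝ] EK) ∘ Q.lift e := by
    funext q; exact lift_act e q k
  have hfun' : ((Ad k⁻¹⁻¹ : EK →L[ℝ] EK) ∘ Q.lift e) ∘ (fun q : P => Q.act q k) = Q.lift e := by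
    funext q
    have h := lift_act e (Q.act q k) k⁻¹
    rw [← Q.act_mul, mul_inv_cancel, Q.act_one] at h
    exact h.symm
  have hR := Q.hasMFDerivAt_dR (rfl : p = p) k
  unfold horDeriv
  by_cases hd : MDifferentiableAt 𝓘(ℝ, EP) 𝓘(ℝ, EK) (Q.lift e) (Q.act p k)
  · have hd' : MDifferentiableAt 𝓘(ℝ, EP) 𝓘(ℝ, EK) (Q.lift e) p := by
      have h2 := MDifferentiableAt.comp p
        ((Ad (EK := EK) k⁻¹⁻¹).differentiableAt.mdifferentiableAt.comp _ hd) hR.mdifferentiableAt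
      rwa [hfun'] at h2
    have h1 := hd.hasMFDerivAt.comp p hR
    rw [hfun] at h1
    have h2 := HasMFDerivAt.comp p
      ((Ad (EK := EK) k⁻¹).hasMFDerivAt (x := Q.lift e p)) hd'.hasMFDerivAt
    have h3 := hasMFDerivAt_unique h1 h2
    have h4 := congrArg (fun L : EP →L[ℝ] EK => L (A.horLift p X)) h3
    refine Eq.trans ?_ h4
    rw [← A.dR_horLift p k X]
    rfl
  · have hd' : ¬ MDifferentiableAt 𝓘(ℝ, EP) 𝓘(ℝ, EK) (Q.lift e) p := by
      intro h
      apply hd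
      have h1 := (Ad (EK := EK) k⁻¹).differentiableAt.mdifferentiableAt.comp p h
      rw [← hfun] at h1
      have h2 : MDifferentiableAt 𝓘(ℝ, EP) 𝓘(ℝ, EP) (fun q : P => Q.act q k⁻¹) (Q.act p k) :=
        (Q.hasMFDerivAt_dR rfl k⁻¹).mdifferentiableAt
      have h3 : MDifferentiableAt 𝓘(ℝ, EP) 𝓘(ℝ, EK) (Q.lift e ∘ fun q : P => Q.act q k)
          (Q.act (Q.act p k) k⁻¹) := by
        rw [← Q.act_mul, mul_inv_cancel, Q.act_one]
        exact h1
      have h4 := MDifferentiableAt.comp (f := fun q : P => Q.act q k⁻¹) (Q.act p k) h3 h2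
      have h5 : (Q.lift e ∘ fun q : P => Q.act q k) ∘ (fun q : P => Q.act q k⁻¹) = Q.lift e := by
        funext q
        simp only [Function.comp_apply]
        rw [← Q.act_mul, inv_mul_cancel, Q.act_one]
      rwa [h5] at h4
    rw [mvfderiv, mvfderiv, mfderiv_zero_of_not_mdifferentiableAt hd,
      mfderiv_zero_of_not_mdifferentiableAt hd']
    exact (map_zero (Ad (EK := EK) k⁻¹)).symm

/-- The covariant derivative `∇^A e` of a section of the adjoint bundle.  As an equivariant function on the
fibre, `∇^A_X e` is the derivative of the equivariant function of `e` along the horizontal lift of `X`. -/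
def cov [LieGroup 𝓘(ℝ, EK) ∞ K] (A : Q.Connection) (e : ∀ x : M, Q.AdFiber x) (x : M) :
    TangentSpace 𝓘(ℝ, EM) x →ₗ[ℝ] Q.AdFiber x where
  toFun X := ⟨fun p => A.horDeriv e p.1 X, fun p k => A.horDeriv_act e p.1 k X⟩
  map_add' X Y := by
    ext p
    exact ((mvfderiv 𝓘(ℝ, EP) (Q.lift e) p.1).congr_arg ((A.horLift p.1).map_add X Y)).trans
      (map_add (mvfderiv 𝓘(ℝ, EP) (Q.lift e) p.1) _ _)
  map_smul' c X := by
    ext p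
    exact ((mvfderiv 𝓘(ℝ, EP) (Q.lift e) p.1).congr_arg ((A.horLift p.1).map_smul c X)).trans
      (map_smul (mvfderiv 𝓘(ℝ, EP) (Q.lift e) p.1) _ _)

theorem cov_add [LieGroup 𝓘(ℝ, EK) ∞ K] (A : Q.Connection) {e e' : ∀ x : M, Q.AdFiber x} {x : M}
    (he : Q.SmoothAdAt e x) (he' : Q.SmoothAdAt e' x) (X : TangentSpace 𝓘(ℝ, EM) x) :
    A.cov (fun y => e y + e' y) x X = A.cov e x X + A.cov e' x X := by
  ext p
  have h1 := ((he p.1 p.2).mdifferentiableAt (by simp))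
  have h2 := ((he' p.1 p.2).mdifferentiableAt (by simp))
  have h3 := mvfderiv_add h1 h2
  exact congrArg (fun L : EP →L[ℝ] EK => L (A.horLift p.1 X)) h3

theorem cov_smul [LieGroup 𝓘(ℝ, EK) ∞ K] (A : Q.Connection) {e : ∀ x : M, Q.AdFiber x} {x : M}
    (he : Q.SmoothAdAt e x) (c : ℝ) (X : TangentSpace 𝓘(ℝ, EM) x) :
    A.cov (fun y => c • e y) x X = c • A.cov e x X := by
  ext p
  have h1 := ((he p.1 p.2).mdifferentiableAt (by simp))
  have h3 := mvfderiv_smul (mdifferentiableAt_const (c := c)) h1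
  rw [mvfderiv_const] at h3
  have h4 := congrArg (fun L : EP →L[ℝ] EK => L (A.horLift p.1 X)) h3
  refine h4.trans ?_
  change c • (mvfderiv 𝓘(ℝ, EP) (Q.lift e) p.1) _ + (0 : ℝ) • Q.lift e p.1 = _
  rw [zero_smul, add_zero]
  rfl

/-- The curvature `F_A = dA + ½ [A ∧ A]`, as a two-form on `P`. -/
def curvP (A : Q.Connection) (p : P) (v w : EP) : EK :=
  extD A.form p ![v, w] + lieBr K (A.form p ![v]) (A.form p ![w])

/-- The curvature as a two-form on `M` with values in the adjoint bundle, evaluated at a point `p` of the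
fibre. -/
def curv (A : Q.Connection) (p : P) (X : Fin 2 → EM) : EK :=
  A.curvP p (A.horLift p (X 0)) (A.horLift p (X 1))

end Connection

/-- The fibrewise linear maps `s : V → Ad_P` that are smooth, i.e. the smooth sections of
`Hom(V, Ad_P) = V^* ⊗ Ad_P`: they take smooth sections of `V` to smooth sections of `Ad_P`. -/
def smoothHom (Q : PrincipalBundle EM EK EP M K P)
    (F : Type*) [NormedAddCommGroup F] [NormedSpace ℝ F]
    (V : M → Type*) [TopologicalSpace (TotalSpace F V)] [∀ x, AddCommGroup (V x)]
    [∀ x, Module ℝ (V x)] [∀ x, TopologicalSpace (V x)] [FiberBundle F V] :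
    Submodule ℝ (∀ x : M, V x →ₗ[ℝ] Q.AdFiber x) where
  carrier := {s | ∀ (x : M) (u : ∀ y : M, V y),
    ContMDiffAt 𝓘(ℝ, EM) (𝓘(ℝ, EM).prod 𝓘(ℝ, F)) ∞ (fun y => TotalSpace.mk' F y (u y)) x →
      Q.SmoothAdAt (fun y => s y (u y)) x}
  add_mem' := fun hs hs' x u hu p hp => (hs x u hu p hp).add (hs' x u hu p hp)
  zero_mem' := fun _ _ _ _ _ => contMDiffAt_const (c := (0 : EK))
  smul_mem' := fun c _ hs x u hu p hp =>
    ContMDiffAt.smul (contMDiffAt_const : ContMDiffAt 𝓘(ℝ, EP) 𝓘(ℝ, ℝ) ∞ (fun _ : P => c) p)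
      (hs x u hu p hp)

theorem smoothAdAt_extend [IsManifold 𝓘(ℝ, EM) ∞ M] {Q : PrincipalBundle EM EK EP M K P}
    {F : Type*} [NormedAddCommGroup F] [NormedSpace ℝ F]
    {V : M → Type*} [TopologicalSpace (TotalSpace F V)] [∀ x, AddCommGroup (V x)]
    [∀ x, Module ℝ (V x)] [∀ x, TopologicalSpace (V x)] [FiberBundle F V] [VectorBundle ℝ F V]
    [ContMDiffVectorBundle ∞ F V 𝓘(ℝ, EM)]
    {s : ∀ x : M, V x →ₗ[ℝ] Q.AdFiber x} (hs : s ∈ Q.smoothHom F V) (x : M) (v : V x) :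
    Q.SmoothAdAt (fun y => s y (FiberBundle.extend F v y)) x :=
  hs x _ (FiberBundle.contMDiffAt_extend (k := ∞) 𝓘(ℝ, EM) F v)

end PrincipalBundle

end PrincipalBundles

/-! ## Nearly parallel `G₂`-structures, spinors and Dirac operators -/

section Geometry

abbrev E7 : Type := EuclideanSpace ℝ (Fin 7)

/-- The tangent bundle of a seven-dimensional manifold. -/
abbrev TM (M : Type*) [TopologicalSpace M] [ChartedSpace E7 M] : M → Type :=
  fun x => TangentSpace 𝓘(ℝ, E7) x

/-- The real spinor bundle `S = Λ⁰ ⊕ Λ¹` of a seven-manifold with a `G₂`-structure (one-forms being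
identified with tangent vectors by the metric).  Its Clifford multiplication is `G2Structure.cliff`. -/
abbrev SM (M : Type*) [TopologicalSpace M] [ChartedSpace E7 M] : M → Type :=
  Bundle.Trivial M ℝ ×ᵇ TM M

variable {M : Type*} [TopologicalSpace M] [ChartedSpace E7 M] [IsManifold 𝓘(ℝ, E7) ∞ M]
  [RiemannianBundle (TM M)]

/-- Differentiability at a point of a vector field. -/
def DiffVF (Y : ∀ y : M, TM M y) (x : M) : Prop :=
  MDifferentiableAt 𝓘(ℝ, E7) (𝓘(ℝ, E7).prod 𝓘(ℝ, E7)) (fun y => TotalSpace.mk' E7 y (Y y)) x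

/-- Differentiability at a point of a spinor field. -/
def DiffSpinor (u : ∀ y : M, SM M y) (x : M) : Prop :=
  MDifferentiableAt 𝓘(ℝ, E7) (𝓘(ℝ, E7).prod 𝓘(ℝ, ℝ × E7))
    (fun y => TotalSpace.mk' (ℝ × E7) y (u y)) x

/-- The Levi-Civita connection: the torsion-free metric connection on the tangent bundle.  As in Mathlib,
`nabla Y x (X x)` is `(∇_X Y)(x)`. -/
structure IsLeviCivita (nabla : CovariantDerivative 𝓘(ℝ, E7) E7 (TM M)) : Prop where
  torsion_free : ∀ (x : M) (X Y : ∀ y : M, TM M y), DiffVF X x → DiffVF Y x →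
    nabla Y x (X x) - nabla X x (Y x) = VectorField.mlieBracket 𝓘(ℝ, E7) X Y x
  metric : ∀ (x : M) (Y Z : ∀ y : M, TM M y) (X : TM M x), DiffVF Y x → DiffVF Z x →
    mvfderiv 𝓘(ℝ, E7) (fun y => inner ℝ (Y y) (Z y)) x X =
      inner ℝ (nabla Y x X) (Z x) + inner ℝ (Y x) (nabla Z x X)

/-- The inner product of spinors, `⟨(f, Y), (g, Z)⟩ = f g + ⟨Y, Z⟩`, as a linear functional of the second
argument. -/
def spinInner (x : M) (u : SM M x) : SM M x →ₗ[ℝ] ℝ :=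
  u.1 • LinearMap.fst ℝ ℝ (TM M x) + (innerₛₗ ℝ u.2) ∘ₗ LinearMap.snd ℝ ℝ (TM M x)

/-- A `G₂`-structure on a Riemannian seven-manifold: a smooth positive three-form whose induced metric is
the given one.  At each point there is an orthonormal basis in which the form is the model form `φ₀`;
these bases also define the induced orientation. -/
structure G2Structure (M : Type*) [TopologicalSpace M] [ChartedSpace E7 M]
    [IsManifold 𝓘(ℝ, E7) ∞ M] [RiemannianBundle (TM M)] where
  form : ∀ x : M, TangentSpace 𝓘(ℝ, E7) x [⋀^Fin 3]→L[ℝ] ℝ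
  smooth : IsSmoothForm form
  adapted : ∀ x : M, ∃ b : OrthonormalBasis (Fin 7) ℝ (TM M x),
    ∀ i j k, form x ![b i, b j, b k] = phi0 i j k

namespace G2Structure

variable (G : G2Structure M)

/-- An adapted orthonormal basis `e₁, …, e₇` of the tangent space at `x`. -/
def frame (x : M) : OrthonormalBasis (Fin 7) ℝ (TM M x) := (G.adapted x).choose

/-- The four-form `ψ = ⋆φ`. -/
def psi (x : M) (v : Fin 4 → TM M x) : ℝ :=
  hodgeStar (G.frame x).toBasis 3 4 rfl (fun w => G.form x w) v

/-- The equation `dφ = τ ψ`.  For `τ ≠ 0` the `G₂`-structure is nearly parallel. -/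
def IsNearlyParallel (τ : ℝ) : Prop :=
  ∀ (x : M) (v : Fin 4 → TM M x), extD G.form x v = τ * G.psi x v

/-- The cross product, `⟨Y × Z, W⟩ = φ(Y, Z, W)`. -/
def cross (x : M) (Y Z : TM M x) : TM M x :=
  ∑ a, G.form x ![Y, Z, G.frame x a] • G.frame x a

theorem cross_add (x : M) (Y Z Z' : TM M x) :
    G.cross x Y (Z + Z') = G.cross x Y Z + G.cross x Y Z' := by
  have hu : ∀ Z c : TM M x, Function.update (![Y, 0, c] : Fin 3 → TM M x) 1 Z = ![Y, Z, c] :=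
    fun Z c => by ext i; fin_cases i <;> simp
  simp only [cross, ← Finset.sum_add_distrib]
  refine Finset.sum_congr rfl fun a _ => ?_
  have h := (G.form x).map_update_add ![Y, 0, G.frame x a] 1 Z Z'
  rw [hu, hu, hu] at h
  rw [h, add_smul]

theorem cross_smul (x : M) (Y : TM M x) (c : ℝ) (Z : TM M x) :
    G.cross x Y (c • Z) = c • G.cross x Y Z := by
  have hu : ∀ Z c : TM M x, Function.update (![Y, 0, c] : Fin 3 → TM M x) 1 Z = ![Y, Z, c] :=
    fun Z c => by ext i; fin_cases i <;> simp
  simp only [cross, Finset.smul_sum]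
  refine Finset.sum_congr rfl fun a _ => ?_
  have h := (G.form x).map_update_smul ![Y, 0, G.frame x a] 1 c Z
  rw [hu, hu] at h
  rw [h, smul_eq_mul, mul_smul]

/-- Clifford multiplication of a spinor by a tangent vector (or one-form),
`Y · (f, Z) = -(-⟨Y, Z⟩, f Y + Y × Z)`, the negative of the octonionic product. -/
def cliff (x : M) (Y : TM M x) : Module.End ℝ (SM M x) where
  toFun u := (inner ℝ Y u.2, -(u.1 • Y + G.cross x Y u.2))
  map_add' u w := by
    ext1
    · exact inner_add_right _ _ _
    · change -((u.1 + w.1) • Y + G.cross x Y (u.2 + w.2)) =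
        -(u.1 • Y + G.cross x Y u.2) + -(w.1 • Y + G.cross x Y w.2)
      rw [cross_add, add_smul]
      abel
  map_smul' c u := by
    ext1
    · exact inner_smul_right _ _ _
    · change -((c * u.1) • Y + G.cross x Y (c • u.2)) = c • -(u.1 • Y + G.cross x Y u.2)
      rw [cross_smul, mul_smul, smul_neg, smul_add]

/-- The spinor field `η = (1, 0)` defined by the `G₂`-structure. -/
def eta (x : M) : SM M x := ((1 : ℝ), (0 : TM M x))

/-- The spin connection `∇^{LC}` on the spinor bundle: the metric connection for which Clifford
multiplication is parallel with respect to the Levi-Civita connection `nabla`. -/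
structure IsSpinConnection (nabla : CovariantDerivative 𝓘(ℝ, E7) E7 (TM M))
    (nablaS : CovariantDerivative 𝓘(ℝ, E7) (ℝ × E7) (SM M)) : Prop where
  metric : ∀ (x : M) (u w : ∀ y : M, SM M y) (X : TM M x), DiffSpinor u x → DiffSpinor w x →
    mvfderiv 𝓘(ℝ, E7) (fun y => spinInner y (u y) (w y)) x X =
      spinInner x (nablaS u x X) (w x) + spinInner x (u x) (nablaS w x X)
  clifford : ∀ (x : M) (Y : ∀ y : M, TM M y) (u : ∀ y : M, SM M y) (X : TM M x),
    DiffVF Y x → DiffSpinor u x →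
    nablaS (fun y => G.cliff y (Y y) (u y)) x X =
      G.cliff x (nabla Y x X) (u x) + G.cliff x (Y x) (nablaS u x X)

/-- The Clifford action of `e_{i₁} · e_{i₂} · … · e_{i_p}`. -/
def cliffWord (x : M) {p : ℕ} (i : Fin p → Fin 7) : Module.End ℝ (SM M x) :=
  (List.ofFn fun r => G.cliff x (G.frame x (i r))).prod

/-- Clifford multiplication by a real `p`-form,
`β · u = (1/p!) ∑ β(e_{i₁}, …, e_{i_p}) e_{i₁} · … · e_{i_p} · u`. -/
def cliffForm (x : M) (p : ℕ) (β : (Fin p → TM M x) → ℝ) : Module.End ℝ (SM M x) :=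
  ((p.factorial : ℝ)⁻¹) • ∑ i : Fin p → Fin 7, β (fun r => G.frame x (i r)) • G.cliffWord x i

/-- The Clifford product `β · u` of a `p`-form with values in a vector space `W` and a spinor `u`.  It is
an element of `S ⊗ W`, which is realised as `Hom(S, W)` by means of the inner product of `S`:
the decomposable element `s ⊗ w` is the map `s' ↦ ⟨s, s'⟩ w`. -/
def cliffFormVal {W : Type*} [AddCommGroup W] [Module ℝ W] (x : M) (p : ℕ)
    (β : (Fin p → TM M x) → W) (u : SM M x) : SM M x →ₗ[ℝ] W :=
  ((p.factorial : ℝ)⁻¹) • ∑ i : Fin p → Fin 7,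
    (spinInner x (G.cliffWord x i u)).smulRight (β (fun r => G.frame x (i r)))

/-- The family of connections `∇^t_X u = ∇^{LC}_X u + (t/6) (i_X φ) · u` on the spinor bundle.  The
canonical connection is `∇^{-1}`. -/
def spinCov (nablaS : CovariantDerivative 𝓘(ℝ, E7) (ℝ × E7) (SM M)) (t : ℝ)
    (u : ∀ y : M, SM M y) (x : M) (X : TM M x) : SM M x :=
  nablaS u x X + (t / 6) • G.cliffForm x 2 (fun v => G.form x ![X, v 0, v 1]) (u x)

/-- The orthonormal basis `(1, 0), (0, e₁), …, (0, e₇)` of the spinor space at `x`. -/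
def spinFrame (x : M) : Option (Fin 7) → SM M x
  | none => ((1 : ℝ), (0 : TM M x))
  | some a => ((0 : ℝ), G.frame x a)

variable {EK : Type*} [NormedAddCommGroup EK] [NormedSpace ℝ EK]
  {EP : Type*} [NormedAddCommGroup EP] [NormedSpace ℝ EP]
  {K P : Type*} [TopologicalSpace K] [ChartedSpace EK K] [Group K] [LieGroup 𝓘(ℝ, EK) ∞ K]
  [TopologicalSpace P] [ChartedSpace EP P] [IsManifold 𝓘(ℝ, EP) ∞ P]
  {Q : PrincipalBundle E7 EK EP M K P}

/-- A connection is a `G₂`-instanton if its curvature satisfies `F_A ∧ φ = ⋆ F_A`. -/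
def IsInstanton (A : Q.Connection) : Prop :=
  ∀ (p : P) (v : Fin 5 → TM M (Q.proj p)),
    wedge 2 3 (fun w : Fin 2 → TM M (Q.proj p) => A.curv p w) (fun w => G.form (Q.proj p) w) v =
      hodgeStar (G.frame (Q.proj p)).toBasis 2 5 rfl
        (fun w : Fin 2 → TM M (Q.proj p) => A.curv p w) v

/-- The exterior covariant derivative of a one-form with values in the adjoint bundle,
`(d^A ε)(X, Y) = ∇^A_X (ε(Y)) - ∇^A_Y (ε(X)) - ε([X, Y])`; the tangent vectors are extended to local vector
fields. -/
def dA (A : Q.Connection) (ε : ∀ x : M, TM M x →ₗ[ℝ] Q.AdFiber x) (x : M) (v : Fin 2 → TM M x) :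
    Q.AdFiber x :=
  A.cov (fun y => ε y (FiberBundle.extend E7 (v 1) y)) x (v 0) -
    A.cov (fun y => ε y (FiberBundle.extend E7 (v 0) y)) x (v 1) -
    ε x (VectorField.mlieBracket 𝓘(ℝ, E7) (FiberBundle.extend E7 (v 0) : ∀ y : M, TM M y)
      (FiberBundle.extend E7 (v 1)) x)

/-- The formal adjoint `(d^A)^* ε = -∑ (∇^A_{e_a} ε)(e_a)` of `d^A` on one-forms, where
`(∇^A_X ε)(Y) = ∇^A_X (ε(Y)) - ε(∇_X Y)`. -/
def dAstar (nabla : CovariantDerivative 𝓘(ℝ, E7) E7 (TM M)) (A : Q.Connection)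
    (ε : ∀ x : M, TM M x →ₗ[ℝ] Q.AdFiber x) (x : M) : Q.AdFiber x :=
  -∑ a, (A.cov (fun y => ε y (FiberBundle.extend E7 (G.frame x a) y)) x (G.frame x a) -
    ε x (nabla (FiberBundle.extend E7 (G.frame x a)) x (G.frame x a)))

/-- The section `ε · η` of `S ⊗ Ad_P` for a one-form `ε` with values in `Ad_P`. -/
def mulEta (ε : ∀ x : M, TM M x →ₗ[ℝ] Q.AdFiber x) (x : M) : SM M x →ₗ[ℝ] Q.AdFiber x :=
  G.cliffFormVal x 1 (fun v => ε x (v 0)) (eta x)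

/-- The connection `∇^{t,A}` induced by `∇^t` and `A` on `S ⊗ Ad_P = Hom(S, Ad_P)`:
`(∇^{t,A}_X s)(u) = ∇^A_X (s(u)) - s(∇^t_X u)` for spinor fields `u`. -/
def twistedCov (nablaS : CovariantDerivative 𝓘(ℝ, E7) (ℝ × E7) (SM M)) (t : ℝ) (A : Q.Connection)
    (s : ∀ x : M, SM M x →ₗ[ℝ] Q.AdFiber x) (x : M) (X : TM M x) : SM M x →ₗ[ℝ] Q.AdFiber x :=
  ∑ B, (spinInner x (G.spinFrame x B)).smulRight
    (A.cov (fun y => s y (FiberBundle.extend (ℝ × E7) (G.spinFrame x B) y)) x X -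
      s x (G.spinCov nablaS t (FiberBundle.extend (ℝ × E7) (G.spinFrame x B)) x X))

/-- Clifford multiplication on `S ⊗ W = Hom(S, W)`.  It is skew-adjoint on `S`, whence the sign. -/
def cliffHom {W : Type*} [AddCommGroup W] [Module ℝ W] (x : M) (Y : TM M x)
    (s : SM M x →ₗ[ℝ] W) : SM M x →ₗ[ℝ] W :=
  -(s ∘ₗ G.cliff x Y)

/-- The Dirac operator `D^{t,A} s = ∑ e_a · ∇^{t,A}_{e_a} s` on sections of `S ⊗ Ad_P`. -/
def dirac (nablaS : CovariantDerivative 𝓘(ℝ, E7) (ℝ × E7) (SM M)) (t : ℝ) (A : Q.Connection)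
    (s : ∀ x : M, SM M x →ₗ[ℝ] Q.AdFiber x) (x : M) : SM M x →ₗ[ℝ] Q.AdFiber x :=
  ∑ a, G.cliffHom x (G.frame x a) (G.twistedCov nablaS t A s x (G.frame x a))

/-- The equations `(d^A ε) · η = 0` and `(d^A)^* ε = 0` for an infinitesimal deformation. -/
def IsDeformation (nabla : CovariantDerivative 𝓘(ℝ, E7) E7 (TM M)) (A : Q.Connection)
    (ε : ∀ x : M, TM M x →ₗ[ℝ] Q.AdFiber x) : Prop :=
  ∀ x, G.cliffFormVal x 2 (dA A ε x) (eta x) = 0 ∧ G.dAstar nabla A ε x = 0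

/-- The operator `D^{-1,A} + 2 Id`. -/
def diracShift (nablaS : CovariantDerivative 𝓘(ℝ, E7) (ℝ × E7) (SM M)) (A : Q.Connection)
    (s : ∀ x : M, SM M x →ₗ[ℝ] Q.AdFiber x) (x : M) : SM M x →ₗ[ℝ] Q.AdFiber x :=
  G.dirac nablaS (-1) A s x + (2 : ℝ) • s x

theorem cliffFormVal_add {W : Type*} [AddCommGroup W] [Module ℝ W] (x : M) (p : ℕ)
    (β β' : (Fin p → TM M x) → W) (u : SM M x) :
    G.cliffFormVal x p (fun v => β v + β' v) u =
      G.cliffFormVal x p β u + G.cliffFormVal x p β' u := by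
  refine LinearMap.ext fun w => ?_
  simp [cliffFormVal, smul_add, Finset.sum_add_distrib]

theorem cliffFormVal_smul {W : Type*} [AddCommGroup W] [Module ℝ W] (x : M) (p : ℕ) (c : ℝ)
    (β : (Fin p → TM M x) → W) (u : SM M x) :
    G.cliffFormVal x p (fun v => c • β v) u = c • G.cliffFormVal x p β u := by
  refine LinearMap.ext fun w => ?_
  simp [cliffFormVal, Finset.smul_sum, smul_comm c]

section Linearity

variable {ε ε' : ∀ x : M, TM M x →ₗ[ℝ] Q.AdFiber x}
  {s s' : ∀ x : M, SM M x →ₗ[ℝ] Q.AdFiber x}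

theorem dA_add (A : Q.Connection) (hε : ε ∈ Q.smoothHom E7 (TM M)) (hε' : ε' ∈ Q.smoothHom E7 (TM M))
    (x : M) (v : Fin 2 → TM M x) : dA A (ε + ε') x v = dA A ε x v + dA A ε' x v := by
  have h := fun w : TM M x => A.cov_add (PrincipalBundle.smoothAdAt_extend hε x w)
    (PrincipalBundle.smoothAdAt_extend hε' x w)
  simp only [dA, Pi.add_apply, LinearMap.add_apply, h]
  abel

theorem dA_smul (A : Q.Connection) (hε : ε ∈ Q.smoothHom E7 (TM M)) (c : ℝ)
    (x : M) (v : Fin 2 → TM M x) : dA A (c • ε) x v = c • dA A ε x v := by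
  have h := fun w : TM M x => A.cov_smul (PrincipalBundle.smoothAdAt_extend hε x w) c
  simp only [dA, Pi.smul_apply, LinearMap.smul_apply, h, smul_sub]

theorem dAstar_add (nabla : CovariantDerivative 𝓘(ℝ, E7) E7 (TM M)) (A : Q.Connection)
    (hε : ε ∈ Q.smoothHom E7 (TM M)) (hε' : ε' ∈ Q.smoothHom E7 (TM M)) (x : M) :
    G.dAstar nabla A (ε + ε') x = G.dAstar nabla A ε x + G.dAstar nabla A ε' x := by
  have h := fun w : TM M x => A.cov_add (PrincipalBundle.smoothAdAt_extend hε x w)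
    (PrincipalBundle.smoothAdAt_extend hε' x w)
  simp only [dAstar, Pi.add_apply, LinearMap.add_apply, h, ← neg_add, ← Finset.sum_add_distrib]
  congr 1
  refine Finset.sum_congr rfl fun a _ => ?_
  abel

theorem dAstar_smul (nabla : CovariantDerivative 𝓘(ℝ, E7) E7 (TM M)) (A : Q.Connection)
    (hε : ε ∈ Q.smoothHom E7 (TM M)) (c : ℝ) (x : M) :
    G.dAstar nabla A (c • ε) x = c • G.dAstar nabla A ε x := by
  have h := fun w : TM M x => A.cov_smul (PrincipalBundle.smoothAdAt_extend hε x w) c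
  simp only [dAstar, Pi.smul_apply, LinearMap.smul_apply, h, smul_neg, Finset.smul_sum, smul_sub]

theorem dirac_add (nablaS : CovariantDerivative 𝓘(ℝ, E7) (ℝ × E7) (SM M)) (t : ℝ) (A : Q.Connection)
    (hs : s ∈ Q.smoothHom (ℝ × E7) (SM M)) (hs' : s' ∈ Q.smoothHom (ℝ × E7) (SM M)) (x : M) :
    G.dirac nablaS t A (s + s') x = G.dirac nablaS t A s x + G.dirac nablaS t A s' x := by
  have h := fun w : SM M x => A.cov_add (PrincipalBundle.smoothAdAt_extend hs x w)
    (PrincipalBundle.smoothAdAt_extend hs' x w)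
  refine LinearMap.ext fun u => ?_
  simp only [dirac, twistedCov, cliffHom, Pi.add_apply, LinearMap.add_apply, h,
    LinearMap.coe_sum, Finset.sum_apply, LinearMap.neg_apply, LinearMap.comp_apply,
    LinearMap.smulRight_apply, ← Finset.sum_add_distrib, ← neg_add, ← smul_add]
  refine Finset.sum_congr rfl fun a _ => congrArg _ (Finset.sum_congr rfl fun b _ => ?_)
  congr 1
  abel

theorem dirac_smul (nablaS : CovariantDerivative 𝓘(ℝ, E7) (ℝ × E7) (SM M)) (t : ℝ) (A : Q.Connection)
    (hs : s ∈ Q.smoothHom (ℝ × E7) (SM M)) (c : ℝ) (x : M) :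
    G.dirac nablaS t A (c • s) x = c • G.dirac nablaS t A s x := by
  have h := fun w : SM M x => A.cov_smul (PrincipalBundle.smoothAdAt_extend hs x w) c
  refine LinearMap.ext fun u => ?_
  simp only [dirac, twistedCov, cliffHom, Pi.smul_apply, LinearMap.smul_apply, h,
    LinearMap.coe_sum, Finset.sum_apply, LinearMap.neg_apply, LinearMap.comp_apply,
    LinearMap.smulRight_apply, Finset.smul_sum, smul_neg]
  refine Finset.sum_congr rfl fun a _ => congrArg _ (Finset.sum_congr rfl fun b _ => ?_)
  rw [smul_comm]
  exact congrArg _ (smul_sub c _ _).symm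

end Linearity

/-- The space of infinitesimal deformations of `A`: the smooth one-forms `ε` with values in `Ad_P` with
`(d^A ε) · η = 0` and `(d^A)^* ε = 0`. -/
def deformations (nabla : CovariantDerivative 𝓘(ℝ, E7) E7 (TM M)) (A : Q.Connection) :
    Submodule ℝ (∀ x : M, TM M x →ₗ[ℝ] Q.AdFiber x) where
  carrier := {ε | ε ∈ Q.smoothHom E7 (TM M) ∧ G.IsDeformation nabla A ε}
  add_mem' := by
    rintro ε ε' ⟨hε, h⟩ ⟨hε', h'⟩
    refine ⟨add_mem hε hε', fun x => ⟨?_, ?_⟩⟩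
    · rw [show dA A (ε + ε') x = fun v => dA A ε x v + dA A ε' x v from
        funext (dA_add A hε hε' x), cliffFormVal_add, (h x).1, (h' x).1, add_zero]
    · rw [G.dAstar_add nabla A hε hε', (h x).2, (h' x).2, add_zero]
  zero_mem' := by
    have h0 := zero_mem (Q.smoothHom E7 (TM M))
    refine ⟨h0, fun x => ⟨?_, ?_⟩⟩
    · have h := funext (dA_smul A h0 0 x)
      rw [zero_smul] at h
      rw [h, cliffFormVal_smul, zero_smul]
    · have h := G.dAstar_smul nabla A h0 0 x
      rwa [zero_smul, zero_smul] at h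
  smul_mem' := by
    rintro c ε ⟨hε, h⟩
    refine ⟨Submodule.smul_mem _ c hε, fun x => ⟨?_, ?_⟩⟩
    · rw [show dA A (c • ε) x = fun v => c • dA A ε x v from
        funext (dA_smul A hε c x), cliffFormVal_smul, (h x).1, smul_zero]
    · rw [G.dAstar_smul nabla A hε, (h x).2, smul_zero]

/-- The kernel of `D^{-1,A} + 2 Id` on `Γ(Λ¹ · η ⊗ Ad_P)`: the smooth sections `s` of `S ⊗ Ad_P` with values
in `Λ¹ · η ⊗ Ad_P` such that `D^{-1,A} s + 2 s = 0`. -/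
def diracKernel (nablaS : CovariantDerivative 𝓘(ℝ, E7) (ℝ × E7) (SM M)) (A : Q.Connection) :
    Submodule ℝ (∀ x : M, SM M x →ₗ[ℝ] Q.AdFiber x) where
  carrier := {s | s ∈ Q.smoothHom (ℝ × E7) (SM M) ∧
    (∀ x, ∃ α : TM M x →ₗ[ℝ] Q.AdFiber x, s x = G.cliffFormVal x 1 (fun v => α (v 0)) (eta x)) ∧
    ∀ x, G.diracShift nablaS A s x = 0}
  add_mem' := by
    rintro s s' ⟨hs, h1, h⟩ ⟨hs', h1', h'⟩
    refine ⟨add_mem hs hs', fun x => ?_, fun x => ?_⟩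
    · obtain ⟨α, hα⟩ := h1 x
      obtain ⟨β, hβ⟩ := h1' x
      refine ⟨α + β, ?_⟩
      rw [Pi.add_apply, hα, hβ, ← cliffFormVal_add]
      rfl
    · have h2 := h x
      have h3 := h' x
      simp only [diracShift] at h2 h3 ⊢
      rw [G.dirac_add nablaS _ A hs hs', Pi.add_apply, smul_add, add_add_add_comm, h2, h3, add_zero]
  zero_mem' := by
    have h0 := zero_mem (Q.smoothHom (ℝ × E7) (SM M))
    refine ⟨h0, fun x => ⟨0, ?_⟩, fun x => ?_⟩
    · refine LinearMap.ext fun w => ?_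
      simp [cliffFormVal]
    · have h := G.dirac_smul nablaS (-1) A h0 0 x
      rw [zero_smul, zero_smul] at h
      simp [diracShift, h]
  smul_mem' := by
    rintro c s ⟨hs, h1, h⟩
    refine ⟨Submodule.smul_mem _ c hs, fun x => ?_, fun x => ?_⟩
    · obtain ⟨α, hα⟩ := h1 x
      refine ⟨c • α, ?_⟩
      rw [Pi.smul_apply, hα, ← cliffFormVal_smul]
      rfl
    · have h2 := h x
      simp only [diracShift] at h2 ⊢
      rw [G.dirac_smul nablaS _ A hs, Pi.smul_apply, smul_comm, ← smul_add, h2, smul_zero]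

end G2Structure

/-- A first-order operator `L` on sections of `S ⊗ Ad_P` is elliptic: there is a principal symbol
`symb x ξ`, linear in the covector `ξ`, with `[L, f] s = symb(df) s` for all smooth functions `f` and all smooth
sections `s`, and `symb x ξ` is invertible for `ξ ≠ 0`. -/
def IsElliptic {EK : Type*} [NormedAddCommGroup EK] [NormedSpace ℝ EK]
    {EP : Type*} [NormedAddCommGroup EP] [NormedSpace ℝ EP]
    {K P : Type*} [TopologicalSpace K] [ChartedSpace EK K] [Group K]
    [TopologicalSpace P] [ChartedSpace EP P]
    (Q : PrincipalBundle E7 EK EP M K P)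
    (L : (∀ x : M, SM M x →ₗ[ℝ] Q.AdFiber x) → ∀ x : M, SM M x →ₗ[ℝ] Q.AdFiber x) : Prop :=
  ∃ symb : ∀ x : M, (TM M x →L[ℝ] ℝ) →ₗ[ℝ] Module.End ℝ (SM M x →ₗ[ℝ] Q.AdFiber x),
    (∀ f : M → ℝ, ContMDiff 𝓘(ℝ, E7) 𝓘(ℝ, ℝ) ∞ f → ∀ s ∈ Q.smoothHom (ℝ × E7) (SM M), ∀ x : M,
      L (fun y => f y • s y) x - f x • L s x = symb x (mvfderiv 𝓘(ℝ, E7) f x) (s x)) ∧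
    ∀ (x : M) (ξ : TM M x →L[ℝ] ℝ), ξ ≠ 0 → Function.Bijective (symb x ξ)

end Geometry

end

end NearlyG2

/-!
The spinor field `η = (1, 0)` of a nearly parallel `G₂`-structure with `dφ = 4ψ` is a Killing spinor,
`∇^{LC}_X η = -(1/2) X · η` (`IsSpinConnection.nablaS_eta`).  Granted this, the twisted Dirac operator can be computed on
`ε · η` for a one-form `ε` with values in `Ad_P` (`dirac_mulEta`):
`D^{t,A}(ε · η) = (d^A)^* ε ⊗ η + (d^A ε) · η - (t + 5)/2 ε · η`.
The first term is a section of `Λ⁰ ⊗ Ad_P`, the second one of `Λ¹ ⊗ Ad_P`.  Hence `ε · η` is an eigensection for the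
eigenvalue `-(t + 5)/2` exactly if both vanish, which are the equations for an infinitesimal deformation
(`isDeformation_iff`).  The constant comes from the Killing equation, the torsion term `(t/6) (i_X φ) · u` and the
contraction `∑ e_a × (e_a × Y) = -6 Y`.  For `t = -1` the eigenvalue is `-2`, and `ε ↦ ε · η` is a bijection from one-forms
onto the sections of `Λ¹ · η ⊗ Ad_P` (`deformationsToKernel_bijective`).  Ellipticity holds for every Dirac operator: the
symbol is Clifford multiplication, whose square is `-|ξ|²` (`diracSymbol_bijective`).

The Killing equation is proved as follows.  Since `|η| = 1`, one has `∇_X η = (0, b(X))` for an endomorphism `b` of the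
tangent bundle.  Differentiating the Clifford products `Y · (Z · η)` expresses `∇φ` and `∇ψ` through `b`
(`IsSpinConnection.nabla_cross`): `∇_X φ` is `2 i_{b(X)} ψ` and `∇_X ψ` is `-2 b(X) ∧ φ`.  After alternation, `dφ = 4ψ` and
its consequence `dψ = 0` become linear equations for the components of `b` in an adapted frame, whose only solution is
`b = 1/2` (`eq_half_of_deriv_psiZ`).  The exterior derivatives are computed in coordinate vector fields, which commute, so that
the Levi-Civita terms drop out.

Identities between the components of `φ`, `ψ` and the cross product in an adapted frame are finite, and are decided by
evaluation over the integers; `IsCross` transfers them to statements about vectors.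
-/

namespace NearlyG2

noncomputable section

/-! ### The model three-form and four-form -/

/-- The signs `phi0 i j k`, `k` being the third point on the line through `i` and `j`. -/
def lineSign : Fin 7 → Fin 7 → ℤ :=
  ![![0, 1, -1, 1, -1, -1, 1], ![-1, 0, 1, 1, 1, -1, -1], ![1, -1, 0, 1, -1, 1, -1],
    ![-1, -1, -1, 0, 1, 1, 1], ![1, -1, 1, -1, 0, -1, 1], ![1, 1, -1, -1, 1, 0, -1],
    ![-1, 1, 1, -1, -1, 1, 0]]

/-- The components of the model three-form as integers.  The indices, shifted by one and written in binary, are the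
points of the Fano plane, three points being collinear if their bitwise sum vanishes. -/
def phiZ (i j k : Fin 7) : ℤ :=
  if Nat.xor (i.1 + 1) (j.1 + 1) = k.1 + 1 then lineSign i j else 0

/-- The components of the model four-form as integers. -/
def psiZ (i j k l : Fin 7) : ℤ :=
  (if i = k then 1 else 0) * (if j = l then 1 else 0)
    - (if i = l then 1 else 0) * (if j = k then 1 else 0)
    - (if Nat.xor (i.1 + 1) (j.1 + 1) = Nat.xor (k.1 + 1) (l.1 + 1)
        then lineSign i j * lineSign k l else 0)

/-- `tripleCoeff` as an integer. -/
def tripleZ (a b c i j k : Fin 7) : ℤ :=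
  let d (x y : Fin 7) : ℤ := if x = y then 1 else 0
  d a i * d b j * d c k - d a i * d b k * d c j - d a j * d b i * d c k
    + d a j * d b k * d c i + d a k * d b i * d c j - d a k * d b j * d c i

theorem tripleCoeff_eq (a b c i j k : Fin 7) : tripleCoeff a b c i j k = tripleZ a b c i j k := by
  simp only [tripleCoeff, tripleZ, Matrix.det_fin_three, Matrix.of_apply, Matrix.cons_val_zero,
    Matrix.cons_val_one, Matrix.cons_val]
  push_cast
  rfl

theorem phi0_eq (i j k : Fin 7) : phi0 i j k = phiZ i j k := by
  have h : ∀ i j k : Fin 7, tripleZ 0 1 2 i j k + tripleZ 0 3 4 i j k - tripleZ 0 5 6 i j k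
      + tripleZ 1 3 5 i j k + tripleZ 1 4 6 i j k + tripleZ 2 3 6 i j k
      - tripleZ 2 4 5 i j k = phiZ i j k := by decide +kernel
  rw [← h]
  simp only [phi0, tripleCoeff_eq]
  push_cast
  rfl

/-- The third point on the line through `i` and `j`. -/
def thirdPoint (i j : Fin 7) : Fin 7 := Fin.ofNat 7 (Nat.xor (i.1 + 1) (j.1 + 1) - 1)

theorem sum_mul_phiZ (f : Fin 7 → ℤ) (i j : Fin 7) :
    ∑ m, f m * phiZ i j m = f (thirdPoint i j) * lineSign i j := by
  have h : ∀ i j m : Fin 7, phiZ i j m = if m = thirdPoint i j then lineSign i j else 0 := by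
    decide +kernel
  simp [h]

theorem sum_phiZ_mul_phiZ (i j k l : Fin 7) :
    ∑ m, phiZ i j m * phiZ k l m =
      (if i = k then 1 else 0) * (if j = l then 1 else 0)
        - (if i = l then 1 else 0) * (if j = k then 1 else 0) - psiZ i j k l := by
  have h : ∀ i j k l : Fin 7, phiZ i j (thirdPoint k l) * lineSign k l =
      (if Nat.xor (i.1 + 1) (j.1 + 1) = Nat.xor (k.1 + 1) (l.1 + 1)
        then lineSign i j * lineSign k l else 0) := by decide +kernel
  rw [sum_mul_phiZ, h, psiZ]
  ring

/-- The sign of a comparison. -/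
def ltSign (a b : Fin 7) : ℤ := if a < b then 1 else if b < a then -1 else 0

/-- The product of the comparison signs between the triple `a, b, c` and the quadruple `i, j, k, l`. -/
def crossSign (a b c i j k l : Fin 7) : ℤ :=
  ltSign a i * ltSign a j * ltSign a k * ltSign a l * ltSign b i * ltSign b j * ltSign b k
    * ltSign b l * ltSign c i * ltSign c j * ltSign c k * ltSign c l

set_option maxRecDepth 100000 in
/-- `ψ = ⋆φ₀` in components: the sign of a permutation of `0, …, 6` is the product of the comparison signs of all
pairs, so each term `±e^{abc}` of `φ₀` contributes `±1` where `i, j, k, l` complete `a, b, c`. -/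
theorem psiZ_eq_crossSign (i j k l : Fin 7) :
    ltSign i j * ltSign i k * ltSign i l * ltSign j k * ltSign j l * ltSign k l *
      (crossSign 0 1 2 i j k l + crossSign 0 3 4 i j k l - crossSign 0 5 6 i j k l
        + crossSign 1 3 5 i j k l + crossSign 1 4 6 i j k l + crossSign 2 3 6 i j k l
        - crossSign 2 4 5 i j k l) = psiZ i j k l := by
  revert i j k l
  decide +kernel

/-- The coefficient of the volume form of a basis on basis vectors, as a product of comparison signs. -/
theorem det_basis_comp {V : Type*} [AddCommGroup V] [Module ℝ V] (b : Module.Basis (Fin 7) ℝ V)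
    (τ : Fin 7 → Fin 7) :
    b.det (fun r => b (τ r)) = ((∏ i, ∏ j ∈ Finset.Ioi i, ltSign (τ i) (τ j) : ℤ) : ℝ) := by
  by_cases h : Function.Injective τ
  · have hσ := Equiv.ofBijective_apply τ (Finite.injective_iff_bijective.1 h)
    set σ := Equiv.ofBijective τ (Finite.injective_iff_bijective.1 h)
    have h1 := b.det.map_perm b σ
    rw [b.det_self] at h1
    have h2 : (fun r => b (τ r)) = b ∘ σ := by funext r; simp [hσ]
    rw [h2]
    refine h1.trans ?_
    rw [Equiv.Perm.sign_eq_prod_prod_Ioi]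
    simp only [Units.smul_def, zsmul_eq_mul, mul_one]
    congr 1
    push_cast
    refine Finset.prod_congr rfl fun i _ => Finset.prod_congr rfl fun j hj => ?_
    have hne : τ i ≠ τ j := fun e => (Finset.mem_Ioi.1 hj).ne (h e)
    rw [hσ, hσ, ltSign]
    rcases lt_or_gt_of_ne hne with hlt | hlt
    · simp [hlt]
    · simp [hlt, hlt.not_gt]
  · obtain ⟨i, j, hij, hne⟩ : ∃ i j, τ i = τ j ∧ i ≠ j := by
      simpa [Function.Injective] using h
    rw [b.det.map_eq_zero_of_eq _ (i := i) (j := j) (by simp [hij]) hne]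
    symm
    rw [Int.cast_eq_zero]
    rcases lt_or_gt_of_ne hne with hlt | hlt
    · exact Finset.prod_eq_zero (Finset.mem_univ i)
        (Finset.prod_eq_zero (Finset.mem_Ioi.2 hlt) (by simp [hij, ltSign]))
    · exact Finset.prod_eq_zero (Finset.mem_univ j)
        (Finset.prod_eq_zero (Finset.mem_Ioi.2 hlt) (by simp [hij, ltSign]))

/-- Contraction of the elementary three-form with an alternating function of three indices. -/
theorem sum_tripleCoeff_mul (F : (Fin 3 → Fin 7) → ℝ)
    (hF : ∀ (σ : Equiv.Perm (Fin 3)) (I : Fin 3 → Fin 7),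
      F (I ∘ σ) = ((Equiv.Perm.sign σ : ℤ) : ℝ) * F I)
    (a b c : Fin 7) :
    ∑ I : Fin 3 → Fin 7, tripleCoeff a b c (I 0) (I 1) (I 2) * F I = 6 * F ![a, b, c] := by
  have h1 : ∀ I : Fin 3 → Fin 7, tripleCoeff a b c (I 0) (I 1) (I 2) =
      ∑ σ : Equiv.Perm (Fin 3), ((Equiv.Perm.sign σ : ℤ) : ℝ) *
        (if ![a, b, c] ∘ σ = I then 1 else 0) := by
    intro I
    have hI : ![I 0, I 1, I 2] = I := by ext r; fin_cases r <;> rfl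
    rw [tripleCoeff, hI, Matrix.det_apply']
    refine Finset.sum_congr rfl fun σ _ => ?_
    congr 1
    simp only [Matrix.of_apply, Finset.prod_ite_zero, Finset.prod_const_one, Finset.mem_univ,
      true_imp_iff, funext_iff, Function.comp_apply]
  simp only [h1, Finset.sum_mul]
  rw [Finset.sum_comm]
  have h2 : ∀ σ : Equiv.Perm (Fin 3), ∑ I : Fin 3 → Fin 7,
      ((Equiv.Perm.sign σ : ℤ) : ℝ) * (if ![a, b, c] ∘ σ = I then 1 else 0) * F I =
      F ![a, b, c] := by
    intro σ
    simp only [mul_ite, mul_one, mul_zero, ite_mul, zero_mul, Finset.sum_ite_eq, Finset.mem_univ,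
      if_true, hF]
    rw [← mul_assoc, ← Int.cast_mul, ← Units.val_mul, Int.units_mul_self]
    simp
  simp only [h2, Finset.sum_const, Finset.card_univ, Fintype.card_perm, Fintype.card_fin]
  norm_num [Nat.factorial]

/-- The components of `⋆φ₀`. -/
theorem hodgeStar_phi0 {V : Type*} [AddCommGroup V] [Module ℝ V] (b : Module.Basis (Fin 7) ℝ V)
    (α : (Fin 3 → V) → ℝ) (hα : ∀ I : Fin 3 → Fin 7, α (fun r => b (I r)) = phi0 (I 0) (I 1) (I 2))
    (J : Fin 4 → Fin 7) :
    hodgeStar b 3 4 rfl α (fun r => b (J r)) = psiZ (J 0) (J 1) (J 2) (J 3) := by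
  have happ : ∀ I : Fin 3 → Fin 7, (fun k : Fin 7 =>
      Fin.append (fun r => b (I r)) (fun r => b (J r)) (Fin.cast rfl k)) =
      fun k => b ((![I 0, I 1, I 2, J 0, J 1, J 2, J 3] : Fin 7 → Fin 7) k) := by
    intro I
    funext k
    fin_cases k <;> rfl
  set F : (Fin 3 → Fin 7) → ℝ := fun I => b.det (fun k : Fin 7 =>
      Fin.append (fun r => b (I r)) (fun r => b (J r)) (Fin.cast rfl k)) with hFdef
  have hFZ : ∀ i j k, F ![i, j, k] = ((ltSign i j * ltSign i k * ltSign j k *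
      crossSign i j k (J 0) (J 1) (J 2) (J 3) * (ltSign (J 0) (J 1) * ltSign (J 0) (J 2) *
        ltSign (J 0) (J 3) * ltSign (J 1) (J 2) * ltSign (J 1) (J 3) * ltSign (J 2) (J 3)) : ℤ) :
          ℝ) := by
    intro i j k
    simp only [hFdef, happ, det_basis_comp, Fin.prod_univ_seven,
      show Finset.Ioi (0 : Fin 7) = {1, 2, 3, 4, 5, 6} from rfl,
      show Finset.Ioi (1 : Fin 7) = {2, 3, 4, 5, 6} from rfl,
      show Finset.Ioi (2 : Fin 7) = {3, 4, 5, 6} from rfl,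
      show Finset.Ioi (3 : Fin 7) = {4, 5, 6} from rfl,
      show Finset.Ioi (4 : Fin 7) = {5, 6} from rfl,
      show Finset.Ioi (5 : Fin 7) = {6} from rfl, show Finset.Ioi (6 : Fin 7) = ∅ from rfl]
    simp [crossSign]
    ring
  have hF : ∀ (σ : Equiv.Perm (Fin 3)) (I : Fin 3 → Fin 7),
      F (I ∘ σ) = ((Equiv.Perm.sign σ : ℤ) : ℝ) * F I := by
    intro σ I
    set w : Fin 7 → V := fun k : Fin 7 =>
      Fin.append (fun r => b (I r)) (fun r => b (J r)) (Fin.cast rfl k) with hw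
    let e : Fin 3 ⊕ Fin 4 ≃ Fin 7 := finSumFinEquiv
    have h := b.det.map_perm w (e.permCongr (Equiv.Perm.sumCongr σ 1))
    rw [Equiv.Perm.sign_permCongr, Equiv.Perm.sign_sumCongr, Equiv.Perm.sign_one, mul_one] at h
    have hp : w ∘ (e.permCongr (Equiv.Perm.sumCongr σ 1)) = fun k : Fin 7 =>
        Fin.append (fun r => b ((I ∘ σ) r)) (fun r => b (J r)) (Fin.cast rfl k) := by
      funext k
      obtain ⟨k, rfl⟩ := e.surjective k
      have hl : ∀ (f : Fin 3 → V) (g : Fin 4 → V) (r : Fin 3),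
          Fin.append f g (finSumFinEquiv (Sum.inl r)) = f r := fun f g r => by
        rw [finSumFinEquiv_apply_left, Fin.append_left]
      have hr : ∀ (f : Fin 3 → V) (g : Fin 4 → V) (r : Fin 4),
          Fin.append f g (finSumFinEquiv (Sum.inr r)) = g r := fun f g r => by
        rw [finSumFinEquiv_apply_right, Fin.append_right]
      rcases k with k | k <;> simp only [hw, e, Equiv.permCongr_apply, Function.comp_apply,
        Equiv.symm_apply_apply, Equiv.Perm.sumCongr_apply, Sum.map_inl, Sum.map_inr, Fin.cast_eq_self]
      · exact (hl _ _ _).trans (hl (fun r => b (I (σ r))) (fun r => b (J r)) k).symm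
      · exact (hr _ _ _).trans (hr (fun r => b (I (σ r))) (fun r => b (J r)) k).symm
    rw [hp] at h
    refine h.trans ?_
    simp only [Units.smul_def, zsmul_eq_mul]
    rfl
  have h6 : hodgeStar b 3 4 rfl α (fun r => b (J r)) = (6 : ℝ)⁻¹ * ∑ I, phi0 (I 0) (I 1) (I 2) * F I := by
    simp only [hodgeStar, hα, smul_eq_mul, hFdef]
    norm_num [Nat.factorial, mul_comm]
  rw [h6]
  simp only [phi0, add_mul, sub_mul, Finset.sum_add_distrib, Finset.sum_sub_distrib,
    sum_tripleCoeff_mul F hF, hFZ]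
  rw [← psiZ_eq_crossSign]
  simp only [show ltSign 0 1 = 1 from rfl, show ltSign 0 2 = 1 from rfl,show ltSign 1 2 = 1 from rfl,
    show ltSign 0 3 = 1 from rfl, show ltSign 0 4 = 1 from rfl,show ltSign 3 4 = 1 from rfl,
    show ltSign 0 5 = 1 from rfl, show ltSign 0 6 = 1 from rfl,show ltSign 5 6 = 1 from rfl,
    show ltSign 1 3 = 1 from rfl, show ltSign 1 5 = 1 from rfl,show ltSign 3 5 = 1 from rfl,
    show ltSign 1 4 = 1 from rfl, show ltSign 1 6 = 1 from rfl,show ltSign 4 6 = 1 from rfl,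
    show ltSign 2 3 = 1 from rfl, show ltSign 2 6 = 1 from rfl,show ltSign 3 6 = 1 from rfl,
    show ltSign 2 4 = 1 from rfl, show ltSign 2 5 = 1 from rfl,show ltSign 4 5 = 1 from rfl]
  push_cast
  ring

set_option maxHeartbeats 1000000 in
/-- The linear algebra behind the Killing equation.  With `∇_{e_q} η = (0, ∑ b p q e_p)`, the equation `dφ = 4ψ` is `hI`
and `dψ = 0` is `hII`; together they have the only solution `b = 1/2`. -/
theorem eq_half_of_deriv_psiZ (b : Fin 7 → Fin 7 → ℝ)
    (hI : ∀ i j k l, ∑ p, (b p i * psiZ p j k l + b p j * psiZ i p k l + b p k * psiZ i j p l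
      + b p l * psiZ i j k p) = 2 * psiZ i j k l)
    (hII : ∀ i j k l m, (b i j - b j i) * phiZ k l m - (b i k - b k i) * phiZ j l m
      + (b i l - b l i) * phiZ j k m - (b i m - b m i) * phiZ j k l + (b j k - b k j) * phiZ i l m
      - (b j l - b l j) * phiZ i k m + (b j m - b m j) * phiZ i k l
      + (b k l - b l k) * phiZ i j m - (b k m - b m k) * phiZ i j l
      + (b l m - b m l) * phiZ i j k = 0) (p q : Fin 7) :
    b p q = if p = q then 1 / 2 else 0 := by
  -- The system decouples into the diagonal entries and, for each point of the Fano plane, the six entries whose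
  -- indices lie on a common line with that point.
  have g0 : b 0 0 = 2⁻¹ ∧ b 1 1 = 2⁻¹ ∧ b 2 2 = 2⁻¹ ∧ b 3 3 = 2⁻¹ ∧
      b 4 4 = 2⁻¹ ∧ b 5 5 = 2⁻¹ ∧ b 6 6 = 2⁻¹ := by
    have h0 := hI 0 1 3 6
    have h1 := hI 0 1 4 5
    have h2 := hI 0 2 3 5
    have h3 := hI 0 2 4 6
    have h4 := hI 1 2 3 4
    have h5 := hI 1 2 5 6
    have h6 := hI 3 4 5 6
    simp [Fin.sum_univ_seven, psiZ, lineSign] at h0 h1 h2 h3 h4 h5 h6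
    refine ⟨?_, ?_, ?_, ?_, ?_, ?_, ?_⟩ <;> linarith
  have g1 : b 1 2 = 0 ∧ b 2 1 = 0 ∧ b 3 4 = 0 ∧ b 4 3 = 0 ∧ b 5 6 = 0 ∧ b 6 5 = 0 := by
    have h0 := hI 0 1 3 5
    have h1 := hI 0 1 4 6
    have h2 := hI 0 2 3 6
    have h3 := hI 0 2 4 5
    have h4 := hII 0 1 2 3 4
    have h5 := hII 0 1 2 5 6
    have h6 := hII 0 3 4 5 6
    simp [Fin.sum_univ_seven, psiZ, phiZ, lineSign] at h0 h1 h2 h3 h4 h5 h6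
    refine ⟨?_, ?_, ?_, ?_, ?_, ?_⟩ <;> linarith
  have g2 : b 0 2 = 0 ∧ b 2 0 = 0 ∧ b 3 5 = 0 ∧ b 4 6 = 0 ∧ b 5 3 = 0 ∧ b 6 4 = 0 := by
    have h0 := hI 0 1 3 4
    have h1 := hI 0 1 5 6
    have h2 := hI 1 2 3 6
    have h3 := hI 1 2 4 5
    have h4 := hII 0 1 2 3 5
    have h5 := hII 0 1 2 4 6
    have h6 := hII 1 3 4 5 6
    simp [Fin.sum_univ_seven, psiZ, phiZ, lineSign] at h0 h1 h2 h3 h4 h5 h6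
    refine ⟨?_, ?_, ?_, ?_, ?_, ?_⟩ <;> linarith
  have g3 : b 0 1 = 0 ∧ b 1 0 = 0 ∧ b 3 6 = 0 ∧ b 4 5 = 0 ∧ b 5 4 = 0 ∧ b 6 3 = 0 := by
    have h0 := hI 0 2 3 4
    have h1 := hI 0 2 5 6
    have h2 := hI 1 2 3 5
    have h3 := hI 1 2 4 6
    have h4 := hII 0 1 2 3 6
    have h5 := hII 0 1 2 4 5
    have h6 := hII 2 3 4 5 6
    simp [Fin.sum_univ_seven, psiZ, phiZ, lineSign] at h0 h1 h2 h3 h4 h5 h6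
    refine ⟨?_, ?_, ?_, ?_, ?_, ?_⟩ <;> linarith
  have g4 : b 0 4 = 0 ∧ b 1 5 = 0 ∧ b 2 6 = 0 ∧ b 4 0 = 0 ∧ b 5 1 = 0 ∧ b 6 2 = 0 := by
    have h0 := hI 0 1 2 3
    have h1 := hI 0 3 5 6
    have h2 := hI 1 3 4 6
    have h3 := hI 2 3 4 5
    have h4 := hII 0 1 3 4 5
    have h5 := hII 0 2 3 4 6
    have h6 := hII 1 2 3 5 6
    simp [Fin.sum_univ_seven, psiZ, phiZ, lineSign] at h0 h1 h2 h3 h4 h5 h6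
    refine ⟨?_, ?_, ?_, ?_, ?_, ?_⟩ <;> linarith
  have g5 : b 0 3 = 0 ∧ b 1 6 = 0 ∧ b 2 5 = 0 ∧ b 3 0 = 0 ∧ b 5 2 = 0 ∧ b 6 1 = 0 := by
    have h0 := hI 0 1 2 4
    have h1 := hI 0 4 5 6
    have h2 := hI 1 3 4 5
    have h3 := hI 2 3 4 6
    have h4 := hII 0 1 3 4 6
    have h5 := hII 0 2 3 4 5
    have h6 := hII 1 2 4 5 6
    simp [Fin.sum_univ_seven, psiZ, phiZ, lineSign] at h0 h1 h2 h3 h4 h5 h6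
    refine ⟨?_, ?_, ?_, ?_, ?_, ?_⟩ <;> linarith
  have g6 : b 0 6 = 0 ∧ b 1 3 = 0 ∧ b 2 4 = 0 ∧ b 3 1 = 0 ∧ b 4 2 = 0 ∧ b 6 0 = 0 := by
    have h0 := hI 0 1 2 5
    have h1 := hI 0 3 4 5
    have h2 := hI 1 4 5 6
    have h3 := hI 2 3 5 6
    have h4 := hII 0 1 3 5 6
    have h5 := hII 0 2 4 5 6
    have h6 := hII 1 2 3 4 5
    simp [Fin.sum_univ_seven, psiZ, phiZ, lineSign] at h0 h1 h2 h3 h4 h5 h6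
    refine ⟨?_, ?_, ?_, ?_, ?_, ?_⟩ <;> linarith
  have g7 : b 0 5 = 0 ∧ b 1 4 = 0 ∧ b 2 3 = 0 ∧ b 3 2 = 0 ∧ b 4 1 = 0 ∧ b 5 0 = 0 := by
    have h0 := hI 0 1 2 6
    have h1 := hI 0 3 4 6
    have h2 := hI 1 3 5 6
    have h3 := hI 2 4 5 6
    have h4 := hII 0 1 4 5 6
    have h5 := hII 0 2 3 5 6
    have h6 := hII 1 2 3 4 6
    simp [Fin.sum_univ_seven, psiZ, phiZ, lineSign] at h0 h1 h2 h3 h4 h5 h6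
    refine ⟨?_, ?_, ?_, ?_, ?_, ?_⟩ <;> linarith
  clear hI hII
  fin_cases p <;> fin_cases q <;> simp <;> tauto

/-! ### Seven-dimensional cross products -/

section CrossProduct

variable {V : Type*} [NormedAddCommGroup V] [InnerProductSpace ℝ V]

theorem eq_zero_of_frame {W : Type*} [AddCommGroup W] [Module ℝ W]
    (e : OrthonormalBasis (Fin 7) ℝ V) (F : V → W) (hadd : ∀ a b, F (a + b) = F a + F b)
    (hsmul : ∀ (r : ℝ) a, F (r • a) = r • F a) (h : ∀ i, F (e i) = 0) (a : V) : F a = 0 := by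
  let L : V →ₗ[ℝ] W := ⟨⟨F, hadd⟩, hsmul⟩
  have hL : L = 0 := e.toBasis.ext fun i => by simpa [L] using h i
  exact congrArg (fun T : V →ₗ[ℝ] W => T a) hL

/-- A bilinear map that is the model cross product in some orthonormal basis. -/
structure IsCross (e : OrthonormalBasis (Fin 7) ℝ V) (C : V →ₗ[ℝ] V →ₗ[ℝ] V) : Prop where
  inner_frame : ∀ i j k, inner ℝ (C (e i) (e j)) (e k) = phiZ i j k

/-- The four-form `ψ` of a cross product, `ψ(a, b, c, d) = -⟨a × b, c × d⟩ + ⟨a, c⟩⟨b, d⟩ - ⟨a, d⟩⟨b, c⟩`. -/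
def fourForm (C : V →ₗ[ℝ] V →ₗ[ℝ] V) (a b c d : V) : ℝ :=
  -inner ℝ (C a b) (C c d) + inner ℝ a c * inner ℝ b d - inner ℝ a d * inner ℝ b c

/-- The value `(∇_X ×)(z, y)` of the derivative of the cross product when `∇_X η = (0, b)`. -/
def crossVar (C : V →ₗ[ℝ] V →ₗ[ℝ] V) (b z y : V) : V :=
  inner ℝ z y • b - C (C z y) b - inner ℝ y b • z + C z (C y b)

/-- The derivative of the four-form when the derivative of the cross product is `crossVar C b`. -/
def fourFormVar (C : V →ₗ[ℝ] V →ₗ[ℝ] V) (b y₁ y₂ y₃ y₄ : V) : ℝ :=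
  -inner ℝ (crossVar C b y₁ y₂) (C y₃ y₄) - inner ℝ (C y₁ y₂) (crossVar C b y₃ y₄)

namespace IsCross

variable {e : OrthonormalBasis (Fin 7) ℝ V} {C : V →ₗ[ℝ] V →ₗ[ℝ] V} (hC : IsCross e C)
include hC

theorem inner_frame' (i j k : Fin 7) : inner ℝ (e k) (C (e i) (e j)) = phiZ i j k := by
  rw [real_inner_comm, hC.inner_frame]

theorem frame_eq (i j : Fin 7) : C (e i) (e j) = ∑ k, (phiZ i j k : ℝ) • e k := by
  rw [← e.sum_repr (C (e i) (e j))]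
  simp [e.repr_apply_apply, hC.inner_frame']

theorem swap (a b : V) : C a b = -C b a := by
  rw [eq_neg_iff_add_eq_zero]
  revert a
  refine eq_zero_of_frame e _ (fun x y => ?_) (fun r x => ?_) fun i => ?_
  · simp only [map_add, LinearMap.add_apply]; abel
  · simp
  revert b
  refine eq_zero_of_frame e _ (fun x y => ?_) (fun r x => ?_) fun j => ?_
  · simp only [map_add, LinearMap.add_apply]; abel
  · simp
  rw [hC.frame_eq, hC.frame_eq, ← Finset.sum_add_distrib]
  have h : ∀ i j k : Fin 7, phiZ i j k = -phiZ j i k := by decide +kernel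
  refine Finset.sum_eq_zero fun k _ => ?_
  rw [h i j k]
  simp

theorem inner_left (a b c : V) : inner ℝ (C a b) c = inner ℝ a (C b c) := by
  rw [← sub_eq_zero]
  revert a
  refine eq_zero_of_frame e _ (fun x y => ?_) (fun r x => ?_) fun i => ?_
  · simp only [map_add, LinearMap.add_apply, inner_add_left]; abel
  · simp only [map_smul, LinearMap.smul_apply, real_inner_smul_left, smul_eq_mul]; ring
  revert b
  refine eq_zero_of_frame e _ (fun x y => ?_) (fun r x => ?_) fun j => ?_
  · simp only [map_add, LinearMap.add_apply, inner_add_left, inner_add_right]; abel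
  · simp only [map_smul, LinearMap.smul_apply, real_inner_smul_left, real_inner_smul_right,
      smul_eq_mul]; ring
  revert c
  refine eq_zero_of_frame e _ (fun x y => ?_) (fun r x => ?_) fun k => ?_
  · simp only [map_add, inner_add_right]; abel
  · simp only [map_smul, real_inner_smul_right, smul_eq_mul]; ring
  have h : ∀ i j k : Fin 7, phiZ i j k = phiZ j k i := by decide +kernel
  rw [hC.inner_frame, hC.inner_frame', h, sub_self]

theorem inner_cross_cross_frame (i j k l : Fin 7) :
    inner ℝ (C (e i) (e j)) (C (e k) (e l)) =
      (if i = k then 1 else 0) * (if j = l then 1 else 0)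
        - (if i = l then 1 else 0) * (if j = k then 1 else 0) - psiZ i j k l := by
  have h := sum_phiZ_mul_phiZ i j k l
  rw [hC.frame_eq i j, sum_inner]
  simp only [real_inner_smul_left, hC.inner_frame']
  rw [← Int.cast_inj (α := ℝ)] at h
  push_cast at h
  rw [h]

theorem cross_cross_add (a b c : V) : C a (C b c) + C b (C a c) =
    -(2 * inner ℝ a b) • c + inner ℝ a c • b + inner ℝ b c • a := by
  have key : ∀ a b c d : V, inner ℝ (C d a) (C b c) + inner ℝ (C d b) (C a c) -
      (-(2 * inner ℝ a b) * inner ℝ d c + inner ℝ a c * inner ℝ d b + inner ℝ b c * inner ℝ d a) =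
        0 := by
    intro a b c d
    revert a
    refine eq_zero_of_frame e _ (fun x y => ?_) (fun r x => ?_) fun i => ?_
    · simp only [map_add, LinearMap.add_apply, inner_add_left, inner_add_right]; ring
    · simp only [map_smul, LinearMap.smul_apply, real_inner_smul_left, real_inner_smul_right,
        smul_eq_mul]; ring
    revert b
    refine eq_zero_of_frame e _ (fun x y => ?_) (fun r x => ?_) fun j => ?_
    · simp only [map_add, LinearMap.add_apply, inner_add_left, inner_add_right]; ring
    · simp only [map_smul, LinearMap.smul_apply, real_inner_smul_left, real_inner_smul_right,
        smul_eq_mul]; ring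
    revert c
    refine eq_zero_of_frame e _ (fun x y => ?_) (fun r x => ?_) fun k => ?_
    · simp only [map_add, inner_add_right]; ring
    · simp only [map_smul, real_inner_smul_right, smul_eq_mul]; ring
    revert d
    refine eq_zero_of_frame e _ (fun x y => ?_) (fun r x => ?_) fun l => ?_
    · simp only [map_add, LinearMap.add_apply, inner_add_left]; ring
    · simp only [map_smul, LinearMap.smul_apply, real_inner_smul_left, smul_eq_mul]; ring
    have h : ∀ i j k l : Fin 7, psiZ l i j k + psiZ l j i k = 0 := by decide +kernel
    have h' := h i j k l
    rw [← Int.cast_inj (α := ℝ)] at h'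
    push_cast at h'
    simp only [hC.inner_cross_cross_frame, e.inner_eq_ite]
    rw [show (if j = i then (1 : ℝ) else 0) = if i = j then 1 else 0 by simp [eq_comm]]
    linear_combination -h'
  rw [← sub_eq_zero]
  refine ext_inner_left ℝ fun d => ?_
  rw [inner_zero_right, ← key a b c d, hC.inner_left, hC.inner_left]
  simp only [inner_sub_right, inner_add_right, real_inner_smul_right]

theorem cross_cross_self (a b : V) : C a (C a b) = -inner ℝ a a • b + inner ℝ a b • a := by
  have h := hC.cross_cross_add a a b
  rw [← two_smul ℝ (C a (C a b))] at h
  have h2 : (2 : ℝ) • C a (C a b) = (2 : ℝ) • (-inner ℝ a a • b + inner ℝ a b • a) := by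
    rw [h]; module
  exact smul_right_injective V (two_ne_zero (α := ℝ)) h2

theorem sum_cross_cross (b : V) : ∑ i, C (e i) (C (e i) b) = (-6 : ℝ) • b := by
  simp only [hC.cross_cross_self, Finset.sum_add_distrib, e.inner_eq_one, Finset.sum_const,
    Finset.card_univ, Fintype.card_fin]
  have h := e.sum_repr b
  simp only [e.repr_apply_apply] at h
  rw [h]
  module

theorem self_eq_zero (a : V) : C a a = 0 := by
  have h := hC.swap a a
  rwa [eq_neg_iff_add_eq_zero, ← two_smul ℝ, smul_eq_zero_iff_right two_ne_zero] at h

/-- Contraction of `i_X φ` with the cross product. -/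
theorem sum_inner_cross_smul_cross (a : V) :
    ∑ i, ∑ j, inner ℝ (C a (e i)) (e j) • C (e i) (e j) = (6 : ℝ) • a := by
  rw [← sub_eq_zero]
  revert a
  refine eq_zero_of_frame e _ (fun x y => ?_) (fun r x => ?_) fun m => ?_
  · simp only [map_add, LinearMap.add_apply, inner_add_left, add_smul, smul_add,
      Finset.sum_add_distrib]; abel
  · simp only [map_smul, LinearMap.smul_apply, real_inner_smul_left, mul_smul, ← Finset.smul_sum,
      smul_sub]
    rw [smul_comm]
  refine ext_inner_left ℝ fun d => ?_
  rw [inner_zero_right]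
  revert d
  refine eq_zero_of_frame e _ (fun x y => ?_) (fun r x => ?_) fun n => ?_
  · simp only [inner_add_left]
  · simp only [real_inner_smul_left, smul_eq_mul]
  have h : ∀ m n : Fin 7, ∑ i, ∑ j, phiZ m i j * phiZ i j n - 6 * (if n = m then 1 else 0) = 0 := by
    decide +kernel
  have h' := h m n
  rw [← Int.cast_inj (α := ℝ)] at h'
  push_cast at h'
  simp only [inner_sub_right, inner_sum, real_inner_smul_right, hC.inner_frame, hC.inner_frame',
    e.inner_eq_ite]
  exact h'

theorem sum_inner_cross_smul_cross_cross (a b : V) :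
    ∑ i, ∑ j, inner ℝ (C a (e i)) (e j) • C (e i) (C (e j) b) = (-3 : ℝ) • C a b := by
  rw [← sub_eq_zero]
  revert a
  refine eq_zero_of_frame e _ (fun x y => ?_) (fun r x => ?_) fun m => ?_
  · simp only [map_add, LinearMap.add_apply, inner_add_left, add_smul, smul_add,
      Finset.sum_add_distrib]; abel
  · simp only [map_smul, LinearMap.smul_apply, real_inner_smul_left, mul_smul, ← Finset.smul_sum,
      smul_sub]
    rw [smul_comm]
  revert b
  refine eq_zero_of_frame e _ (fun x y => ?_) (fun r x => ?_) fun n => ?_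
  · simp only [map_add, smul_add, Finset.sum_add_distrib]; abel
  · simp only [map_smul, smul_sub, Finset.smul_sum]
    simp only [smul_comm r]
  refine ext_inner_left ℝ fun d => ?_
  rw [inner_zero_right]
  revert d
  refine eq_zero_of_frame e _ (fun x y => ?_) (fun r x => ?_) fun l => ?_
  · simp only [inner_add_left]
  · simp only [real_inner_smul_left, smul_eq_mul]
  have h : ∀ m n l : Fin 7, ∑ i, ∑ j, phiZ m i j * ((if l = j then 1 else 0) * (if i = n then 1 else 0)
        - (if l = n then 1 else 0) * (if i = j then 1 else 0) - psiZ l i j n)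
      - (-3) * phiZ m n l = 0 := by
    decide +kernel
  have h' := h m n l
  rw [← Int.cast_inj (α := ℝ)] at h'
  push_cast at h'
  have hf := fun i j => (hC.inner_left (e l) (e i) (C (e j) (e n))).symm.trans
    (hC.inner_cross_cross_frame l i j n)
  simp only [inner_sub_right, inner_sum, real_inner_smul_right, hC.inner_frame, hC.inner_frame', hf]
  exact h'

/-- The components of the four-form `-⟨a × b, c × d⟩ + ⟨a, c⟩⟨b, d⟩ - ⟨a, d⟩⟨b, c⟩` are those of `⋆φ₀`. -/
theorem fourForm_frame (i j k l : Fin 7) : fourForm C (e i) (e j) (e k) (e l) = psiZ i j k l := by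
  simp only [fourForm, hC.inner_cross_cross_frame, e.inner_eq_ite]
  ring

theorem fourForm_swap₁₂ (a b c d : V) : fourForm C b a c d = -fourForm C a b c d := by
  simp only [fourForm, hC.swap b a, inner_neg_left]
  ring

theorem fourForm_swap₃₄ (a b c d : V) : fourForm C a b d c = -fourForm C a b c d := by
  simp only [fourForm, hC.swap d c, inner_neg_right]
  ring

theorem fourForm_swap₂₃ (a b c d : V) : fourForm C a c b d = -fourForm C a b c d := by
  have h := congrArg (inner ℝ a) (hC.cross_cross_add b c d)
  simp only [inner_add_right, real_inner_smul_right, ← hC.inner_left a b,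
    ← hC.inner_left a c] at h
  simp only [fourForm]
  rw [real_inner_comm c b] at *
  linear_combination -h

/-- The first variation of the cross product: `(∇_X ×)(z, y)` if `∇_X η = (0, b)`. -/
theorem crossVar_frame (p i j : Fin 7) :
    crossVar C (e p) (e i) (e j) = ∑ k, (2 * psiZ p i j k : ℝ) • e k := by
  rw [← sub_eq_zero]
  refine ext_inner_left ℝ fun d => ?_
  rw [inner_zero_right]
  revert d
  refine eq_zero_of_frame e _ (fun x y => ?_) (fun r x => ?_) fun k => ?_
  · simp only [inner_add_left]
  · simp only [real_inner_smul_left, smul_eq_mul]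
  have hf : ∀ x, inner ℝ (e k) (C (e i) x) = _ := fun x => (hC.inner_left (e k) (e i) x).symm
  have hg : inner ℝ (e k) (C (C (e i) (e j)) (e p)) = inner ℝ (C (e p) (e k)) (C (e i) (e j)) := by
    rw [← hC.inner_left (e k) _ (e p), real_inner_comm, ← hC.inner_left]
  have h : ∀ p i j k : Fin 7, (if i = j then 1 else 0) * (if k = p then 1 else 0) -
      ((if p = i then 1 else 0) * (if k = j then 1 else 0) -
        (if p = j then 1 else 0) * (if k = i then 1 else 0) - psiZ p k i j) -
      (if j = p then 1 else 0) * (if k = i then 1 else 0) +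
      ((if k = j then 1 else 0) * (if i = p then 1 else 0) -
        (if k = p then 1 else 0) * (if i = j then 1 else 0) - psiZ k i j p) -
      2 * psiZ p i j k = 0 := by decide +kernel
  have h' := h p i j k
  rw [← Int.cast_inj (α := ℝ)] at h'
  push_cast at h'
  simp only [crossVar, inner_sub_right, inner_add_right, inner_sum, real_inner_smul_right,
    e.inner_eq_ite, hf, hg, hC.inner_cross_cross_frame, mul_ite, mul_one, mul_zero,
    Finset.sum_ite_eq, Finset.mem_univ, if_true]
  simpa using h'

theorem inner_crossVar_frame (p i j k : Fin 7) :
    inner ℝ (crossVar C (e p) (e i) (e j)) (e k) = 2 * psiZ p i j k := by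
  rw [hC.crossVar_frame, sum_inner]
  simp [real_inner_smul_left, e.inner_eq_ite]

/-- The first variation of the four-form in the direction `b` is `-2 b ∧ φ`. -/
theorem fourFormVar_frame (p i j k l : Fin 7) :
    fourFormVar C (e p) (e i) (e j) (e k) (e l) =
      -2 * ((if p = i then 1 else 0) * phiZ j k l - (if p = j then 1 else 0) * phiZ i k l
        + (if p = k then 1 else 0) * phiZ i j l - (if p = l then 1 else 0) * phiZ i j k) := by
  have h : ∀ p i j k l : Fin 7, -(psiZ p i j (thirdPoint k l) * lineSign k l)
      - psiZ p k l (thirdPoint i j) * lineSign i j =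
      -((if p = i then 1 else 0) * phiZ j k l - (if p = j then 1 else 0) * phiZ i k l
        + (if p = k then 1 else 0) * phiZ i j l - (if p = l then 1 else 0) * phiZ i j k) := by
    decide +kernel
  have h' := h p i j k l
  rw [← sum_mul_phiZ, ← sum_mul_phiZ, ← Int.cast_inj (α := ℝ)] at h'
  push_cast at h'
  simp only [fourFormVar, hC.crossVar_frame, sum_inner, inner_sum, real_inner_smul_left,
    real_inner_smul_right, hC.inner_frame, hC.inner_frame', mul_assoc, ← Finset.mul_sum]
  linear_combination 2 * h'

end IsCross

end CrossProduct

/-! ### The cross product and the four-form of a `G₂`-structure -/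

section Vectors

variable {V W : Type*} [AddCommGroup V] [Module ℝ V] [TopologicalSpace V]
  [AddCommGroup W] [Module ℝ W] [TopologicalSpace W]

theorem map_vec3_add (α : V [⋀^Fin 3]→L[ℝ] W) (a a' b c : V) :
    α ![a + a', b, c] = α ![a, b, c] + α ![a', b, c] := by
  have hu : ∀ y : V, Function.update ![0, b, c] 0 y = ![y, b, c] := fun y => by
    ext i; fin_cases i <;> simp
  simpa only [hu] using α.map_update_add ![0, b, c] 0 a a'

theorem map_vec3_smul (α : V [⋀^Fin 3]→L[ℝ] W) (r : ℝ) (a b c : V) :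
    α ![r • a, b, c] = r • α ![a, b, c] := by
  have hu : ∀ y : V, Function.update ![0, b, c] 0 y = ![y, b, c] := fun y => by
    ext i; fin_cases i <;> simp
  simpa only [hu] using α.map_update_smul ![0, b, c] 0 r a

theorem map_vec3_rotate (α : V [⋀^Fin 3]→L[ℝ] W) (a b c : V) :
    α ![b, c, a] = α ![a, b, c] := by
  have h1 := α.map_swap ![a, b, c] (i := 0) (j := 1) (by decide)
  have h2 := α.map_swap ![b, a, c] (i := 1) (j := 2) (by decide)
  have e1 : ![a, b, c] ∘ Equiv.swap 0 1 = ![b, a, c] := by ext i; fin_cases i <;> rfl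
  have e2 : ![b, a, c] ∘ Equiv.swap 1 2 = ![b, c, a] := by ext i; fin_cases i <;> rfl
  rw [e1] at h1
  rw [e2, h1, neg_neg] at h2
  exact h2

theorem map_vec4_add (α : V [⋀^Fin 4]→L[ℝ] W) (a a' b c d : V) :
    α ![a + a', b, c, d] = α ![a, b, c, d] + α ![a', b, c, d] := by
  have hu : ∀ y : V, Function.update ![0, b, c, d] 0 y = ![y, b, c, d] := fun y => by
    ext i; fin_cases i <;> simp
  simpa only [hu] using α.map_update_add ![0, b, c, d] 0 a a'

theorem map_vec4_smul (α : V [⋀^Fin 4]→L[ℝ] W) (r : ℝ) (a b c d : V) :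
    α ![r • a, b, c, d] = r • α ![a, b, c, d] := by
  have hu : ∀ y : V, Function.update ![0, b, c, d] 0 y = ![y, b, c, d] := fun y => by
    ext i; fin_cases i <;> simp
  simpa only [hu] using α.map_update_smul ![0, b, c, d] 0 r a

theorem map_vec4_rotate (α : V [⋀^Fin 4]→L[ℝ] W) (a b c d : V) :
    α ![b, c, d, a] = -α ![a, b, c, d] := by
  have h1 := α.map_swap ![a, b, c, d] (i := 0) (j := 1) (by decide)
  have h2 := α.map_swap ![b, a, c, d] (i := 1) (j := 2) (by decide)
  have h3 := α.map_swap ![b, c, a, d] (i := 2) (j := 3) (by decide)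
  have e1 : ![a, b, c, d] ∘ Equiv.swap 0 1 = ![b, a, c, d] := by ext i; fin_cases i <;> rfl
  have e2 : ![b, a, c, d] ∘ Equiv.swap 1 2 = ![b, c, a, d] := by ext i; fin_cases i <;> rfl
  have e3 : ![b, c, a, d] ∘ Equiv.swap 2 3 = ![b, c, d, a] := by ext i; fin_cases i <;> rfl
  rw [e1] at h1
  rw [e2, h1, neg_neg] at h2
  rw [e3, h2] at h3
  exact h3

end Vectors

section FourForm

variable {V : Type*} [NormedAddCommGroup V] [InnerProductSpace ℝ V]
  {e : OrthonormalBasis (Fin 7) ℝ V} {C : V →ₗ[ℝ] V →ₗ[ℝ] V}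

theorem fourForm_add (a a' b c d : V) :
    fourForm C (a + a') b c d = fourForm C a b c d + fourForm C a' b c d := by
  simp only [fourForm, map_add, LinearMap.add_apply, inner_add_left]
  ring

theorem fourForm_smul (r : ℝ) (a b c d : V) :
    fourForm C (r • a) b c d = r • fourForm C a b c d := by
  simp only [fourForm, map_smul, LinearMap.smul_apply, real_inner_smul_left, smul_eq_mul]
  ring

theorem IsCross.fourForm_rotate (hC : IsCross e C) (a b c d : V) :
    fourForm C b c d a = -fourForm C a b c d := by
  rw [hC.fourForm_swap₃₄, hC.fourForm_swap₂₃, hC.fourForm_swap₁₂, neg_neg]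

/-- A multiple of the four-form is determined by its values on an adapted frame. -/
theorem IsCross.eq_smul_fourForm [TopologicalSpace V] (hC : IsCross e C)
    (α : V [⋀^Fin 4]→L[ℝ] ℝ) (r : ℝ)
    (h : ∀ i j k l, α ![e i, e j, e k, e l] = r * psiZ i j k l) (a b c d : V) :
    α ![a, b, c, d] = r * fourForm C a b c d := by
  have step : ∀ P : V → V → V → Prop, (∀ b c d : V, P b c d → ∀ i,
      α ![e i, b, c, d] = r * fourForm C (e i) b c d) → ∀ a b c d : V, P b c d →
      α ![a, b, c, d] = r * fourForm C a b c d := by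
    intro P hP a b c d hbcd
    rw [← sub_eq_zero]
    revert a
    refine eq_zero_of_frame e _ (fun x y => ?_) (fun s x => ?_) fun i => ?_
    · rw [map_vec4_add, fourForm_add]; ring
    · rw [map_vec4_smul, fourForm_smul]; simp only [smul_eq_mul]; ring
    · rw [hP b c d hbcd i, sub_self]
  have rot : ∀ a b c d : V, α ![a, b, c, d] = r * fourForm C a b c d →
      α ![b, c, d, a] = r * fourForm C b c d a := by
    intro a b c d h
    rw [map_vec4_rotate, hC.fourForm_rotate, h, mul_neg]
  let R : Set V := Set.range e
  have s1 : ∀ a b c d : V, (b ∈ R ∧ c ∈ R ∧ d ∈ R) → α ![a, b, c, d] = r * fourForm C a b c d := by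
    refine step _ ?_
    rintro _ _ _ ⟨⟨j, rfl⟩, ⟨k, rfl⟩, ⟨l, rfl⟩⟩ i
    rw [h, hC.fourForm_frame]
  have s2 : ∀ a b c d : V, (b ∈ R ∧ c ∈ R) → α ![a, b, c, d] = r * fourForm C a b c d := by
    refine step (fun b c _ => b ∈ R ∧ c ∈ R) ?_
    rintro b c d ⟨hb, hc⟩ i
    refine rot _ _ _ _ (s1 _ _ _ _ ⟨⟨i, rfl⟩, hb, hc⟩)
  have s3 : ∀ a b c d : V, b ∈ R → α ![a, b, c, d] = r * fourForm C a b c d := by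
    refine step (fun b _ _ => b ∈ R) ?_
    rintro b c d hb i
    exact rot _ _ _ _ (s2 _ _ _ _ ⟨⟨i, rfl⟩, hb⟩)
  refine step (fun _ _ _ => True) ?_ a b c d trivial
  rintro b c d - i
  exact rot _ _ _ _ (s3 _ _ _ _ ⟨i, rfl⟩)

end FourForm

section Geometry

variable {M : Type*} [TopologicalSpace M] [ChartedSpace E7 M] [IsManifold 𝓘(ℝ, E7) ∞ M]
  [RiemannianBundle (TM M)]

namespace G2Structure

variable (G : G2Structure M)

theorem frame_spec (x : M) (i j k : Fin 7) :
    G.form x ![G.frame x i, G.frame x j, G.frame x k] = phi0 i j k :=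
  (G.adapted x).choose_spec i j k

/-- The cross product at a point as a bilinear map. -/
def crossL (x : M) : TM M x →ₗ[ℝ] TM M x →ₗ[ℝ] TM M x :=
  LinearMap.mk₂ ℝ (G.cross x)
    (fun Y Y' Z => by
      simp only [cross, ← Finset.sum_add_distrib, ← add_smul]
      exact Finset.sum_congr rfl fun a _ => congrArg (· • G.frame x a) (map_vec3_add (G.form x) _ _ _ _))
    (fun c Y Z => by
      simp only [cross, Finset.smul_sum, ← mul_smul]
      exact Finset.sum_congr rfl fun a _ => congrArg (· • G.frame x a) (map_vec3_smul (G.form x) _ _ _ _))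
    (G.cross_add x) (fun c Y Z => G.cross_smul x Y c Z)

theorem crossL_apply (x : M) (Y Z : TM M x) : G.crossL x Y Z = G.cross x Y Z := rfl

theorem form_eq (x : M) (Y Z W : TM M x) :
    G.form x ![Y, Z, W] = inner ℝ (G.crossL x Y Z) W := by
  rw [← sub_eq_zero]
  revert W
  refine eq_zero_of_frame (G.frame x) _ (fun a b => ?_) (fun r a => ?_) fun i => ?_
  · rw [map_vec3_rotate _ (a + b), map_vec3_add, inner_add_right, map_vec3_rotate _ a,
      map_vec3_rotate _ b]; ring
  · rw [map_vec3_rotate _ (r • a), map_vec3_smul, real_inner_smul_right, map_vec3_rotate _ a]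
    simp only [smul_eq_mul]; ring
  · rw [crossL_apply, cross, sum_inner]
    simp [real_inner_smul_left, (G.frame x).inner_eq_ite]

theorem isCross (x : M) : IsCross (G.frame x) (G.crossL x) where
  inner_frame i j k := by rw [← G.form_eq, G.frame_spec, phi0_eq]

theorem psi_frame (x : M) (i j k l : Fin 7) :
    G.psi x ![G.frame x i, G.frame x j, G.frame x k, G.frame x l] = psiZ i j k l := by
  have h := hodgeStar_phi0 (G.frame x).toBasis (fun w => G.form x w) (fun I => by
    have h := G.frame_spec x (I 0) (I 1) (I 2)
    rw [← h]
    congr 1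
    ext r; fin_cases r <;> simp) ![i, j, k, l]
  refine Eq.trans ?_ h
  unfold psi
  congr 1
  funext r
  fin_cases r <;> simp

theorem IsNearlyParallel.extD_eq {G : G2Structure M} {τ : ℝ} (hG : G.IsNearlyParallel τ) (x : M)
    (a b c d : TM M x) : extD G.form x ![a, b, c, d] = τ * fourForm (G.crossL x) a b c d :=
  (G.isCross x).eq_smul_fourForm _ _ (fun i j k l => by rw [hG, psi_frame]) a b c d

theorem cliff_apply (x : M) (Y : TM M x) (u : SM M x) :
    G.cliff x Y u = (inner ℝ Y u.2, -(u.1 • Y + G.crossL x Y u.2)) := rfl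

end G2Structure

end Geometry

/-! ### Coordinate vector fields -/

-- The next two instances shorten the instance searches in what follows.
local instance topologicalSpaceTotalSpaceTM
    {M : Type*} [TopologicalSpace M] [ChartedSpace E7 M] [IsManifold 𝓘(ℝ, E7) ∞ M] :
    TopologicalSpace (TotalSpace E7 (TM M)) :=
  inferInstance

local instance topologicalSpaceTotalSpaceSM
    {M : Type*} [TopologicalSpace M] [ChartedSpace E7 M] [IsManifold 𝓘(ℝ, E7) ∞ M] :
    TopologicalSpace (TotalSpace (ℝ × E7) (SM M)) :=
  inferInstance

section Extend

variable {B F : Type*} [TopologicalSpace B] [NormedAddCommGroup F] [NormedSpace ℝ F] {V : B → Type*}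
  [TopologicalSpace (TotalSpace F V)] [∀ x, AddCommGroup (V x)] [∀ x, Module ℝ (V x)]
  [∀ x, TopologicalSpace (V x)] [FiberBundle F V] [VectorBundle ℝ F V]

theorem extend_smul {x : B} (c : ℝ) (v : V x) :
    ∀ᶠ y in nhds x, (FiberBundle.extend F (c • v) y : V y) = c • FiberBundle.extend F v y := by
  have hx := FiberBundle.mem_baseSet_trivializationAt' (F := F) (E := V) x
  have h := ((trivializationAt F V x).linear ℝ hx).map_smul c v
  filter_upwards [(trivializationAt F V x).open_baseSet.mem_nhds hx] with y hy
  simp only [FiberBundle.extend, h, ← Trivialization.symmL_apply (R := ℝ) _ hy, map_smul]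

end Extend

section CoordinateFields

variable {M : Type*} [TopologicalSpace M] [ChartedSpace E7 M] [IsManifold 𝓘(ℝ, E7) ∞ M]

/-- On the chart domain, `FiberBundle.extend` is given by the trivialisation, hence linear in the vector; outside of
it, its values are arbitrary. -/
theorem extend_eq_symmL {x y : M} (hy : y ∈ (chartAt E7 x).source) (v : TM M x) :
    (FiberBundle.extend E7 v y : TM M y) = (trivializationAt E7 (TM M) x).symmL ℝ y v := by
  have h2 := TangentBundle.continuousLinearMapAt_trivializationAt (I := 𝓘(ℝ, E7))
    (mem_chart_source E7 x)
  rw [mfderiv_extChartAt_self] at h2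
  have h3 : (trivializationAt E7 (TM M) x ⟨x, v⟩).2 = v := by
    have h := Trivialization.coe_linearMapAt_of_mem (R := ℝ) (trivializationAt E7 (TM M) x)
      (FiberBundle.mem_baseSet_trivializationAt' x)
    exact (congrFun h v).symm.trans (congrArg (fun T : E7 →L[ℝ] E7 => T v) h2)
  rw [FiberBundle.extend, h3]
  exact (Trivialization.symmL_apply (R := ℝ) _ (by simpa using hy) _).symm

/-- The local extension of a tangent vector is a coordinate vector field of the chart. -/
theorem extend_eq {x y : M} (hy : y ∈ (chartAt E7 x).source) (v : TM M x) :
    (FiberBundle.extend E7 v y : TM M y) =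
      mfderiv 𝓘(ℝ, E7) 𝓘(ℝ, E7) (extChartAt 𝓘(ℝ, E7) x).symm (extChartAt 𝓘(ℝ, E7) x y) v := by
  have h1 := TangentBundle.symmL_trivializationAt (I := 𝓘(ℝ, E7)) hy
  rw [modelWithCornersSelf_coe, Set.range_id, mfderivWithin_univ] at h1
  rw [extend_eq_symmL hy]
  exact congrArg (fun T : E7 →L[ℝ] E7 => T v) h1

theorem mfderiv_extChartAt_extend {x y : M} (hy : y ∈ (chartAt E7 x).source) (v : TM M x) :
    mfderiv 𝓘(ℝ, E7) 𝓘(ℝ, E7) (extChartAt 𝓘(ℝ, E7) x) y (FiberBundle.extend E7 v y) = v := by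
  have h2 := TangentBundle.continuousLinearMapAt_trivializationAt (I := 𝓘(ℝ, E7)) hy
  have h3 := (trivializationAt E7 (TM M) x).continuousLinearMapAt_symmL (R := ℝ) (b := y)
    (by simpa using hy) v
  rw [extend_eq_symmL hy]
  exact (congrArg (fun T : E7 →L[ℝ] E7 => T _) h2.symm).trans h3

theorem contMDiffAt_extend_of_mem {x y : M} (hy : y ∈ (chartAt E7 x).source) (v : TM M x) :
    ContMDiffAt 𝓘(ℝ, E7) (𝓘(ℝ, E7).prod 𝓘(ℝ, E7)) ∞
      (fun y => TotalSpace.mk' E7 y (FiberBundle.extend E7 v y : TM M y)) y := by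
  set t := trivializationAt E7 (TM M) x
  have hyt : y ∈ t.baseSet := by simpa [t] using hy
  refine (Trivialization.contMDiffAt_section_iff t hyt).2 ?_
  refine (contMDiffAt_const (c := (t ⟨x, v⟩).2)).congr_of_eventuallyEq ?_
  filter_upwards [t.open_baseSet.mem_nhds hyt] with z hz
  have h := congrArg Prod.snd (t.apply_mk_symm hz (t ⟨x, v⟩).2)
  exact h

theorem contMDiffAt_extChartAt_symm {x : M} {z : E7} (hz : z ∈ (extChartAt 𝓘(ℝ, E7) x).target) :
    ContMDiffAt 𝓘(ℝ, E7) 𝓘(ℝ, E7) ∞ (extChartAt 𝓘(ℝ, E7) x).symm z :=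
  (contMDiffOn_extChartAt_symm x).contMDiffAt ((isOpen_extChartAt_target x).mem_nhds hz)

theorem mvfderiv_extend {x y : M} (hy : y ∈ (chartAt E7 x).source) (v : TM M x) {f : M → ℝ}
    (hf : MDifferentiableAt 𝓘(ℝ, E7) 𝓘(ℝ, ℝ) f y) :
    mvfderiv 𝓘(ℝ, E7) f y (FiberBundle.extend E7 v y) =
      fderiv ℝ (f ∘ (extChartAt 𝓘(ℝ, E7) x).symm) (extChartAt 𝓘(ℝ, E7) x y) v := by
  have hys : y ∈ (extChartAt 𝓘(ℝ, E7) x).source := by simpa using hy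
  have hz := (extChartAt 𝓘(ℝ, E7) x).map_source hys
  have h1 := ((contMDiffAt_extChartAt_symm hz).mdifferentiableAt (by simp)).hasMFDerivAt
  have h2 : HasMFDerivAt 𝓘(ℝ, E7) 𝓘(ℝ, ℝ) f ((extChartAt 𝓘(ℝ, E7) x).symm (extChartAt 𝓘(ℝ, E7) x y))
      (mfderiv 𝓘(ℝ, E7) 𝓘(ℝ, ℝ) f y : E7 →L[ℝ] ℝ) := by
    have h := hf.hasMFDerivAt
    have e := (extChartAt 𝓘(ℝ, E7) x).left_inv hys
    generalize (extChartAt 𝓘(ℝ, E7) x).symm (extChartAt 𝓘(ℝ, E7) x y) = y' at e ⊢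
    subst e
    exact h
  have h3 := (HasMFDerivAt.comp _ h2 h1).mfderiv
  rw [mfderiv_eq_fderiv] at h3
  rw [extend_eq hy]
  exact (congrArg (fun T : E7 →L[ℝ] ℝ => T v) h3).symm

/-- The constant vector field on the model space. -/
def constField (u : E7) (z : E7) : TangentSpace 𝓘(ℝ, E7) z := u

theorem mdifferentiableAt_constField (u z : E7) :
    MDifferentiableAt 𝓘(ℝ, E7) (𝓘(ℝ, E7).prod 𝓘(ℝ, E7))
      (fun z => TotalSpace.mk' E7 z (constField u z)) z := by
  refine (mdifferentiableAt_section 𝓘(ℝ, E7) (constField u)).2 ?_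
  refine (mdifferentiableAt_const (c := u)).congr_of_eventuallyEq (Filter.Eventually.of_forall fun w => ?_)
  simp [constField]

theorem extend_eq_mpullback {x y : M} (hy : y ∈ (chartAt E7 x).source) (v : TM M x) :
    (FiberBundle.extend E7 v y : TM M y) =
      VectorField.mpullback 𝓘(ℝ, E7) 𝓘(ℝ, E7) (extChartAt 𝓘(ℝ, E7) x) (constField v) y := by
  rw [VectorField.mpullback_apply]
  have hi := isInvertible_mfderiv_extChartAt (I := 𝓘(ℝ, E7)) (x := x) (y := y) (by simpa using hy)
  have h := mfderiv_extChartAt_extend hy v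
  obtain ⟨T, hT⟩ := hi
  rw [← hT] at h ⊢
  rw [ContinuousLinearMap.inverse_equiv]
  exact (T.symm_apply_eq.2 h.symm).symm

theorem two_le_smooth : minSmoothness ℝ 2 ≤ ∞ := by
  rw [minSmoothness_of_isRCLikeNormedField]
  exact ENat.LEInfty.out

theorem mlieBracket_mpullback_constField {x y : M} (hy : y ∈ (chartAt E7 x).source) (u w : E7) :
    VectorField.mlieBracket 𝓘(ℝ, E7)
      (VectorField.mpullback 𝓘(ℝ, E7) 𝓘(ℝ, E7) (extChartAt 𝓘(ℝ, E7) x) (constField u))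
      (VectorField.mpullback 𝓘(ℝ, E7) 𝓘(ℝ, E7) (extChartAt 𝓘(ℝ, E7) x) (constField w)) y = 0 := by
  have : IsManifold 𝓘(ℝ, E7) (minSmoothness ℝ 2) M := IsManifold.of_le (n := ∞) two_le_smooth
  rw [← VectorField.mpullback_mlieBracket (n := ∞) (mdifferentiableAt_constField _ _)
      (mdifferentiableAt_constField _ _) (contMDiffAt_extChartAt' hy) two_le_smooth,
    VectorField.mpullback_apply, ← VectorField.mlieBracketWithin_univ,
    VectorField.mlieBracketWithin_eq_lieBracketWithin]
  have h : ∀ u : E7, fderivWithin ℝ (fun _ : E7 => u) Set.univ (extChartAt 𝓘(ℝ, E7) x y) = 0 :=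
    fun u => by simp
  have h0 : VectorField.lieBracketWithin ℝ (constField u) (constField w) Set.univ
      (extChartAt 𝓘(ℝ, E7) x y) = 0 :=
    (congrArg₂ (fun S T : E7 →L[ℝ] E7 => S u - T w) (h w) (h u)).trans (sub_self _)
  exact (congrArg _ h0).trans (map_zero _)

/-- Coordinate fields commute. -/
theorem mlieBracket_extend {x y : M} (hy : y ∈ (chartAt E7 x).source) (v w : TM M x) :
    VectorField.mlieBracket 𝓘(ℝ, E7) (FiberBundle.extend E7 v : ∀ y : M, TM M y)
      (FiberBundle.extend E7 w) y = 0 := by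
  have hnh := (chartAt E7 x).open_source.mem_nhds hy
  rw [Filter.EventuallyEq.mlieBracket_vectorField_eq
    (Filter.eventually_of_mem hnh fun z hz => extend_eq_mpullback hz v)
    (Filter.eventually_of_mem hnh fun z hz => extend_eq_mpullback hz w)]
  exact mlieBracket_mpullback_constField hy v w

end CoordinateFields

/-! ### The exterior derivative in coordinate fields -/

section Forms

variable {M : Type*} [TopologicalSpace M] [ChartedSpace E7 M] [IsManifold 𝓘(ℝ, E7) ∞ M]

theorem contDiffAt_alternating_of_apply {n : ℕ} {r : WithTop ℕ∞} {f : E7 → E7 [⋀^Fin n]→L[ℝ] ℝ} {z : E7}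
    (h : ∀ w : Fin n → E7, ContDiffAt ℝ r (fun z => f z w) z) : ContDiffAt ℝ r f z := by
  let b := (EuclideanSpace.basisFun (Fin 7) ℝ).toBasis
  let T : (E7 [⋀^Fin n]→L[ℝ] ℝ) →ₗ[ℝ] ((Fin n → Fin 7) → ℝ) :=
    { toFun := fun α I => α fun r => b (I r)
      map_add' := fun _ _ => rfl
      map_smul' := fun _ _ => rfl }
  have hT : LinearMap.ker T = ⊥ := by
    refine LinearMap.ker_eq_bot'.2 fun α hα => ?_
    have : α.toAlternatingMap = 0 := b.ext_alternating fun I _ => congrFun hα I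
    exact ContinuousAlternatingMap.toAlternatingMap_injective this
  obtain ⟨S, hS⟩ := T.exists_leftInverse_of_injective hT
  have hf : f = fun z => S.toContinuousLinearMap (fun I => f z fun r => b (I r)) := by
    funext z
    exact (congrArg (fun L : (E7 [⋀^Fin n]→L[ℝ] ℝ) →ₗ[ℝ] _ => L (f z)) hS).symm
  rw [hf]
  exact S.toContinuousLinearMap.contDiff.contDiffAt.comp z (contDiffAt_pi.2 fun I => h _)

theorem formInChart_apply {n : ℕ} (α : ∀ x : M, TangentSpace 𝓘(ℝ, E7) x [⋀^Fin n]→L[ℝ] ℝ) {x : M}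
    {z : E7} (hz : z ∈ (extChartAt 𝓘(ℝ, E7) x).target) (w : Fin n → TM M x) :
    formInChart α x z w = α ((extChartAt 𝓘(ℝ, E7) x).symm z)
      (fun i => FiberBundle.extend E7 (w i) ((extChartAt 𝓘(ℝ, E7) x).symm z)) := by
  have hy := (extChartAt 𝓘(ℝ, E7) x).map_target hz
  rw [extChartAt_source] at hy
  have h : (fun i => (FiberBundle.extend E7 (w i) ((extChartAt 𝓘(ℝ, E7) x).symm z) :
      TM M ((extChartAt 𝓘(ℝ, E7) x).symm z))) = fun i => mfderiv 𝓘(ℝ, E7) 𝓘(ℝ, E7)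
      (extChartAt 𝓘(ℝ, E7) x).symm z (w i) := by
    funext i
    rw [extend_eq hy, (extChartAt 𝓘(ℝ, E7) x).right_inv hz]
  rw [h]
  rfl

theorem contMDiffAt_form_extend {n : ℕ} {α : ∀ x : M, TangentSpace 𝓘(ℝ, E7) x [⋀^Fin n]→L[ℝ] ℝ}
    (hα : IsSmoothForm α) {x y : M} (hy : y ∈ (chartAt E7 x).source) (w : Fin n → TM M x) :
    ContMDiffAt 𝓘(ℝ, E7) 𝓘(ℝ, ℝ) ∞ (fun y => α y (fun i => FiberBundle.extend E7 (w i) y)) y :=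
  hα y _ fun i => contMDiffAt_extend_of_mem hy (w i)

theorem formInChart_apply_eventuallyEq {n : ℕ} (α : ∀ x : M, TangentSpace 𝓘(ℝ, E7) x [⋀^Fin n]→L[ℝ] ℝ) {x : M}
    {z : E7} (hz : z ∈ (extChartAt 𝓘(ℝ, E7) x).target) (w : Fin n → TM M x) :
    (fun z => formInChart α x z w) =ᶠ[nhds z]
      (fun y => α y (fun i => FiberBundle.extend E7 (w i) y)) ∘ (extChartAt 𝓘(ℝ, E7) x).symm :=
  Filter.eventually_of_mem ((isOpen_extChartAt_target x).mem_nhds hz) fun _ h => formInChart_apply α h w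

theorem contDiffAt_formInChart {n : ℕ} {α : ∀ x : M, TangentSpace 𝓘(ℝ, E7) x [⋀^Fin n]→L[ℝ] ℝ}
    (hα : IsSmoothForm α) {x : M} {z : E7} (hz : z ∈ (extChartAt 𝓘(ℝ, E7) x).target) :
    ContDiffAt ℝ ∞ (formInChart α x) z := by
  refine contDiffAt_alternating_of_apply fun w => ?_
  refine ContDiffAt.congr_of_eventuallyEq ?_ (formInChart_apply_eventuallyEq α hz w)
  have hy := (extChartAt 𝓘(ℝ, E7) x).map_target hz
  rw [extChartAt_source] at hy
  exact ((contMDiffAt_form_extend hα hy w).comp z (contMDiffAt_extChartAt_symm hz)).contDiffAt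

/-- The exterior derivative of a form in a chart, in terms of coordinate fields. -/
theorem extDeriv_formInChart {n : ℕ} {α : ∀ x : M, TangentSpace 𝓘(ℝ, E7) x [⋀^Fin n]→L[ℝ] ℝ}
    (hα : IsSmoothForm α) {x y : M} (hy : y ∈ (chartAt E7 x).source) (v : Fin (n + 1) → TM M x) :
    extDeriv (formInChart α x) (extChartAt 𝓘(ℝ, E7) x y) v =
      ∑ i, (-1) ^ i.val * mvfderiv 𝓘(ℝ, E7)
        (fun y => α y fun j => FiberBundle.extend E7 (i.removeNth v j) y) y
          (FiberBundle.extend E7 (v i) y) := by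
  have hys : y ∈ (extChartAt 𝓘(ℝ, E7) x).source := by simpa using hy
  have hz := (extChartAt 𝓘(ℝ, E7) x).map_source hys
  refine (extDeriv_apply ((contDiffAt_formInChart hα hz).differentiableAt (by simp)) v).trans ?_
  refine Finset.sum_congr rfl fun i _ => ?_
  rw [mvfderiv_extend hy _ ((contMDiffAt_form_extend hα hy _).mdifferentiableAt (by simp)),
    ← (formInChart_apply_eventuallyEq α hz _).fderiv_eq]
  exact (zsmul_eq_mul _ _).trans (by push_cast; rfl)

theorem extD_eq_extDeriv {n : ℕ} (α : ∀ x : M, TangentSpace 𝓘(ℝ, E7) x [⋀^Fin n]→L[ℝ] ℝ) (x : M)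
    (v : Fin (n + 1) → TM M x) :
    extD α x v = extDeriv (formInChart α x) (extChartAt 𝓘(ℝ, E7) x x) v := by
  rw [extD, mfderiv_extChartAt_self]
  rfl

/-- The equation `d(dα) = 0`, when the values of `dα` on coordinate fields are given by functions `h w`. -/
theorem sum_mvfderiv_eq_zero {n : ℕ} {α : ∀ x : M, TangentSpace 𝓘(ℝ, E7) x [⋀^Fin n]→L[ℝ] ℝ}
    (hα : IsSmoothForm α) (x : M) (h : (Fin (n + 1) → TM M x) → M → ℝ)
    (hd : ∀ w, MDifferentiableAt 𝓘(ℝ, E7) 𝓘(ℝ, ℝ) (h w) x)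
    (hh : ∀ w, ∀ y ∈ (chartAt E7 x).source,
      extDeriv (formInChart α x) (extChartAt 𝓘(ℝ, E7) x y) w = h w y)
    (v : Fin (n + 2) → TM M x) :
    ∑ i : Fin (n + 2), (-1) ^ i.val * mvfderiv 𝓘(ℝ, E7) (h (i.removeNth v)) x (v i) = 0 := by
  have hz := mem_extChartAt_target (I := 𝓘(ℝ, E7)) x
  have hc := contDiffAt_formInChart hα hz
  have hdd : DifferentiableAt ℝ (extDeriv (formInChart α x)) (extChartAt 𝓘(ℝ, E7) x x) := by
    have h1 : DifferentiableAt ℝ (fderiv ℝ (formInChart α x)) (extChartAt 𝓘(ℝ, E7) x x) :=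
      ((hc.of_le ENat.LEInfty.out).fderiv_right (m := 1) one_add_one_eq_two.le).differentiableAt
        (by simp)
    exact (ContinuousAlternatingMap.alternatizeUncurryFinCLM ℝ E7 ℝ).differentiableAt.comp _ h1
  have h0 := congrArg (fun β : E7 [⋀^Fin (n + 2)]→L[ℝ] ℝ => β v)
    (extDeriv_extDeriv_apply hc two_le_smooth)
  refine Eq.trans ?_ h0
  refine Eq.trans ?_ (extDeriv_apply hdd v).symm
  refine Finset.sum_congr rfl fun i _ => ?_
  have h1 := mvfderiv_extend (mem_chart_source E7 x) (v i) (hd (i.removeNth v))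
  rw [FiberBundle.extend_apply_self] at h1
  have h2 : (fun z => extDeriv (formInChart α x) z (i.removeNth v)) =ᶠ[nhds (extChartAt 𝓘(ℝ, E7) x x)]
      h (i.removeNth v) ∘ (extChartAt 𝓘(ℝ, E7) x).symm := by
    filter_upwards [(isOpen_extChartAt_target x).mem_nhds hz] with z hz
    have hy := (extChartAt 𝓘(ℝ, E7) x).map_target hz
    rw [extChartAt_source] at hy
    have h3 := hh (i.removeNth v) _ hy
    rw [(extChartAt 𝓘(ℝ, E7) x).right_inv hz] at h3
    exact h3
  rw [h1, ← h2.fderiv_eq]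
  exact ((zsmul_eq_mul _ _).trans (by push_cast; rfl)).symm

end Forms

/-! ### Smoothness of the cross product -/

section Smooth
variable {M : Type*} [TopologicalSpace M] [ChartedSpace E7 M] [IsManifold 𝓘(ℝ, E7) ∞ M]

/-- Smoothness at a point of a vector field. -/
def SmoothVF (Y : ∀ y : M, TM M y) (x : M) : Prop :=
  ContMDiffAt 𝓘(ℝ, E7) (𝓘(ℝ, E7).prod 𝓘(ℝ, E7)) ∞ (fun y => TotalSpace.mk' E7 y (Y y)) x

theorem SmoothVF.diffVF {Y : ∀ y : M, TM M y} {x : M} (h : SmoothVF Y x) : DiffVF Y x :=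
  ContMDiffAt.mdifferentiableAt h (by simp)

theorem contMDiffAt_det {ι : Type*} [Fintype ι] [DecidableEq ι] {A : M → Matrix ι ι ℝ} {x : M}
    (h : ∀ i j, ContMDiffAt 𝓘(ℝ, E7) 𝓘(ℝ, ℝ) ∞ (fun y => A y i j) x) :
    ContMDiffAt 𝓘(ℝ, E7) 𝓘(ℝ, ℝ) ∞ (fun y => (A y).det) x := by
  simp only [Matrix.det_apply']
  exact contMDiffAt_finsetSum fun σ _ => contMDiffAt_const.mul (contMDiffAt_finsetProd fun i _ => h _ _)

variable [RiemannianBundle (TM M)]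

theorem SmoothVF.inner [IsContMDiffRiemannianBundle 𝓘(ℝ, E7) ∞ E7 (TM M)]
    {Y Z : ∀ y : M, TM M y} {x : M} (hY : SmoothVF Y x) (hZ : SmoothVF Z x) :
    ContMDiffAt 𝓘(ℝ, E7) 𝓘(ℝ, ℝ) ∞ (fun y => inner ℝ (Y y) (Z y)) x :=
  ContMDiffAt.inner_bundle hY hZ

/-- A vector field is smooth if its inner products with coordinate fields are smooth. -/
theorem smoothVF_of_inner_extend [IsContMDiffRiemannianBundle 𝓘(ℝ, E7) ∞ E7 (TM M)]
    (x : M) (e : OrthonormalBasis (Fin 7) ℝ (TM M x)) (W : ∀ y : M, TM M y)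
    (h : ∀ v : TM M x, ContMDiffAt 𝓘(ℝ, E7) 𝓘(ℝ, ℝ) ∞
      (fun y => inner ℝ (W y) (FiberBundle.extend E7 v y)) x) : SmoothVF W x := by
  let X : Fin 7 → ∀ y : M, TM M y := fun i y => FiberBundle.extend E7 (e i) y
  have hX : ∀ i, SmoothVF (X i) x := fun i => contMDiffAt_extend_of_mem (mem_chart_source E7 x) (e i)
  let g : M → Matrix (Fin 7) (Fin 7) ℝ := fun y => Matrix.of fun i j => inner ℝ (X i y) (X j y)
  let f : M → Fin 7 → ℝ := fun y i => inner ℝ (W y) (X i y)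
  have hg : ∀ i j, ContMDiffAt 𝓘(ℝ, E7) 𝓘(ℝ, ℝ) ∞ (fun y => g y i j) x := fun i j => (hX i).inner (hX j)
  have hdet := contMDiffAt_det hg
  have h1 : (g x).det = 1 := by
    have : g x = 1 := by
      ext i j
      simp [g, X, e.inner_eq_ite, Matrix.one_apply]
    rw [this, Matrix.det_one]
  have hne : ∀ᶠ y in nhds x, (g y).det ≠ 0 :=
    hdet.continuousAt.eventually_ne (by rw [h1]; exact one_ne_zero)
  let c : Fin 7 → M → ℝ := fun j y => (g y).det⁻¹ * Matrix.cramer (g y) (f y) j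
  have hc : ∀ j, ContMDiffAt 𝓘(ℝ, E7) 𝓘(ℝ, ℝ) ∞ (c j) x := by
    intro j
    refine (hdet.inv₀ (by rw [h1]; exact one_ne_zero)).mul ?_
    simp only [Matrix.cramer_apply]
    refine contMDiffAt_det fun a b => ?_
    by_cases hb : b = j
    · subst hb
      simpa using h (e a)
    · simpa [Matrix.updateCol_apply, hb] using hg a b
  have hsum : SmoothVF (fun y => ∑ j, c j y • X j y) x :=
    ContMDiffAt.sum_section fun j _ => (hc j).smul_section (hX j)
  refine ContMDiffAt.congr_of_eventuallyEq hsum ?_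
  filter_upwards [hne, (chartAt E7 x).open_source.mem_nhds (mem_chart_source E7 x)] with y hy hys
  congr 1
  rw [← sub_eq_zero, ← inner_self_eq_zero (𝕜 := ℝ)]
  have hzero : ∀ u : TM M y, inner ℝ (W y - ∑ j, c j y • X j y) u = 0 := by
    have hi : ∀ i, inner ℝ (W y - ∑ j, c j y • X j y) (X i y) = 0 := by
      intro i
      have h3 := congrFun (Matrix.mulVec_cramer (g y) (f y)) i
      rw [inner_sub_left, sum_inner, sub_eq_zero]
      simp only [real_inner_smul_left, c, mul_assoc, ← Finset.mul_sum]
      rw [Matrix.mulVec, dotProduct] at h3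
      have h4 : ∑ j, Matrix.cramer (g y) (f y) j * inner ℝ (X j y) (X i y) = (g y).det * f y i := by
        rw [← smul_eq_mul, ← Pi.smul_apply, ← h3]
        refine Finset.sum_congr rfl fun j _ => ?_
        rw [mul_comm, real_inner_comm]
        rfl
      rw [h4, inv_mul_cancel_left₀ hy]
    intro u
    set t := trivializationAt E7 (TM M) x
    have hyt : y ∈ t.baseSet := by simpa [t] using hys
    let v : TM M x := t.continuousLinearMapAt ℝ y u
    have hu : u = (FiberBundle.extend E7 v y : TM M y) := by
      rw [extend_eq_symmL hys]
      exact (t.symmL_continuousLinearMapAt (R := ℝ) hyt u).symm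
    rw [hu, extend_eq_symmL hys, ← e.sum_repr v]
    have h5 : (t.symmL ℝ y : E7 → TM M y) (∑ i, e.repr v i • e i : TM M x) = ∑ i, e.repr v i • X i y := by
      refine (map_sum (t.symmL ℝ y) (fun i => (e.repr v i • e i : TM M x)) Finset.univ).trans ?_
      refine Finset.sum_congr rfl fun i _ => ?_
      refine ((t.symmL ℝ y).map_smul (e.repr v i) (e i)).trans ?_
      exact congrArg _ (extend_eq_symmL hys (e i)).symm
    refine (congrArg (inner ℝ _) h5).trans ?_
    simp [inner_sum, real_inner_smul_right, hi]
  exact hzero _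

namespace G2Structure
variable (G : G2Structure M) [IsContMDiffRiemannianBundle 𝓘(ℝ, E7) ∞ E7 (TM M)]

theorem smoothVF_cross {x : M} {Y Z : ∀ y : M, TM M y} (hY : SmoothVF Y x) (hZ : SmoothVF Z x) :
    SmoothVF (fun y => G.crossL y (Y y) (Z y)) x := by
  refine smoothVF_of_inner_extend x (G.frame x) _ fun v => ?_
  simp only [← G.form_eq]
  have h := G.smooth x ![Y, Z, FiberBundle.extend E7 v] (by
    intro i
    fin_cases i
    · exact hY
    · exact hZ
    · exact contMDiffAt_extend_of_mem (mem_chart_source E7 x) v)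
  refine h.congr_of_eventuallyEq (Filter.Eventually.of_forall fun y => ?_)
  dsimp only
  congr 1
  funext i
  fin_cases i <;> rfl

end G2Structure
end Smooth

/-! ### The spin connection and the derivative of the cross product -/

section Spin
variable {M : Type*} [TopologicalSpace M] [ChartedSpace E7 M] [IsManifold 𝓘(ℝ, E7) ∞ M]

theorem trivializationAt_pair (x y : M) (r : ℝ) (v : TM M y) :
    (trivializationAt (ℝ × E7) (SM M) x ⟨y, (r, v)⟩).2 = (r, (trivializationAt E7 (TM M) x ⟨y, v⟩).2) := rfl

theorem extend_pair {x y : M} (hy : y ∈ (chartAt E7 x).source) (r : ℝ) (v : TM M x) :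
    (FiberBundle.extend (E := SM M) (ℝ × E7) (x := x) (r, v) y : SM M y) = (r, FiberBundle.extend E7 v y) := by
  have hyt : y ∈ (trivializationAt E7 (TM M) x).baseSet := by simpa using hy
  have hyt' : y ∈ (trivializationAt (ℝ × E7) (SM M) x).baseSet := ⟨trivial, hyt⟩
  have h1 := (trivializationAt (ℝ × E7) (SM M) x).symm_apply_apply_mk hyt' ((r, FiberBundle.extend E7 v y) : SM M y)
  rw [← h1, trivializationAt_pair, FiberBundle.extend, trivializationAt_pair]
  congr 2
  exact (congrArg Prod.snd ((trivializationAt E7 (TM M) x).apply_mk_symm hyt _)).symm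

theorem diffSpinor_pair {x : M} {f : M → ℝ} {Y : ∀ y : M, TM M y}
    (hf : MDifferentiableAt 𝓘(ℝ, E7) 𝓘(ℝ, ℝ) f x) (hY : DiffVF Y x) :
    DiffSpinor (fun y => (f y, Y y)) x := by
  refine (mdifferentiableAt_section 𝓘(ℝ, E7) (fun y => ((f y, Y y) : SM M y))).2 ?_
  simp only [trivializationAt_pair]
  exact hf.prodMk_space ((mdifferentiableAt_section 𝓘(ℝ, E7) Y).1 hY)

theorem contMDiffAt_pair {x : M} {f : M → ℝ} {Y : ∀ y : M, TM M y}
    (hf : ContMDiffAt 𝓘(ℝ, E7) 𝓘(ℝ, ℝ) ∞ f x) (hY : SmoothVF Y x) :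
    ContMDiffAt 𝓘(ℝ, E7) (𝓘(ℝ, E7).prod 𝓘(ℝ, ℝ × E7)) ∞
      (fun y => TotalSpace.mk' (ℝ × E7) y ((f y, Y y) : SM M y)) x := by
  refine (contMDiffAt_section x).2 ?_
  simp only [trivializationAt_pair]
  exact hf.prodMk_space ((contMDiffAt_section x).1 hY)

theorem smoothVF_snd {x : M} {u : ∀ y : M, SM M y}
    (hu : ContMDiffAt 𝓘(ℝ, E7) (𝓘(ℝ, E7).prod 𝓘(ℝ, ℝ × E7)) ∞
      (fun y => TotalSpace.mk' (ℝ × E7) y (u y)) x) : SmoothVF (fun y => (u y).2) x := by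
  have h := (contMDiffAt_section x).1 hu
  exact (contMDiffAt_section x).2 ((ContinuousLinearMap.snd ℝ ℝ E7).contMDiff.contMDiffAt.comp x h)

theorem diffVF_zero (x : M) : DiffVF (fun y : M => (0 : TM M y)) x :=
  mdifferentiableAt_zeroSection ..

omit [IsManifold 𝓘(ℝ, E7) ∞ M] in
theorem mvfderiv_neg_add_mul_sub_mul {f₁ f₂ f₃ f₄ f₅ : M → ℝ} {x : M}
    (h₁ : MDifferentiableAt 𝓘(ℝ, E7) 𝓘(ℝ, ℝ) f₁ x) (h₂ : MDifferentiableAt 𝓘(ℝ, E7) 𝓘(ℝ, ℝ) f₂ x)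
    (h₃ : MDifferentiableAt 𝓘(ℝ, E7) 𝓘(ℝ, ℝ) f₃ x) (h₄ : MDifferentiableAt 𝓘(ℝ, E7) 𝓘(ℝ, ℝ) f₄ x)
    (h₅ : MDifferentiableAt 𝓘(ℝ, E7) 𝓘(ℝ, ℝ) f₅ x) (X : TM M x) :
    mvfderiv 𝓘(ℝ, E7) (fun y => -f₁ y + f₂ y * f₃ y - f₄ y * f₅ y) x X =
      -mvfderiv 𝓘(ℝ, E7) f₁ x X + (f₂ x * mvfderiv 𝓘(ℝ, E7) f₃ x X + mvfderiv 𝓘(ℝ, E7) f₂ x X * f₃ x) -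
        (f₄ x * mvfderiv 𝓘(ℝ, E7) f₅ x X + mvfderiv 𝓘(ℝ, E7) f₄ x X * f₅ x) := by
  have e : (fun y => -f₁ y + f₂ y * f₃ y - f₄ y * f₅ y) = -f₁ + f₂ * f₃ - f₄ * f₅ := rfl
  rw [e, mvfderiv_sub (h₁.neg.add (h₂.mul h₃)) (h₄.mul h₅), mvfderiv_add h₁.neg (h₂.mul h₃), mvfderiv_neg,
    mvfderiv_mul h₂ h₃, mvfderiv_mul h₄ h₅]
  simp only [_root_.add_apply, _root_.sub_apply, _root_.neg_apply, _root_.smul_apply, smul_eq_mul]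
  ring

theorem G2Structure.diffSpinor_eta (x : M) : DiffSpinor (fun y : M => (G2Structure.eta y : SM M y)) x :=
  diffSpinor_pair mdifferentiableAt_const (diffVF_zero x)

variable [RiemannianBundle (TM M)]

namespace G2Structure
variable {G : G2Structure M} [IsContMDiffRiemannianBundle 𝓘(ℝ, E7) ∞ E7 (TM M)]
  {nabla : CovariantDerivative 𝓘(ℝ, E7) E7 (TM M)}
  {nablaS : CovariantDerivative 𝓘(ℝ, E7) (ℝ × E7) (SM M)}

theorem contMDiffAt_fourForm {x : M} {Y₁ Y₂ Y₃ Y₄ : ∀ y : M, TM M y}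
    (h₁ : SmoothVF Y₁ x) (h₂ : SmoothVF Y₂ x) (h₃ : SmoothVF Y₃ x) (h₄ : SmoothVF Y₄ x) :
    ContMDiffAt 𝓘(ℝ, E7) 𝓘(ℝ, ℝ) ∞
      (fun y => fourForm (G.crossL y) (Y₁ y) (Y₂ y) (Y₃ y) (Y₄ y)) x :=
  ((((G.smoothVF_cross h₁ h₂).inner (G.smoothVF_cross h₃ h₄)).neg).add
    ((h₁.inner h₃).mul (h₂.inner h₄))).sub ((h₁.inner h₄).mul (h₂.inner h₃))

namespace IsSpinConnection
variable (hS : G.IsSpinConnection nabla nablaS)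
include hS

/-- The field `η` has constant length. -/
theorem fst_eta (x : M) (X : TM M x) : (nablaS eta x X).1 = 0 := by
  have h := hS.metric x eta eta X (diffSpinor_eta x) (diffSpinor_eta x)
  have h1 : (fun y : M => spinInner y (eta y : SM M y) (eta y)) = fun _ => (1 : ℝ) := by
    funext y
    simp [spinInner, eta]
  rw [h1, mvfderiv_const] at h
  simp [spinInner, eta] at h
  linarith

/-- Differentiating `Y · η = (0, -Y)`: the spin connection on one-forms is determined by its value on `η`. -/
theorem nablaS_neg (x : M) (Y : ∀ y : M, TM M y) (hY : DiffVF Y x) (X : TM M x) :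
    nablaS (fun y => ((0 : ℝ), -Y y)) x X = (inner ℝ (Y x) (nablaS eta x X).2,
      -(nabla Y x X) - G.crossL x (Y x) (nablaS eta x X).2) := by
  have h := hS.clifford x Y eta X hY (diffSpinor_eta x)
  have h1 : (fun y => G.cliff y (Y y) (eta y)) = fun y => (((0 : ℝ), -Y y) : SM M y) := by
    funext y
    rw [cliff_apply]
    simp [eta]
  rw [h1] at h
  rw [h, cliff_apply, cliff_apply, hS.fst_eta]
  ext1 <;> simp [eta, sub_eq_add_neg]

/-- The derivative of the cross product, obtained by differentiating `Y · (Z · η)`. -/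
theorem nabla_cross (x : M) (Z Y : ∀ y : M, TM M y) (hZ : SmoothVF Z x) (hY : SmoothVF Y x) (X : TM M x) :
    nabla (fun y => G.crossL y (Z y) (Y y)) x X = G.crossL x (nabla Z x X) (Y x) +
      G.crossL x (Z x) (nabla Y x X) + crossVar (G.crossL x) (nablaS eta x X).2 (Z x) (Y x) := by
  have hW := G.smoothVF_cross hZ hY
  have hf : MDifferentiableAt 𝓘(ℝ, E7) 𝓘(ℝ, ℝ) (fun y => -inner ℝ (Y y) (Z y)) x :=
    ((hY.inner hZ).mdifferentiableAt (by simp)).neg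
  have hE : DiffSpinor (fun y : M => (eta y : SM M y)) x := diffSpinor_eta x
  have hZ' : DiffSpinor (fun y => ((0 : ℝ), -Z y)) x :=
    diffSpinor_pair mdifferentiableAt_const (mdifferentiableAt_neg_section hZ.diffVF)
  have hW' : DiffSpinor (fun y => ((0 : ℝ), -G.crossL y (Z y) (Y y))) x :=
    diffSpinor_pair mdifferentiableAt_const (mdifferentiableAt_neg_section hW.diffVF)
  have h := hS.clifford x Y _ X hY.diffVF hZ'
  have h1 : (fun y => G.cliff y (Y y) (((0 : ℝ), -Z y) : SM M y)) =
      (fun y => -inner ℝ (Y y) (Z y)) • (fun y : M => (eta y : SM M y)) +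
        fun y => (((0 : ℝ), -G.crossL y (Z y) (Y y)) : SM M y) := by
    funext y
    rw [cliff_apply]
    refine Prod.ext ?_ ?_
    · simp [eta]
    · simp [eta, (G.isCross y).swap (Y y) (Z y)]
  have hfe : DiffSpinor ((fun y => -inner ℝ (Y y) (Z y)) • (fun y : M => (eta y : SM M y))) x :=
    MDifferentiableAt.smul_section hf hE
  rw [h1, nablaS.isCovariantDerivativeOnUniv.add hfe hW',
    nablaS.isCovariantDerivativeOnUniv.leibniz hE hf] at h
  have h2 := congrArg Prod.snd h
  simp only [_root_.add_apply, hS.nablaS_neg x _ hW.diffVF, hS.nablaS_neg x _ hZ.diffVF,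
    cliff_apply] at h2
  set b := (nablaS eta x X).2
  set N := nabla (fun y => G.crossL y (Z y) (Y y)) x X
  have h3 : (-inner ℝ (Y x) (Z x)) • b + (mvfderiv 𝓘(ℝ, E7) (fun y => -inner ℝ (Y y) (Z y)) x X) • (0 : TM M x) +
      (-N - G.crossL x (G.crossL x (Z x) (Y x)) b) =
      -((0 : ℝ) • nabla Y x X + G.crossL x (nabla Y x X) (-Z x)) +
        -(inner ℝ (Z x) b • Y x + G.crossL x (Y x) (-nabla Z x X - G.crossL x (Z x) b)) := h2
  have s1 := (G.isCross x).swap (nabla Y x X) (Z x)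
  have s2 := (G.isCross x).swap (Y x) (nabla Z x X)
  have s3 := (G.isCross x).cross_cross_add (Y x) (Z x) b
  simp only [map_neg, map_sub, zero_smul, zero_add, smul_zero, add_zero] at h3
  rw [real_inner_comm (Z x) (Y x)] at *
  rw [crossVar]
  linear_combination (norm := module) -h3 - s1 - s2 - s3

/-- The derivative of `φ` on vector fields. -/
theorem mvfderiv_form (hLC : IsLeviCivita nabla) (x : M) (Z Y W : ∀ y : M, TM M y)
    (hZ : SmoothVF Z x) (hY : SmoothVF Y x) (hW : SmoothVF W x) (X : TM M x) :
    mvfderiv 𝓘(ℝ, E7) (fun y => inner ℝ (G.crossL y (Z y) (Y y)) (W y)) x X =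
      inner ℝ (G.crossL x (nabla Z x X) (Y x)) (W x) +
      inner ℝ (G.crossL x (Z x) (nabla Y x X)) (W x) +
      inner ℝ (G.crossL x (Z x) (Y x)) (nabla W x X) +
      inner ℝ (crossVar (G.crossL x) (nablaS eta x X).2 (Z x) (Y x)) (W x) := by
  rw [hLC.metric x _ _ X (G.smoothVF_cross hZ hY).diffVF hW.diffVF, hS.nabla_cross x Z Y hZ hY]
  simp only [inner_add_left]
  ring

/-- The derivative of `ψ` on vector fields. -/
theorem mvfderiv_fourForm (hLC : IsLeviCivita nabla) (x : M) (Y₁ Y₂ Y₃ Y₄ : ∀ y : M, TM M y)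
    (h₁ : SmoothVF Y₁ x) (h₂ : SmoothVF Y₂ x) (h₃ : SmoothVF Y₃ x) (h₄ : SmoothVF Y₄ x) (X : TM M x) :
    mvfderiv 𝓘(ℝ, E7) (fun y => fourForm (G.crossL y) (Y₁ y) (Y₂ y) (Y₃ y) (Y₄ y)) x X =
      fourForm (G.crossL x) (nabla Y₁ x X) (Y₂ x) (Y₃ x) (Y₄ x) +
      fourForm (G.crossL x) (Y₁ x) (nabla Y₂ x X) (Y₃ x) (Y₄ x) +
      fourForm (G.crossL x) (Y₁ x) (Y₂ x) (nabla Y₃ x X) (Y₄ x) +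
      fourForm (G.crossL x) (Y₁ x) (Y₂ x) (Y₃ x) (nabla Y₄ x X) +
      fourFormVar (G.crossL x) (nablaS eta x X).2 (Y₁ x) (Y₂ x) (Y₃ x) (Y₄ x) := by
  have m : ∀ {f : M → ℝ}, ContMDiffAt 𝓘(ℝ, E7) 𝓘(ℝ, ℝ) ∞ f x → MDifferentiableAt 𝓘(ℝ, E7) 𝓘(ℝ, ℝ) f x :=
    fun h => h.mdifferentiableAt (by simp)
  have hc₁ := G.smoothVF_cross h₁ h₂
  have hc₂ := G.smoothVF_cross h₃ h₄
  refine (mvfderiv_neg_add_mul_sub_mul (m (hc₁.inner hc₂)) (m (h₁.inner h₃)) (m (h₂.inner h₄))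
    (m (h₁.inner h₄)) (m (h₂.inner h₃)) X).trans ?_
  simp only [fourForm,
    hLC.metric x _ _ X hc₁.diffVF hc₂.diffVF, hLC.metric x _ _ X h₁.diffVF h₃.diffVF,
    hLC.metric x _ _ X h₁.diffVF h₄.diffVF, hLC.metric x _ _ X h₂.diffVF h₃.diffVF,
    hLC.metric x _ _ X h₂.diffVF h₄.diffVF, hS.nabla_cross x _ _ h₁ h₂, hS.nabla_cross x _ _ h₃ h₄,
    inner_add_left, inner_add_right, fourFormVar]
  ring

end IsSpinConnection
end G2Structure
end Spin

/-! ### Nearly parallel `G₂`-structures and Killing spinors -/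

section Variations
variable {V : Type*} [NormedAddCommGroup V] [InnerProductSpace ℝ V]

theorem crossVar_add (C : V →ₗ[ℝ] V →ₗ[ℝ] V) (b b' z y : V) :
    crossVar C (b + b') z y = crossVar C b z y + crossVar C b' z y := by
  simp only [crossVar, map_add, inner_add_right, add_smul, smul_add]
  abel

theorem crossVar_smul (C : V →ₗ[ℝ] V →ₗ[ℝ] V) (r : ℝ) (b z y : V) :
    crossVar C (r • b) z y = r • crossVar C b z y := by
  simp only [crossVar, map_smul, real_inner_smul_right, mul_smul, smul_add, smul_sub]
  rw [smul_comm r (inner ℝ z y) b]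

/-- A function that is linear in `b` is determined by its values on a basis. -/
theorem apply_eq_sum_frame (e : OrthonormalBasis (Fin 7) ℝ V) (F : V → ℝ)
    (hadd : ∀ a b, F (a + b) = F a + F b) (hsmul : ∀ (r : ℝ) a, F (r • a) = r * F a) (b : V) :
    F b = ∑ p, inner ℝ (e p) b * F (e p) := by
  let L : V →ₗ[ℝ] ℝ := ⟨⟨F, hadd⟩, hsmul⟩
  have h : L b = ∑ p, inner ℝ (e p) b * L (e p) := by
    conv_lhs => rw [← e.sum_repr' b]
    simp
  exact h

variable {e : OrthonormalBasis (Fin 7) ℝ V} {C : V →ₗ[ℝ] V →ₗ[ℝ] V}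

theorem IsCross.inner_crossVar_sum (hC : IsCross e C) (b : V) (i j k : Fin 7) :
    inner ℝ (crossVar C b (e i) (e j)) (e k) = ∑ p, inner ℝ (e p) b * (2 * psiZ p i j k) := by
  rw [apply_eq_sum_frame e (fun b => inner ℝ (crossVar C b (e i) (e j)) (e k))
    (fun a b => by simp only [crossVar_add, inner_add_left])
    (fun r a => by simp only [crossVar_smul, real_inner_smul_left])]
  simp only [hC.inner_crossVar_frame]

theorem IsCross.fourFormVar_sum (hC : IsCross e C) (b : V) (i j k l : Fin 7) :
    fourFormVar C b (e i) (e j) (e k) (e l) = -2 * (inner ℝ (e i) b * phiZ j k l -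
      inner ℝ (e j) b * phiZ i k l + inner ℝ (e k) b * phiZ i j l - inner ℝ (e l) b * phiZ i j k) := by
  rw [apply_eq_sum_frame e (fun b => fourFormVar C b (e i) (e j) (e k) (e l))
    (fun a b => by simp only [fourFormVar, crossVar_add, inner_add_left, inner_add_right]; ring)
    (fun r a => by
      simp only [fourFormVar, crossVar_smul, real_inner_smul_left, real_inner_smul_right]; ring)]
  simp only [hC.fourFormVar_frame]
  simp [mul_add, mul_sub, Finset.sum_add_distrib, Finset.sum_sub_distrib]
  ring

/-- The terms with a symmetric `∇` in the exterior derivative of a three-form cancel. -/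
theorem IsCross.alternating_sum_inner (hC : IsCross e C) (x : Fin 4 → V) (N : Fin 4 → Fin 4 → V)
    (hN : ∀ i j, N i j = N j i) :
    (inner ℝ (C (N 0 1) (x 2)) (x 3) + inner ℝ (C (x 1) (N 0 2)) (x 3) + inner ℝ (C (x 1) (x 2)) (N 0 3)) -
    (inner ℝ (C (N 1 0) (x 2)) (x 3) + inner ℝ (C (x 0) (N 1 2)) (x 3) + inner ℝ (C (x 0) (x 2)) (N 1 3)) +
    (inner ℝ (C (N 2 0) (x 1)) (x 3) + inner ℝ (C (x 0) (N 2 1)) (x 3) + inner ℝ (C (x 0) (x 1)) (N 2 3)) -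
    (inner ℝ (C (N 3 0) (x 1)) (x 2) + inner ℝ (C (x 0) (N 3 1)) (x 2) + inner ℝ (C (x 0) (x 1)) (N 3 2)) = 0 := by
  have r1 : ∀ i j a c, inner ℝ (C a (N i j)) c = -inner ℝ (C (N i j) a) c := fun i j a c => by
    rw [hC.swap, inner_neg_left]
  have r2 : ∀ i j a b, inner ℝ (C a b) (N i j) = inner ℝ (C (N i j) a) b := fun i j a b => by
    rw [hC.inner_left (N i j), real_inner_comm]
  simp only [r1, r2, hN 1 0, hN 2 0, hN 3 0, hN 2 1, hN 3 1, hN 3 2]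
  have s : ∀ a b c, inner ℝ (C a c) b = -inner ℝ (C a b) c := fun a b c => by
    rw [hC.inner_left a b c, hC.swap b c, inner_neg_right, neg_neg, ← hC.inner_left a c b]
  ring

/-- The terms with a symmetric `∇` in the exterior derivative of the four-form cancel. -/
theorem IsCross.alternating_sum_fourForm (hC : IsCross e C) (x : Fin 5 → V) (N : Fin 5 → Fin 5 → V)
    (hN : ∀ i j, N i j = N j i) :
    (fourForm C (N 0 1) (x 2) (x 3) (x 4) + fourForm C (x 1) (N 0 2) (x 3) (x 4) +
      fourForm C (x 1) (x 2) (N 0 3) (x 4) + fourForm C (x 1) (x 2) (x 3) (N 0 4)) -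
    (fourForm C (N 1 0) (x 2) (x 3) (x 4) + fourForm C (x 0) (N 1 2) (x 3) (x 4) +
      fourForm C (x 0) (x 2) (N 1 3) (x 4) + fourForm C (x 0) (x 2) (x 3) (N 1 4)) +
    (fourForm C (N 2 0) (x 1) (x 3) (x 4) + fourForm C (x 0) (N 2 1) (x 3) (x 4) +
      fourForm C (x 0) (x 1) (N 2 3) (x 4) + fourForm C (x 0) (x 1) (x 3) (N 2 4)) -
    (fourForm C (N 3 0) (x 1) (x 2) (x 4) + fourForm C (x 0) (N 3 1) (x 2) (x 4) +
      fourForm C (x 0) (x 1) (N 3 2) (x 4) + fourForm C (x 0) (x 1) (x 2) (N 3 4)) +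
    (fourForm C (N 4 0) (x 1) (x 2) (x 3) + fourForm C (x 0) (N 4 1) (x 2) (x 3) +
      fourForm C (x 0) (x 1) (N 4 2) (x 3) + fourForm C (x 0) (x 1) (x 2) (N 4 3)) = 0 := by
  have m2 : ∀ i j a c d, fourForm C a (N i j) c d = -fourForm C (N i j) a c d := fun i j a c d =>
    hC.fourForm_swap₁₂ _ _ _ _
  have m3 : ∀ i j a b d, fourForm C a b (N i j) d = fourForm C (N i j) a b d := fun i j a b d => by
    rw [hC.fourForm_swap₂₃, m2, neg_neg]
  have m4 : ∀ i j a b c, fourForm C a b c (N i j) = -fourForm C (N i j) a b c := fun i j a b c => by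
    rw [hC.fourForm_swap₃₄, m3]
  simp only [m2, m3, m4, hN 1 0, hN 2 0, hN 3 0, hN 4 0, hN 2 1, hN 3 1, hN 4 1, hN 3 2, hN 4 2, hN 4 3]
  ring
end Variations

section Killing
variable {M : Type*} [TopologicalSpace M] [ChartedSpace E7 M] [IsManifold 𝓘(ℝ, E7) ∞ M]
  [RiemannianBundle (TM M)] [IsContMDiffRiemannianBundle 𝓘(ℝ, E7) ∞ E7 (TM M)]
  {nabla : CovariantDerivative 𝓘(ℝ, E7) E7 (TM M)}
  {nablaS : CovariantDerivative 𝓘(ℝ, E7) (ℝ × E7) (SM M)}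

omit [IsContMDiffRiemannianBundle 𝓘(ℝ, E7) ∞ E7 (TM M)] in
theorem IsLeviCivita.nabla_extend_comm (hLC : IsLeviCivita nabla) {x y : M}
    (hy : y ∈ (chartAt E7 x).source) (v w : TM M x) :
    nabla (FiberBundle.extend E7 v) y (FiberBundle.extend E7 w y) =
      nabla (FiberBundle.extend E7 w) y (FiberBundle.extend E7 v y) := by
  have h := hLC.torsion_free y (FiberBundle.extend E7 w) (FiberBundle.extend E7 v)
    ((contMDiffAt_extend_of_mem hy w).mdifferentiableAt (by simp))
    ((contMDiffAt_extend_of_mem hy v).mdifferentiableAt (by simp))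
  rw [mlieBracket_extend hy, sub_eq_zero] at h
  exact h

namespace G2Structure
variable {G : G2Structure M}

namespace IsSpinConnection
variable (hS : G.IsSpinConnection nabla nablaS) (hLC : IsLeviCivita nabla)
include hS hLC

/-- The exterior derivative of `φ`.  The Levi-Civita terms cancel, since coordinate fields commute, and only the
derivative of `η` remains. -/
theorem extDeriv_form {x y : M} (hy : y ∈ (chartAt E7 x).source) (v : Fin 4 → TM M x)
    (X : Fin 4 → TM M y) (hX : ∀ i, X i = FiberBundle.extend E7 (v i) y) :
    extDeriv (formInChart G.form x) (extChartAt 𝓘(ℝ, E7) x y) v =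
      inner ℝ (crossVar (G.crossL y) (nablaS eta y (X 0)).2 (X 1) (X 2)) (X 3) -
      inner ℝ (crossVar (G.crossL y) (nablaS eta y (X 1)).2 (X 0) (X 2)) (X 3) +
      inner ℝ (crossVar (G.crossL y) (nablaS eta y (X 2)).2 (X 0) (X 1)) (X 3) -
      inner ℝ (crossVar (G.crossL y) (nablaS eta y (X 3)).2 (X 0) (X 1)) (X 2) := by
  have hs : ∀ i, SmoothVF (FiberBundle.extend E7 (v i) : ∀ y : M, TM M y) y := fun i =>
    contMDiffAt_extend_of_mem hy (v i)
  have hd : ∀ i a b c, i.removeNth v = ![v a, v b, v c] → mvfderiv 𝓘(ℝ, E7)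
      (fun y => G.form y fun j => FiberBundle.extend E7 (i.removeNth v j) y) y (FiberBundle.extend E7 (v i) y) =
      inner ℝ (G.crossL y (nabla (FiberBundle.extend E7 (v a)) y (X i)) (X b)) (X c) +
      inner ℝ (G.crossL y (X a) (nabla (FiberBundle.extend E7 (v b)) y (X i))) (X c) +
      inner ℝ (G.crossL y (X a) (X b)) (nabla (FiberBundle.extend E7 (v c)) y (X i)) +
      inner ℝ (crossVar (G.crossL y) (nablaS eta y (X i)).2 (X a) (X b)) (X c) := by
    intro i a b c hi
    have hform : (fun y => G.form y fun j => FiberBundle.extend E7 (i.removeNth v j) y) =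
        fun y => inner ℝ (G.crossL y (FiberBundle.extend E7 (v a) y) (FiberBundle.extend E7 (v b) y))
          (FiberBundle.extend E7 (v c) y) := by
      funext y
      rw [← G.form_eq, hi]
      congr 1
      funext j
      fin_cases j <;> rfl
    rw [hform, ← hX, hS.mvfderiv_form hLC y _ _ _ (hs a) (hs b) (hs c)]
    simp only [hX]
  have hN := fun i j => hLC.nabla_extend_comm hy (v i) (v j)
  simp only [← hX] at hN
  have key := (G.isCross y).alternating_sum_inner X
    (fun i j => nabla (FiberBundle.extend E7 (v j)) y (X i)) (fun i j => hN j i)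
  rw [extDeriv_formInChart G.smooth hy, Fin.sum_univ_four,
    hd 0 1 2 3 (by funext j; fin_cases j <;> rfl), hd 1 0 2 3 (by funext j; fin_cases j <;> rfl),
    hd 2 0 1 3 (by funext j; fin_cases j <;> rfl), hd 3 0 1 2 (by funext j; fin_cases j <;> rfl)]
  norm_num
  linear_combination key

variable (hG : G.IsNearlyParallel 4)
include hG

/-- The part of `dφ = 4ψ` that involves the derivative of the spinor field. -/
theorem crossVar_eq_fourForm (x : M) (X : Fin 4 → TM M x) :
      inner ℝ (crossVar (G.crossL x) (nablaS eta x (X 0)).2 (X 1) (X 2)) (X 3) -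
      inner ℝ (crossVar (G.crossL x) (nablaS eta x (X 1)).2 (X 0) (X 2)) (X 3) +
      inner ℝ (crossVar (G.crossL x) (nablaS eta x (X 2)).2 (X 0) (X 1)) (X 3) -
      inner ℝ (crossVar (G.crossL x) (nablaS eta x (X 3)).2 (X 0) (X 1)) (X 2) =
      4 * fourForm (G.crossL x) (X 0) (X 1) (X 2) (X 3) := by
  rw [← hS.extDeriv_form hLC (mem_chart_source E7 x) X X (fun i => by simp), ← extD_eq_extDeriv,
    ← hG.extD_eq]
  congr 1
  funext j
  fin_cases j <;> rfl

/-- The part of `dψ = 0` that involves the derivative of the spinor field. -/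
theorem sum_fourFormVar (x : M) (X : Fin 5 → TM M x) :
    fourFormVar (G.crossL x) (nablaS eta x (X 0)).2 (X 1) (X 2) (X 3) (X 4) -
    fourFormVar (G.crossL x) (nablaS eta x (X 1)).2 (X 0) (X 2) (X 3) (X 4) +
    fourFormVar (G.crossL x) (nablaS eta x (X 2)).2 (X 0) (X 1) (X 3) (X 4) -
    fourFormVar (G.crossL x) (nablaS eta x (X 3)).2 (X 0) (X 1) (X 2) (X 4) +
    fourFormVar (G.crossL x) (nablaS eta x (X 4)).2 (X 0) (X 1) (X 2) (X 3) = 0 := by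
  have hs : ∀ v : TM M x, SmoothVF (FiberBundle.extend E7 v : ∀ y : M, TM M y) x := fun v =>
    contMDiffAt_extend_of_mem (mem_chart_source E7 x) v
  let f : (Fin 4 → TM M x) → M → ℝ := fun w y => fourForm (G.crossL y) (FiberBundle.extend E7 (w 0) y)
    (FiberBundle.extend E7 (w 1) y) (FiberBundle.extend E7 (w 2) y) (FiberBundle.extend E7 (w 3) y)
  have hf : ∀ w, MDifferentiableAt 𝓘(ℝ, E7) 𝓘(ℝ, ℝ) (f w) x := fun w =>
    (G2Structure.contMDiffAt_fourForm (hs (w 0)) (hs (w 1)) (hs (w 2)) (hs (w 3))).mdifferentiableAt (by simp)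
  have h := sum_mvfderiv_eq_zero G.smooth x (fun w => (fun _ => (4 : ℝ)) * f w)
    (fun w => mdifferentiableAt_const.mul (hf w)) (fun (w : Fin 4 → TM M x) y hy => by
      rw [hS.extDeriv_form hLC hy w (fun i => FiberBundle.extend E7 (w i) y) (fun i => rfl)]
      exact hS.crossVar_eq_fourForm hLC hG y (fun i => FiberBundle.extend E7 (w i) y)) X
  replace h := (Fin.sum_univ_five _).symm.trans h
  simp only [mvfderiv_mul mdifferentiableAt_const (hf _), mvfderiv_const] at h
  have hd : ∀ i a b c d, i.removeNth X = ![X a, X b, X c, X d] →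
      mvfderiv 𝓘(ℝ, E7) (f (i.removeNth X)) x (X i) =
      fourForm (G.crossL x) (nabla (FiberBundle.extend E7 (X a)) x (X i)) (X b) (X c) (X d) +
      fourForm (G.crossL x) (X a) (nabla (FiberBundle.extend E7 (X b)) x (X i)) (X c) (X d) +
      fourForm (G.crossL x) (X a) (X b) (nabla (FiberBundle.extend E7 (X c)) x (X i)) (X d) +
      fourForm (G.crossL x) (X a) (X b) (X c) (nabla (FiberBundle.extend E7 (X d)) x (X i)) +
      fourFormVar (G.crossL x) (nablaS eta x (X i)).2 (X a) (X b) (X c) (X d) := by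
    intro i a b c d hi
    rw [hi]
    refine (hS.mvfderiv_fourForm hLC x _ _ _ _ (hs (X a)) (hs (X b)) (hs (X c)) (hs (X d)) (X i)).trans ?_
    simp only [FiberBundle.extend_apply_self]
  have hN := fun i j => hLC.nabla_extend_comm (mem_chart_source E7 x) (X i) (X j)
  simp only [FiberBundle.extend_apply_self] at hN
  have key := (G.isCross x).alternating_sum_fourForm X
    (fun i j => nabla (FiberBundle.extend E7 (X j)) x (X i)) (fun i j => hN j i)
  simp only [_root_.smul_apply, smul_zero, add_zero, smul_eq_mul] at h
  rw [hd 0 1 2 3 4 (by funext j; fin_cases j <;> rfl), hd 1 0 2 3 4 (by funext j; fin_cases j <;> rfl),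
    hd 2 0 1 3 4 (by funext j; fin_cases j <;> rfl), hd 3 0 1 2 4 (by funext j; fin_cases j <;> rfl),
    hd 4 0 1 2 3 (by funext j; fin_cases j <;> rfl)] at h
  norm_num at h
  linear_combination h / 4 - key

/-- The spinor field of a nearly parallel `G₂`-structure is a Killing spinor, `∇_X η = -(1/2) X · η`. -/
theorem nablaS_eta (x : M) (X : TM M x) : nablaS eta x X = ((0 : ℝ), (1 / 2 : ℝ) • X) := by
  let e := G.frame x
  let b : Fin 7 → Fin 7 → ℝ := fun p q => inner ℝ (e p) (nablaS eta x (e q)).2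
  have hC : IsCross e (G.crossL x) := G.isCross x
  have hb := eq_half_of_deriv_psiZ b (fun i j k l => by
    have h := hS.crossVar_eq_fourForm hLC hG x ![e i, e j, e k, e l]
    simp only [Matrix.cons_val] at h
    rw [hC.inner_crossVar_sum, hC.inner_crossVar_sum, hC.inner_crossVar_sum, hC.inner_crossVar_sum,
      hC.fourForm_frame, ← Finset.sum_sub_distrib, ← Finset.sum_add_distrib, ← Finset.sum_sub_distrib] at h
    have a2 : ∀ i p k l, psiZ i p k l = -psiZ p i k l := by decide +kernel
    have a3 : ∀ i j p l, psiZ i j p l = psiZ p i j l := by decide +kernel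
    have a4 : ∀ i j k p, psiZ i j k p = -psiZ p i j k := by decide +kernel
    have h2 : ∀ p, (b p i * psiZ p j k l + b p j * psiZ i p k l + b p k * psiZ i j p l + b p l * psiZ i j k p : ℝ) =
        1 / 2 * (inner ℝ (e p) (nablaS eta x (e i)).2 * (2 * psiZ p j k l) -
          inner ℝ (e p) (nablaS eta x (e j)).2 * (2 * psiZ p i k l) +
          inner ℝ (e p) (nablaS eta x (e k)).2 * (2 * psiZ p i j l) -
          inner ℝ (e p) (nablaS eta x (e l)).2 * (2 * psiZ p i j k)) := by
      intro p
      rw [a2 i p, a3 i j p, a4 i j k p]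
      push_cast
      simp only [b]
      ring
    simp only [h2, ← Finset.mul_sum]
    rw [h]
    ring) (fun i j k l m => by
    have h := hS.sum_fourFormVar hLC hG x ![e i, e j, e k, e l, e m]
    simp only [Matrix.cons_val] at h
    simp only [hC.fourFormVar_sum] at h
    linear_combination h / 2)
  refine Prod.ext (hS.fst_eta x X) ?_
  change (nablaS eta x X).2 = (1 / 2 : ℝ) • X
  rw [← sub_eq_zero]
  revert X
  refine eq_zero_of_frame e (fun X => (nablaS eta x X).2 - (1 / 2 : ℝ) • X) (fun a c => ?_) (fun r a => ?_) fun q => ?_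
  · simp only [map_add, Prod.snd_add, smul_add]; abel
  · simp only [map_smul, Prod.smul_snd, smul_sub]
    rw [smul_comm]
  · rw [sub_eq_zero, ← e.sum_repr' (nablaS eta x (e q)).2]
    have : ∀ p, inner ℝ (e p) (nablaS eta x (e q)).2 = if p = q then (1 / 2 : ℝ) else 0 := fun p => hb p q
    simp [this]

end IsSpinConnection
end G2Structure
end Killing

/-! ### Covariant derivatives in the adjoint bundle -/

section AdjointBundle
variable {EM : Type*} [NormedAddCommGroup EM] [NormedSpace ℝ EM]
  {EK : Type*} [NormedAddCommGroup EK] [NormedSpace ℝ EK]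
  {EP : Type*} [NormedAddCommGroup EP] [NormedSpace ℝ EP]
  {M K P : Type*} [TopologicalSpace M] [ChartedSpace EM M]
  [TopologicalSpace K] [ChartedSpace EK K] [Group K] [LieGroup 𝓘(ℝ, EK) ∞ K]
  [TopologicalSpace P] [ChartedSpace EP P] [IsManifold 𝓘(ℝ, EP) ∞ P]
  {Q : PrincipalBundle EM EK EP M K P}

namespace PrincipalBundle.Connection
variable (A : Q.Connection)

theorem cov_congr {e e' : ∀ x : M, Q.AdFiber x} {x : M} (h : ∀ᶠ y in nhds x, e y = e' y)
    (X : TangentSpace 𝓘(ℝ, EM) x) : A.cov e x X = A.cov e' x X := by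
  ext p
  obtain ⟨p, rfl⟩ := p
  have hl : Q.lift e =ᶠ[nhds p] Q.lift e' := by
    filter_upwards [Q.contMDiff_proj.continuous.continuousAt.eventually h] with q hq
    rw [lift, lift, hq]
  have h1 : mvfderiv 𝓘(ℝ, EP) (Q.lift e) p = mvfderiv 𝓘(ℝ, EP) (Q.lift e') p := by
    ext v
    exact congrArg (fun L : EP →L[ℝ] EK => L v) (hl.mfderiv_eq (I := 𝓘(ℝ, EP)) (I' := 𝓘(ℝ, EK)))
  exact congrArg (fun L : EP →L[ℝ] EK => L (A.horLift p X)) h1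

theorem cov_fun_smul {f : M → ℝ} {e : ∀ x : M, Q.AdFiber x} {x : M}
    (hf : MDifferentiableAt 𝓘(ℝ, EM) 𝓘(ℝ, ℝ) f x) (he : Q.SmoothAdAt e x) (X : TangentSpace 𝓘(ℝ, EM) x) :
    A.cov (fun y => f y • e y) x X = f x • A.cov e x X + mvfderiv 𝓘(ℝ, EM) f x X • e x := by
  ext p
  obtain ⟨p, rfl⟩ := p
  have h1 := (he p rfl).mdifferentiableAt (by simp)
  have hp := Q.hasMFDerivAt_proj (rfl : p = p)
  have h2 := hf.comp p hp.mdifferentiableAt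
  have h3 := mvfderiv_smul h2 h1
  have h4 := congrArg (fun L : EP →L[ℝ] EK => L (A.horLift p X)) h3
  have h5 : (mvfderiv 𝓘(ℝ, EP) (f ∘ Q.proj) p : EP →L[ℝ] ℝ) (A.horLift p X) = mvfderiv 𝓘(ℝ, EM) f (Q.proj p) X := by
    have h6 := (HasMFDerivAt.comp p hf.hasMFDerivAt hp).mfderiv
    have h7 := congrArg (fun L : EP →L[ℝ] ℝ => L (A.horLift p X)) h6
    refine Eq.trans h7 ?_
    exact congrArg (mfderiv 𝓘(ℝ, EM) 𝓘(ℝ, ℝ) f (Q.proj p) : EM →L[ℝ] ℝ) (A.dproj_horLift p X)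
  refine h4.trans ?_
  rw [← h5]
  rfl

end PrincipalBundle.Connection
end AdjointBundle

/-! ### Clifford multiplication by one-forms and two-forms -/

section CliffordForms
variable {M : Type*} [TopologicalSpace M] [ChartedSpace E7 M] [IsManifold 𝓘(ℝ, E7) ∞ M]
  [RiemannianBundle (TM M)] {W : Type*} [AddCommGroup W] [Module ℝ W]
namespace G2Structure
variable (G : G2Structure M)

omit [IsManifold 𝓘(ℝ, E7) ∞ M] in
theorem spinInner_apply (x : M) (u w : SM M x) : spinInner x u w = u.1 * w.1 + inner ℝ u.2 w.2 := by
  simp [spinInner]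

theorem sum_fin_two {ι : Type*} [Fintype ι] [DecidableEq ι] {V : Type*} [AddCommMonoid V] (F : (Fin 2 → ι) → V) :
    ∑ i, F i = ∑ a, ∑ b, F ![a, b] := by
  rw [← (finTwoArrowEquiv ι).symm.sum_comp, Fintype.sum_prod_type]
  rfl

theorem sum_fin_one {ι : Type*} [Fintype ι] [DecidableEq ι] {V : Type*} [AddCommMonoid V] (F : (Fin 1 → ι) → V) :
    ∑ i, F i = ∑ a, F ![a] := by
  rw [← (Equiv.funUnique (Fin 1) ι).symm.sum_comp]
  refine Finset.sum_congr rfl fun a _ => congrArg F ?_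
  ext j
  fin_cases j
  rfl

theorem cliffWord_one (x : M) (a : Fin 7) : G.cliffWord x ![a] = G.cliff x (G.frame x a) := by
  simp [cliffWord]

theorem cliffWord_two (x : M) (a b : Fin 7) :
    G.cliffWord x ![a, b] = G.cliff x (G.frame x a) * G.cliff x (G.frame x b) := by
  simp [cliffWord]

theorem sum_frame (x : M) (α : TM M x →ₗ[ℝ] W) (Y : TM M x) :
    ∑ a, inner ℝ (G.frame x a) Y • α (G.frame x a) = α Y := by
  conv_rhs => rw [← (G.frame x).sum_repr' Y]
  simp

theorem cliffFormVal_one_eta (x : M) (α : TM M x →ₗ[ℝ] W) (u : SM M x) :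
    G.cliffFormVal x 1 (fun v => α (v 0)) (eta x) u = -α u.2 := by
  simp only [cliffFormVal, sum_fin_one, cliffWord_one, cliff_apply, eta]
  rw [← G.sum_frame x α u.2]
  simp [spinInner_apply]

/-- The Clifford product of a two-form `β` with `η`, for `β` the antisymmetrisation of `n`.  The value at `u` is the inner
product of `β` with the two-form `i_{u.2} φ`, and does not involve `u.1`. -/
theorem cliffFormVal_two_eta (x : M) (β : (Fin 2 → TM M x) → W) (n : Fin 7 → Fin 7 → W)
    (h : ∀ a b, β ![G.frame x a, G.frame x b] = n a b - n b a) (u : SM M x) :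
    G.cliffFormVal x 2 β (eta x) u =
      -∑ a, ∑ b, inner ℝ (G.frame x b) (G.crossL x (G.frame x a) u.2) • n a b := by
  have hC := G.isCross x
  have e1 : ∀ a b : Fin 7, inner ℝ (G.crossL x (G.frame x a) (G.frame x b)) u.2 =
      -inner ℝ (G.frame x b) (G.crossL x (G.frame x a) u.2) := fun a b => by
    rw [hC.swap, inner_neg_left, hC.inner_left]
  have e2 : ∀ a b : Fin 7, inner ℝ (G.crossL x (G.frame x a) (G.frame x b)) u.2 =
      inner ℝ (G.frame x a) (G.crossL x (G.frame x b) u.2) := fun a b => hC.inner_left _ _ _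
  have e3 : ∀ a b : Fin 7, (fun r => G.frame x ((![a, b] : Fin 2 → Fin 7) r)) = ![G.frame x a, G.frame x b] :=
    fun a b => by ext r; fin_cases r <;> rfl
  have h2 : G.cliffFormVal x 2 β (eta x) u = (1 / 2 : ℝ) • ∑ a, ∑ b,
      inner ℝ (G.crossL x (G.frame x a) (G.frame x b)) u.2 • (n a b - n b a) := by
    simp only [cliffFormVal, sum_fin_two, cliffWord_two, Module.End.mul_apply, cliff_apply, eta, e3, h]
    simp only [LinearMap.smul_apply, LinearMap.coe_sum, Finset.sum_apply, LinearMap.smulRight_apply,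
      spinInner_apply]
    congr 1
    · norm_num
    · refine Finset.sum_congr rfl fun a _ => Finset.sum_congr rfl fun b _ => ?_
      by_cases hab : a = b
      · subst hab; simp
      · simp [(G.frame x).inner_eq_ite, hab]
  rw [h2]
  simp only [smul_sub, Finset.sum_sub_distrib]
  rw [Finset.sum_comm (f := fun a b => inner ℝ (G.crossL x (G.frame x a) (G.frame x b)) u.2 • n b a)]
  simp only [← Finset.sum_neg_distrib, ← Finset.sum_sub_distrib, Finset.smul_sum]
  refine Finset.sum_congr rfl fun a _ => Finset.sum_congr rfl fun b _ => ?_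
  rw [e1, e2]
  module

/-- The Λ¹-component of the Clifford product `(i_X φ) · u`. -/
theorem cliffForm_two_snd (x : M) (X : TM M x) (u : SM M x) :
    (G.cliffForm x 2 (fun v => G.form x ![X, v 0, v 1]) u).2 =
      (3 * u.1) • X - G.crossL x X u.2 := by
  have hC := G.isCross x
  have h0 : (G.cliffForm x 2 (fun v => G.form x ![X, v 0, v 1]) u).2 = (1 / 2 : ℝ) •
      ∑ a, ∑ b, inner ℝ (G.crossL x X (G.frame x a)) (G.frame x b) •
        (-(inner ℝ (G.frame x b) u.2 • G.frame x a) + u.1 • G.crossL x (G.frame x a) (G.frame x b) +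
          G.crossL x (G.frame x a) (G.crossL x (G.frame x b) u.2)) := by
    simp only [cliffForm, sum_fin_two, cliffWord_two, form_eq]
    simp only [LinearMap.smul_apply, LinearMap.coe_sum, Finset.sum_apply, Module.End.mul_apply, cliff_apply]
    refine congrArg₂ (fun (r : ℝ) (v : TM M x) => r • v) (by norm_num) ?_
    rw [Prod.snd_sum]
    refine Finset.sum_congr rfl fun a _ => ?_
    rw [Prod.snd_sum]
    refine Finset.sum_congr rfl fun b _ => ?_
    refine congrArg (fun v : TM M x => inner ℝ (G.crossL x X (G.frame x a)) (G.frame x b) • v) ?_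
    simp only [map_neg, map_add, map_smul]
    module
  rw [h0]
  simp only [smul_add, Finset.sum_add_distrib, smul_comm _ u.1, ← Finset.smul_sum]
  rw [hC.sum_inner_cross_smul_cross, hC.sum_inner_cross_smul_cross_cross]
  have h1 : ∀ a, ∑ b, inner ℝ (G.crossL x X (G.frame x a)) (G.frame x b) • -(inner ℝ (G.frame x b) u.2 • G.frame x a) =
      inner ℝ (G.frame x a) (G.crossL x X u.2) • G.frame x a := fun a => by
    simp only [smul_neg, smul_smul, Finset.sum_neg_distrib, ← Finset.sum_smul,
      (G.frame x).sum_inner_mul_inner]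
    rw [hC.swap, inner_neg_left, hC.inner_left, neg_smul, neg_neg]
  simp only [h1]
  rw [(G.frame x).sum_repr']
  module

end G2Structure
end CliffordForms

/-! ### The twisted Dirac operator on one-forms -/

section Dirac
variable {M : Type*} [TopologicalSpace M] [ChartedSpace E7 M] [IsManifold 𝓘(ℝ, E7) ∞ M]
  [RiemannianBundle (TM M)] [IsContMDiffRiemannianBundle 𝓘(ℝ, E7) ∞ E7 (TM M)]
  {EK : Type*} [NormedAddCommGroup EK] [NormedSpace ℝ EK]
  {EP : Type*} [NormedAddCommGroup EP] [NormedSpace ℝ EP]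
  {K P : Type*} [TopologicalSpace K] [ChartedSpace EK K] [Group K] [LieGroup 𝓘(ℝ, EK) ∞ K]
  [TopologicalSpace P] [ChartedSpace EP P] [IsManifold 𝓘(ℝ, EP) ∞ P]
  {Q : PrincipalBundle E7 EK EP M K P}
  {nabla : CovariantDerivative 𝓘(ℝ, E7) E7 (TM M)}
  {nablaS : CovariantDerivative 𝓘(ℝ, E7) (ℝ × E7) (SM M)}

namespace G2Structure
variable {G : G2Structure M}

theorem sum_spinFrame {W : Type*} [AddCommGroup W] [Module ℝ W] (x : M) (s : SM M x →ₗ[ℝ] W) (u : SM M x) :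
    ∑ B, spinInner x (G.spinFrame x B) u • s (G.spinFrame x B) = s u := by
  have h1 : s u = u.1 • s ((1 : ℝ), (0 : TM M x)) + s ((0 : ℝ), u.2) := by
    rw [← map_smul, ← map_add]
    congr 1
    ext1 <;> simp
  have h2 := G.sum_frame x (s ∘ₗ LinearMap.inr ℝ ℝ (TM M x)) u.2
  rw [Fintype.sum_option, h1]
  refine congrArg₂ (· + ·) ?_ ?_
  · simp [spinFrame, spinInner_apply]
  · refine Eq.trans ?_ h2
    simp [spinFrame, spinInner_apply]

theorem mulEta_apply (ε : ∀ x : M, TM M x →ₗ[ℝ] Q.AdFiber x) (x : M) (u : SM M x) :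
    G.mulEta ε x u = -ε x u.2 := G.cliffFormVal_one_eta x (ε x) u

/-- The component `(∇_{e_a} ε)(e_b)` of the covariant derivative of a one-form with values in `Ad_P`. -/
def covComp (G : G2Structure M) (nabla : CovariantDerivative 𝓘(ℝ, E7) E7 (TM M)) (A : Q.Connection)
    (ε : ∀ x : M, TM M x →ₗ[ℝ] Q.AdFiber x) (x : M) (a b : Fin 7) : Q.AdFiber x :=
  A.cov (fun y => ε y (FiberBundle.extend E7 (G.frame x b) y)) x (G.frame x a) -
    ε x (nabla (FiberBundle.extend E7 (G.frame x b)) x (G.frame x a))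

theorem dAstar_eq (A : Q.Connection) (ε : ∀ x : M, TM M x →ₗ[ℝ] Q.AdFiber x) (x : M) :
    G.dAstar nabla A ε x = -∑ a, G.covComp nabla A ε x a a := rfl

/-- `d^A ε` is the antisymmetrised covariant derivative, as the Levi-Civita connection is torsion-free. -/
theorem dA_frame (hLC : IsLeviCivita nabla) (A : Q.Connection) (ε : ∀ x : M, TM M x →ₗ[ℝ] Q.AdFiber x)
    (x : M) (a b : Fin 7) : dA A ε x ![G.frame x a, G.frame x b] =
      G.covComp nabla A ε x a b - G.covComp nabla A ε x b a := by
  have h := hLC.nabla_extend_comm (mem_chart_source E7 x) (G.frame x a) (G.frame x b)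
  simp only [FiberBundle.extend_apply_self] at h
  simp only [dA, covComp, Matrix.cons_val_zero, Matrix.cons_val_one,
    mlieBracket_extend (mem_chart_source E7 x), map_zero, h]
  abel

variable (hS : G.IsSpinConnection nabla nablaS) (hLC : IsLeviCivita nabla) (hG : G.IsNearlyParallel 4)
include hS hLC hG

/-- `∇^t_X η = (0, (1 + t)/2 X)`; in particular `η` is parallel for `t = -1`. -/
theorem spinCov_none (t : ℝ) (x : M) (X : TM M x) :
    (G.spinCov nablaS t (FiberBundle.extend (ℝ × E7) (G.spinFrame x none)) x X).2 = ((1 + t) / 2) • X := by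
  have h1 : nablaS (FiberBundle.extend (ℝ × E7) (G.spinFrame x none)) x = nablaS eta x := by
    refine nablaS.isCovariantDerivativeOnUniv.congr_of_eventuallyEq
      (FiberBundle.mdifferentiableAt_extend _ _ _) (diffSpinor_eta x) Filter.univ_mem ?_
    filter_upwards [(chartAt E7 x).open_source.mem_nhds (mem_chart_source E7 x),
      extend_smul (F := E7) (V := TM M) (x := x) (0 : ℝ) 0] with y hy h0
    rw [spinFrame, extend_pair hy]
    rw [zero_smul, zero_smul] at h0
    rw [h0]
    rfl
  rw [spinCov, h1, hS.nablaS_eta hLC hG, FiberBundle.extend_apply_self, Prod.snd_add, Prod.smul_snd,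
    cliffForm_two_snd]
  simp only [spinFrame, map_zero]
  module

/-- The Λ¹-component of `∇^t` on one-forms. -/
theorem spinCov_some (t : ℝ) (x : M) (X : TM M x) (a : Fin 7) :
    (G.spinCov nablaS t (FiberBundle.extend (ℝ × E7) (G.spinFrame x (some a))) x X).2 =
      nabla (FiberBundle.extend E7 (G.frame x a)) x X -
        (1 / 2 + t / 6) • G.crossL x X (G.frame x a) := by
  have hd : DiffSpinor (fun y => ((0 : ℝ), (FiberBundle.extend E7 (G.frame x a) y : TM M y))) x :=
    diffSpinor_pair mdifferentiableAt_const (FiberBundle.mdifferentiableAt_extend _ _ _)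
  have h1 : nablaS (FiberBundle.extend (ℝ × E7) (G.spinFrame x (some a))) x =
      nablaS (fun y => ((0 : ℝ), (FiberBundle.extend E7 (G.frame x a) y : TM M y))) x := by
    refine nablaS.isCovariantDerivativeOnUniv.congr_of_eventuallyEq
      (FiberBundle.mdifferentiableAt_extend _ _ _) hd Filter.univ_mem ?_
    filter_upwards [(chartAt E7 x).open_source.mem_nhds (mem_chart_source E7 x)] with y hy
    rw [spinFrame, extend_pair hy]
  have h2 := hS.nablaS_neg x (FiberBundle.extend E7 (G.frame x a)) (FiberBundle.mdifferentiableAt_extend _ _ _) X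
  have h3 := nablaS.isCovariantDerivativeOnUniv.smul_const (-1) hd
  have h4 : ((-1 : ℝ) • fun y => (((0 : ℝ), (FiberBundle.extend E7 (G.frame x a) y : TM M y)) : SM M y)) =
      fun y => ((0 : ℝ), -(FiberBundle.extend E7 (G.frame x a) y : TM M y)) := by
    funext y
    refine Prod.ext ?_ ?_ <;> simp
  rw [h4] at h3
  have h5 := congrArg Prod.snd ((congrArg (fun L : TM M x →L[ℝ] SM M x => L X) h3).symm.trans h2)
  rw [spinCov, h1, FiberBundle.extend_apply_self, Prod.snd_add, Prod.smul_snd, cliffForm_two_snd]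
  rw [hS.nablaS_eta hLC hG] at h5
  have h6 : -(nablaS (fun y => ((0 : ℝ), (FiberBundle.extend E7 (G.frame x a) y : TM M y))) x X).2 =
      -(nabla (FiberBundle.extend E7 (G.frame x a)) x X) - G.crossL x (G.frame x a) ((1 / 2 : ℝ) • X) := by
    refine Eq.trans ?_ (h5.trans ?_)
    · simp
    · simp
  rw [map_smul, (G.isCross x).swap] at h6
  simp only [spinFrame]
  linear_combination (norm := module) -h6

/-- The covariant derivative of `ε · η`: the derivatives of `ε`, and zeroth order terms from `∇^t η` and from the torsion
of `∇^t`. -/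
theorem twistedCov_mulEta (t : ℝ) (A : Q.Connection) {ε : ∀ x : M, TM M x →ₗ[ℝ] Q.AdFiber x}
    (hε : ε ∈ Q.smoothHom E7 (TM M)) (x : M) (a : Fin 7) (u : SM M x) :
    G.twistedCov nablaS t A (G.mulEta ε) x (G.frame x a) u =
      (u.1 * ((1 + t) / 2)) • ε x (G.frame x a) -
      ∑ b, inner ℝ (G.frame x b) u.2 • G.covComp nabla A ε x a b -
      (1 / 2 + t / 6) • ε x (G.crossL x (G.frame x a) u.2) := by
  have hneg : ∀ (y : M) (w : Q.AdFiber y), (-1 : ℝ) • w = -w := fun y w => by module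
  have hcov : ∀ v : SM M x, A.cov (fun y => G.mulEta ε y (FiberBundle.extend (ℝ × E7) v y)) x (G.frame x a) =
      -A.cov (fun y => ε y (FiberBundle.extend E7 v.2 y)) x (G.frame x a) := by
    intro v
    have h1 := A.cov_smul (PrincipalBundle.smoothAdAt_extend hε x v.2) (-1) (G.frame x a)
    refine Eq.trans ?_ (h1.trans (hneg x _))
    refine A.cov_congr ?_ _
    filter_upwards [(chartAt E7 x).open_source.mem_nhds (mem_chart_source E7 x)] with y hy
    have h2 := extend_pair hy v.1 v.2
    rw [mulEta_apply]
    exact (congrArg (fun w : SM M y => -ε y w.2) h2).trans (hneg y _).symm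
  have hcov0 : A.cov (fun y => ε y (FiberBundle.extend E7 (0 : TM M x) y)) x (G.frame x a) = 0 := by
    have h1 := A.cov_smul (PrincipalBundle.smoothAdAt_extend hε x 0) 0 (G.frame x a)
    rw [zero_smul] at h1
    rw [← h1]
    refine A.cov_congr ?_ _
    filter_upwards [extend_smul (F := E7) (V := TM M) (x := x) (0 : ℝ) 0] with y h0
    rw [zero_smul, zero_smul] at h0
    rw [h0, map_zero, zero_smul]
  simp only [twistedCov, LinearMap.coe_sum, Finset.sum_apply, LinearMap.smulRight_apply, hcov]
  simp only [mulEta_apply]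
  rw [Fintype.sum_option, spinCov_none hS hLC hG]
  simp only [spinCov_some hS hLC hG]
  have h0 : (G.spinFrame x none).2 = 0 := rfl
  have h0' : ∀ b, (G.spinFrame x (some b)).2 = G.frame x b := fun _ => rfl
  simp only [h0, h0', hcov0, map_sub, map_smul]
  have hT : ∑ b, inner ℝ (G.frame x b) u.2 • ε x (G.crossL x (G.frame x a) (G.frame x b)) =
      ε x (G.crossL x (G.frame x a) u.2) := G.sum_frame x (ε x ∘ₗ G.crossL x (G.frame x a)) u.2
  rw [← hT, Finset.smul_sum, sub_sub, ← Finset.sum_add_distrib,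
    sub_eq_add_neg ((u.1 * ((1 + t) / 2)) • ε x (G.frame x a)), ← Finset.sum_neg_distrib]
  refine congrArg₂ (· + ·) ?_ (Finset.sum_congr rfl fun b _ => ?_)
  · simp [spinInner_apply, spinFrame, smul_smul]
  · simp only [spinInner_apply, spinFrame, covComp, zero_mul, zero_add]
    module

/-- The Dirac operator on `ε · η`.  As `ε · η` is `u ↦ -ε(u.2)` in `Hom(S, Ad_P)`, this says
`D^{t,A}(ε · η) = (d^A)^* ε ⊗ η + (d^A ε) · η - (t + 5)/2 ε · η`. -/
theorem dirac_mulEta (t : ℝ) (A : Q.Connection) {ε : ∀ x : M, TM M x →ₗ[ℝ] Q.AdFiber x}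
    (hε : ε ∈ Q.smoothHom E7 (TM M)) (x : M) (u : SM M x) :
    G.dirac nablaS t A (G.mulEta ε) x u =
      u.1 • G.dAstar nabla A ε x + G.cliffFormVal x 2 (dA A ε x) (eta x) u +
        ((t + 5) / 2) • ε x u.2 := by
  have hC := G.isCross x
  rw [G.cliffFormVal_two_eta x _ _ (dA_frame hLC A ε x), dAstar_eq]
  simp only [dirac, cliffHom, LinearMap.coe_sum, Finset.sum_apply, LinearMap.neg_apply, LinearMap.comp_apply,
    twistedCov_mulEta hS hLC hG t A hε, cliff_apply]
  have h1 := G.sum_frame x (ε x) u.2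
  have h2 : ∑ a, ε x (G.crossL x (G.frame x a) (G.crossL x (G.frame x a) u.2)) = (-6 : ℝ) • ε x u.2 := by
    rw [← map_sum, hC.sum_cross_cross, map_smul]
  have h3 : ∀ a, ∑ b, inner ℝ (G.frame x b) (-(u.1 • G.frame x a + G.crossL x (G.frame x a) u.2)) •
      G.covComp nabla A ε x a b = -(u.1 • G.covComp nabla A ε x a a) -
        ∑ b, inner ℝ (G.frame x b) (G.crossL x (G.frame x a) u.2) • G.covComp nabla A ε x a b := by
    intro a
    have h : ∀ b, inner ℝ (G.frame x b) (-(u.1 • G.frame x a + G.crossL x (G.frame x a) u.2)) •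
        G.covComp nabla A ε x a b = -(if b = a then u.1 • G.covComp nabla A ε x a b else 0) -
          inner ℝ (G.frame x b) (G.crossL x (G.frame x a) u.2) • G.covComp nabla A ε x a b := by
      intro b
      rw [inner_neg_right, inner_add_right, real_inner_smul_right, (G.frame x).inner_eq_ite]
      split_ifs
      · module
      · module
    simp only [h, Finset.sum_sub_distrib, Finset.sum_neg_distrib, Finset.sum_ite_eq', Finset.mem_univ, if_true]
  simp only [h3, map_neg, map_add, map_smul, hC.self_eq_zero, smul_zero, zero_add]
  have h4 : ∀ a, -((inner ℝ (G.frame x a) u.2 * ((1 + t) / 2)) • ε x (G.frame x a) -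
      (-(u.1 • G.covComp nabla A ε x a a) -
        ∑ b, inner ℝ (G.frame x b) (G.crossL x (G.frame x a) u.2) • G.covComp nabla A ε x a b) -
      (1 / 2 + t / 6) • -ε x (G.crossL x (G.frame x a) (G.crossL x (G.frame x a) u.2))) =
      -((1 + t) / 2) • (inner ℝ (G.frame x a) u.2 • ε x (G.frame x a)) - u.1 • G.covComp nabla A ε x a a -
        ∑ b, inner ℝ (G.frame x b) (G.crossL x (G.frame x a) u.2) • G.covComp nabla A ε x a b -
        (1 / 2 + t / 6) • ε x (G.crossL x (G.frame x a) (G.crossL x (G.frame x a) u.2)) := by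
    intro a
    module
  simp only [h4, Finset.sum_sub_distrib, ← Finset.smul_sum]
  rw [h1, h2]
  module

end G2Structure
end Dirac

/-! ### Infinitesimal deformations, ellipticity and the kernel -/

section Deformations
variable {M : Type*} [TopologicalSpace M] [ChartedSpace E7 M] [IsManifold 𝓘(ℝ, E7) ∞ M]
  [RiemannianBundle (TM M)] [IsContMDiffRiemannianBundle 𝓘(ℝ, E7) ∞ E7 (TM M)]
  {EK : Type*} [NormedAddCommGroup EK] [NormedSpace ℝ EK]
  {EP : Type*} [NormedAddCommGroup EP] [NormedSpace ℝ EP]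
  {K P : Type*} [TopologicalSpace K] [ChartedSpace EK K] [Group K] [LieGroup 𝓘(ℝ, EK) ∞ K]
  [TopologicalSpace P] [ChartedSpace EP P] [IsManifold 𝓘(ℝ, EP) ∞ P]
  {Q : PrincipalBundle E7 EK EP M K P}
  {nabla : CovariantDerivative 𝓘(ℝ, E7) E7 (TM M)}
  {nablaS : CovariantDerivative 𝓘(ℝ, E7) (ℝ × E7) (SM M)}

namespace G2Structure
variable {G : G2Structure M}

/-- The two deformation equations are the two components of the eigenvalue equation for `ε · η`: at `u = (1, 0)` it is
`(d^A)^* ε = 0`, and at `u = (0, Y)` it is `((d^A ε) · η)(Y) = 0`. -/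
theorem isDeformation_iff (hS : G.IsSpinConnection nabla nablaS) (hLC : IsLeviCivita nabla)
    (hG : G.IsNearlyParallel 4) (t : ℝ) (A : Q.Connection) {ε : ∀ x : M, TM M x →ₗ[ℝ] Q.AdFiber x}
    (hε : ε ∈ Q.smoothHom E7 (TM M)) :
    G.IsDeformation nabla A ε ↔
      ∀ x, G.dirac nablaS t A (G.mulEta ε) x = (-((t + 5) / 2)) • G.mulEta ε x := by
  refine forall_congr' fun x => ?_
  have hD := dirac_mulEta hS hLC hG t A hε x
  constructor
  · rintro ⟨h1, h2⟩
    refine LinearMap.ext fun u => ?_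
    rw [hD, h1, h2, LinearMap.smul_apply, mulEta_apply, LinearMap.zero_apply]
    module
  · intro h
    have key : ∀ u : SM M x, u.1 • G.dAstar nabla A ε x + G.cliffFormVal x 2 (dA A ε x) (eta x) u = 0 := by
      intro u
      have h1 := (hD u).symm.trans (congrArg (fun L : SM M x →ₗ[ℝ] Q.AdFiber x => L u) h)
      rw [LinearMap.smul_apply, mulEta_apply] at h1
      linear_combination (norm := module) h1
    -- the value at `u` of `(d^A ε) · η` depends only on the vector part of `u`
    have hβ : ∀ u : SM M x, G.cliffFormVal x 2 (dA A ε x) (eta x) u =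
        G.cliffFormVal x 2 (dA A ε x) (eta x) ((0 : ℝ), u.2) := by
      intro u
      rw [G.cliffFormVal_two_eta x _ _ (dA_frame hLC A ε x), G.cliffFormVal_two_eta x _ _ (dA_frame hLC A ε x)]
    have h0 : G.cliffFormVal x 2 (dA A ε x) (eta x) = 0 := by
      refine LinearMap.ext fun u => ?_
      have h1 := key ((0 : ℝ), u.2)
      rw [zero_smul, zero_add] at h1
      rw [hβ, h1, LinearMap.zero_apply]
    refine ⟨h0, ?_⟩
    have h1 := key ((1 : ℝ), 0)
    rwa [h0, LinearMap.zero_apply, add_zero, one_smul] at h1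

theorem twistedCov_fun_smul (t : ℝ) (A : Q.Connection) {f : M → ℝ} {s : ∀ x : M, SM M x →ₗ[ℝ] Q.AdFiber x} {x : M}
    (hf : MDifferentiableAt 𝓘(ℝ, E7) 𝓘(ℝ, ℝ) f x) (hs : s ∈ Q.smoothHom (ℝ × E7) (SM M)) (X : TM M x) :
    G.twistedCov nablaS t A (fun y => f y • s y) x X =
      f x • G.twistedCov nablaS t A s x X + mvfderiv 𝓘(ℝ, E7) f x X • s x := by
  refine LinearMap.ext fun u => ?_
  have h := fun w : SM M x => A.cov_fun_smul hf (PrincipalBundle.smoothAdAt_extend hs x w) X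
  simp only [twistedCov, LinearMap.add_apply, LinearMap.smul_apply, LinearMap.coe_sum, Finset.sum_apply,
    LinearMap.smulRight_apply, h, FiberBundle.extend_apply_self]
  rw [← sum_spinFrame (G := G) x (s x) u, Finset.smul_sum, Finset.smul_sum, ← Finset.sum_add_distrib]
  refine Finset.sum_congr rfl fun b _ => ?_
  module

/-- The Clifford relation `Y · Y · u = -|Y|² u`. -/
theorem cliff_cliff (x : M) (Y : TM M x) (u : SM M x) :
    G.cliff x Y (G.cliff x Y u) = (-inner ℝ Y Y) • u := by
  have hC := G.isCross x
  simp only [cliff_apply]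
  refine Prod.ext ?_ ?_
  · have h : inner ℝ Y (G.crossL x Y u.2) = 0 := by
      rw [← hC.inner_left, hC.self_eq_zero, inner_zero_left]
    simp [inner_neg_right, inner_add_right, real_inner_smul_right, h]
    ring
  · simp only [map_neg, map_add, map_smul, hC.self_eq_zero, hC.cross_cross_self, smul_zero, Prod.smul_snd]
    module

/-- The principal symbol of the Dirac operator on `S ⊗ W = Hom(S, W)`: Clifford multiplication by the covector. -/
def diracSymbol (G : G2Structure M) (W : Type*) [AddCommGroup W] [Module ℝ W] (x : M) :
    (TM M x →L[ℝ] ℝ) →ₗ[ℝ] Module.End ℝ (SM M x →ₗ[ℝ] W) where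
  toFun ξ :=
    { toFun := fun s => ∑ a, ξ (G.frame x a) • G.cliffHom x (G.frame x a) s
      map_add' := fun s s' => by
        simp only [cliffHom, LinearMap.add_comp, neg_add, smul_add, Finset.sum_add_distrib]
      map_smul' := fun c s => by
        simp only [cliffHom, LinearMap.smul_comp, Finset.smul_sum, RingHom.id_apply]
        refine Finset.sum_congr rfl fun a _ => ?_
        module }
  map_add' ξ ξ' := by
    refine LinearMap.ext fun s => ?_
    simp only [_root_.add_apply, add_smul, Finset.sum_add_distrib]
    rfl
  map_smul' c ξ := by
    refine LinearMap.ext fun s => ?_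
    simp only [_root_.smul_apply, smul_eq_mul, mul_smul]
    change _ = c • ∑ a, ξ (G.frame x a) • G.cliffHom x (G.frame x a) s
    rw [Finset.smul_sum]
    rfl

theorem diracSymbol_apply {W : Type*} [AddCommGroup W] [Module ℝ W] (x : M) (ξ : TM M x →L[ℝ] ℝ)
    (s : SM M x →ₗ[ℝ] W) :
    G.diracSymbol W x ξ s = G.cliffHom x (∑ a, ξ (G.frame x a) • G.frame x a) s := by
  refine LinearMap.ext fun u => ?_
  have h : G.cliff x (∑ a, ξ (G.frame x a) • G.frame x a) u =
      ∑ a, ξ (G.frame x a) • G.cliff x (G.frame x a) u := by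
    simp only [cliff_apply]
    refine Prod.ext ?_ ?_
    · simp [Prod.fst_sum, sum_inner, real_inner_smul_left]
    · rw [Prod.snd_sum]
      simp only [map_sum, map_smul, LinearMap.coe_sum, Finset.sum_apply, LinearMap.smul_apply, Finset.smul_sum,
        ← Finset.sum_add_distrib, ← Finset.sum_neg_distrib]
      refine Finset.sum_congr rfl fun a _ => ?_
      simp only [Prod.smul_snd]
      module
  simp only [diracSymbol, cliffHom, LinearMap.coe_mk, AddHom.coe_mk, LinearMap.coe_sum, Finset.sum_apply,
    LinearMap.smul_apply, LinearMap.neg_apply, LinearMap.comp_apply, h, map_sum, map_smul, smul_neg,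
    Finset.sum_neg_distrib]

/-- The square of the symbol is `-|ξ|²`. -/
theorem diracSymbol_bijective {W : Type*} [AddCommGroup W] [Module ℝ W] (x : M) {ξ : TM M x →L[ℝ] ℝ}
    (hξ : ξ ≠ 0) : Function.Bijective (G.diracSymbol W x ξ) := by
  set Y : TM M x := ∑ a, ξ (G.frame x a) • G.frame x a with hY
  have hY0 : (-inner ℝ Y Y : ℝ) ≠ 0 := by
    rw [neg_ne_zero]
    refine fun h => hξ ?_
    rw [inner_self_eq_zero] at h
    refine ContinuousLinearMap.ext fun v => ?_
    have h1 := G.sum_frame x ξ.toLinearMap v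
    have h2 : ξ v = inner ℝ Y v := by
      refine h1.symm.trans ?_
      simp [hY, sum_inner, real_inner_smul_left, mul_comm]
    rw [h2, h, inner_zero_left]
    rfl
  have hsq : ∀ s, G.diracSymbol W x ξ (G.diracSymbol W x ξ s) = (-inner ℝ Y Y : ℝ) • s := by
    intro s
    rw [diracSymbol_apply, diracSymbol_apply]
    refine LinearMap.ext fun u => ?_
    simp only [cliffHom, LinearMap.neg_apply, LinearMap.comp_apply, neg_neg, LinearMap.smul_apply]
    rw [cliff_cliff, map_smul]
  constructor
  · intro s s' h
    have h1 := (hsq s).symm.trans ((congrArg (G.diracSymbol W x ξ) h).trans (hsq s'))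
    exact smul_right_injective _ hY0 h1
  · intro s
    refine ⟨(-inner ℝ Y Y : ℝ)⁻¹ • G.diracSymbol W x ξ s, ?_⟩
    rw [map_smul, hsq, smul_smul, inv_mul_cancel₀ hY0, one_smul]

theorem isElliptic_diracShift (A : Q.Connection) : IsElliptic Q (G.diracShift nablaS A) := by
  refine ⟨fun x => G.diracSymbol (Q.AdFiber x) x, fun f hf s hs x => ?_, fun x ξ hξ => diracSymbol_bijective x hξ⟩
  have h := fun a => twistedCov_fun_smul (G := G) (nablaS := nablaS) (-1) A ((hf x).mdifferentiableAt (by simp)) hs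
    (G.frame x a)
  refine LinearMap.ext fun u => ?_
  simp only [diracShift, dirac, diracSymbol, cliffHom, h, LinearMap.coe_mk, AddHom.coe_mk, LinearMap.sub_apply,
    LinearMap.add_apply, LinearMap.smul_apply, LinearMap.coe_sum, Finset.sum_apply, LinearMap.neg_apply,
    LinearMap.comp_apply]
  rw [smul_add, Finset.smul_sum, smul_comm (f x) (2 : ℝ), add_sub_add_right_eq_sub, ← Finset.sum_sub_distrib]
  refine Finset.sum_congr rfl fun a _ => ?_
  module

theorem mulEta_mem_smoothHom {ε : ∀ x : M, TM M x →ₗ[ℝ] Q.AdFiber x} (hε : ε ∈ Q.smoothHom E7 (TM M)) :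
    G.mulEta ε ∈ Q.smoothHom (ℝ × E7) (SM M) := by
  have h : G.mulEta ε = (-1 : ℝ) • fun x => ε x ∘ₗ LinearMap.snd ℝ ℝ (TM M x) := by
    funext x
    refine LinearMap.ext fun u => ?_
    rw [mulEta_apply]
    change _ = (-1 : ℝ) • ε x u.2
    module
  rw [h]
  exact Submodule.smul_mem _ _ fun x u hu => hε x _ (smoothVF_snd hu)

/-- The map `ε ↦ ε · η` from the infinitesimal deformations to the kernel of `D^{-1,A} + 2`. -/
def deformationsToKernel (hS : G.IsSpinConnection nabla nablaS) (hLC : IsLeviCivita nabla)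
    (hG : G.IsNearlyParallel 4) (A : Q.Connection) : G.deformations nabla A →ₗ[ℝ] G.diracKernel nablaS A where
  toFun ε := ⟨G.mulEta ε.1, mulEta_mem_smoothHom ε.2.1, fun x => ⟨ε.1 x, rfl⟩, fun x => by
    rw [diracShift, (isDeformation_iff hS hLC hG (-1) A ε.2.1).1 ε.2.2 x, ← add_smul]
    norm_num⟩
  map_add' ε ε' := Subtype.ext (funext fun x => LinearMap.ext fun u => by
    change G.mulEta (ε.1 + ε'.1) x u = G.mulEta ε.1 x u + G.mulEta ε'.1 x u
    simp only [mulEta_apply, Pi.add_apply, LinearMap.add_apply, neg_add])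
  map_smul' c ε := Subtype.ext (funext fun x => LinearMap.ext fun u => by
    change G.mulEta (c • ε.1) x u = c • G.mulEta ε.1 x u
    simp only [mulEta_apply, Pi.smul_apply, LinearMap.smul_apply, smul_neg])

theorem deformationsToKernel_bijective (hS : G.IsSpinConnection nabla nablaS) (hLC : IsLeviCivita nabla)
    (hG : G.IsNearlyParallel 4) (A : Q.Connection) :
    Function.Bijective (deformationsToKernel hS hLC hG A) := by
  constructor
  · intro ε ε' h
    refine Subtype.ext (funext fun x => LinearMap.ext fun Y => ?_)
    have h1 : G.mulEta ε.1 x ((0 : ℝ), Y) = G.mulEta ε'.1 x ((0 : ℝ), Y) :=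
      congrArg (fun s : G.diracKernel nablaS A => s.1 x ((0 : ℝ), Y)) h
    rw [mulEta_apply, mulEta_apply] at h1
    exact neg_injective h1
  · rintro ⟨s, hs, hα, hD⟩
    let ε : ∀ x : M, TM M x →ₗ[ℝ] Q.AdFiber x := (-1 : ℝ) • fun x => s x ∘ₗ LinearMap.inr ℝ ℝ (TM M x)
    have hε : ε ∈ Q.smoothHom E7 (TM M) := by
      refine Submodule.smul_mem _ _ fun x Y hY => hs x _ ?_
      exact contMDiffAt_pair contMDiffAt_const hY
    have hsε : G.mulEta ε = s := by
      funext x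
      refine LinearMap.ext fun u => ?_
      obtain ⟨α, h⟩ := hα x
      rw [mulEta_apply]
      change -((-1 : ℝ) • s x ((0 : ℝ), u.2)) = s x u
      rw [h, cliffFormVal_one_eta, cliffFormVal_one_eta]
      module
    refine ⟨⟨ε, hε, (isDeformation_iff hS hLC hG (-1) A hε).2 fun x => ?_⟩, Subtype.ext hsε⟩
    have h := hD x
    rw [diracShift, ← hsε] at h
    refine LinearMap.ext fun u => ?_
    have h1 := congrArg (fun L : SM M x →ₗ[ℝ] Q.AdFiber x => L u) h
    simp only [LinearMap.add_apply, LinearMap.smul_apply, LinearMap.zero_apply] at h1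
    rw [LinearMap.smul_apply]
    linear_combination (norm := module) h1

end G2Structure
end Deformations

end

end NearlyG2

theorem theorem3p3
    {M : Type*} [TopologicalSpace M] [T2Space M] [SecondCountableTopology M]
    [ChartedSpace NearlyG2.E7 M] [IsManifold 𝓘(ℝ, NearlyG2.E7) ∞ M]
    [RiemannianBundle (NearlyG2.TM M)]
    [IsContMDiffRiemannianBundle 𝓘(ℝ, NearlyG2.E7) ∞ NearlyG2.E7 (NearlyG2.TM M)]
    {EK : Type*} [NormedAddCommGroup EK] [NormedSpace ℝ EK] [FiniteDimensional ℝ EK]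
    {EP : Type*} [NormedAddCommGroup EP] [NormedSpace ℝ EP] [FiniteDimensional ℝ EP]
    {K : Type*} [TopologicalSpace K] [ChartedSpace EK K] [Group K] [LieGroup 𝓘(ℝ, EK) ∞ K]
    {P : Type*} [TopologicalSpace P] [ChartedSpace EP P] [IsManifold 𝓘(ℝ, EP) ∞ P]
    (G : NearlyG2.G2Structure M) (hG : G.IsNearlyParallel 4)
    (nabla : CovariantDerivative 𝓘(ℝ, NearlyG2.E7) NearlyG2.E7 (NearlyG2.TM M))
    (hLC : NearlyG2.IsLeviCivita nabla)
    (nablaS : CovariantDerivative 𝓘(ℝ, NearlyG2.E7) (ℝ × NearlyG2.E7) (NearlyG2.SM M))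
    (hS : G.IsSpinConnection nabla nablaS)
    (Q : NearlyG2.PrincipalBundle NearlyG2.E7 EK EP M K P) (A : Q.Connection)
    (hA : G.IsInstanton A) :
    (∀ t : ℝ, ∀ ε ∈ Q.smoothHom NearlyG2.E7 (NearlyG2.TM M),
      G.IsDeformation nabla A ε ↔
        ∀ x, G.dirac nablaS t A (G.mulEta ε) x = (-((t + 5) / 2)) • G.mulEta ε x) ∧
    NearlyG2.IsElliptic Q (G.diracShift nablaS A) ∧
    ∃ e : G.deformations nabla A ≃ₗ[ℝ] G.diracKernel nablaS A,
      ∀ (ε : G.deformations nabla A) (x : M), (e ε).1 x = G.mulEta ε.1 x :=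
  ⟨fun t _ hε => NearlyG2.G2Structure.isDeformation_iff hS hLC hG t A hε,
    NearlyG2.G2Structure.isElliptic_diracShift A,
    LinearEquiv.ofBijective (NearlyG2.G2Structure.deformationsToKernel hS hLC hG A)
      (NearlyG2.G2Structure.deformationsToKernel_bijective hS hLC hG A), fun _ _ => rfl⟩
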